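/- Write $\lg=\log_2$, $h_2(x)=-x\lg x-(1-x)\lg(1-x)$, and let $\gamma=\gamma(G)=|E(G)|/\binom n2$ be the edge density of a graph $G$ on the vertex set $\{0,\dots,n-1\}$. The model of computation is a word RAM with words of $w\ge b\lg n$ bits ($b$ a constant depending on the program): arithmetic on words, comparisons, array accesses, and adjacency queries "is $uv\in E(G)$?" (adjacency matrix representation of the input) take unit time. The program is given $n$ and query access to $G$; it is not given $\gamma$. A randomized program can moreover sample a uniformly random element of $\{0,\dots,k-1\}$ in unit time. A biclique $K_{t,t}$ of $G$ consists of two disjoint sets of $t$ vertices such that each vertex of the first is adjacent to each vertex of the second. **Theorem.** (1) There are a randomized program using only adjacency queries and an absolute constant $C>0$ such that the following holds. For every $\eta:\mathbb N\to\mathbb R$ with $\eta(n)\to0$ there is $\delta:\mathbb N\to\mathbb R$ with $\delta(n)\to 0$ such that, for all sufficiently large $n$ and every $n$-vertex graph $G$ with $0<\gamma<1$ and $\max\{\gamma^{-1},(1-\gamma)^{-1}\}\le n^{\eta(n)}$, the program always halts within $C\,\frac{n\lg n}{h_2(\gamma)}\le n^{1+\delta(n)}$ steps, and with probability at least $1-\delta(n)$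 it outputs a biclique $K_{t,t}$ of $G$ with $$(1-\delta(n))\,\frac{\gamma\lg n}{h_2(\gamma)}\le t\le(1+\delta(n))\,\frac{\gamma\lg n}{h_2(\gamma)} .$$ (2) If in addition the degree of a vertex can be queried in unit time, there are a deterministic program and an absolute constant $C>0$ for which, under the same hypotheses and with the same quantification over $\eta,\delta,n,G$, the program halts within $C\,\frac{n\lg n}{h_2(\gamma)}\le n^{1+\delta(n)}$ steps and always outputs a biclique $K_{t,t}$ of $G$ with $t$ in the above range. -/

import Mathlib

open Filter Topology

namespace BicliqueRAM

/-! ## Graph-theoretic notions -/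

/-- Adjacency in a graph on `{0, …, n-1}`, as a relation between natural numbers
(numbers that are not vertices are adjacent to nothing). -/
def NatAdj {n : ℕ} (G : SimpleGraph (Fin n)) (i j : ℕ) : Prop :=
  ∃ (hi : i < n) (hj : j < n), G.Adj ⟨i, hi⟩ ⟨j, hj⟩

/-- The degree of vertex `i` (and `0` if `i` is not a vertex). -/
noncomputable def natDegree {n : ℕ} (G : SimpleGraph (Fin n)) (i : ℕ) : ℕ :=
  Set.ncard {j : ℕ | NatAdj G i j}

/-- The edge density `|E(G)| / (n choose 2)`. -/
noncomputable def density {n : ℕ} (G : SimpleGraph (Fin n)) : ℝ :=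
  (G.edgeSet.ncard : ℝ) / (n.choose 2 : ℝ)

/-- The binary entropy function in bits, `h₂(x) = -x lg x - (1-x) lg (1-x)`. -/
noncomputable def h2 (x : ℝ) : ℝ :=
  -x * Real.logb 2 x - (1 - x) * Real.logb 2 (1 - x)

/-! ## A word RAM with query access to the adjacency matrix of a graph

A program is a structured program over registers and finitely many arrays (the registers and
arrays that occur in the program), all of which are indexed by natural-number names fixed in the
program text. Registers and array cells hold `w`-bit words, and array cells are addressed by
words. Each elementary instruction, and each evaluation of a branching or loop condition, takes
one unit of time. -/

/-- The arithmetic and comparison operations of the machine. -/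
inductive Op where
  | add | sub | mul | div | mod | lt | eq

/-- The value of an operation, before truncation to a word. Subtraction is truncated at `0`,
`div` and `mod` are quotient and remainder (with the conventions `x / 0 = 0`, `x % 0 = x`),
comparisons yield `0` or `1`. -/
def Op.eval : Op → ℕ → ℕ → ℕ
  | .add, x, y => x + y
  | .sub, x, y => x - y
  | .mul, x, y => x * y
  | .div, x, y => x / y
  | .mod, x, y => x % y
  | .lt, x, y => if x < y then 1 else 0
  | .eq, x, y => if x = y then 1 else 0

/-- Programs. Lower-case `x y z` stand for registers and `a` for an array. -/
inductive Prog where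
  /-- do nothing -/
  | skip : Prog
  /-- `x := v` -/
  | const (x v : ℕ) : Prog
  /-- `x := y op z` -/
  | arith (o : Op) (x y z : ℕ) : Prog
  /-- `x := a[y]` -/
  | load (x a y : ℕ) : Prog
  /-- `a[x] := y` -/
  | store (a x y : ℕ) : Prog
  /-- `x := 1` if the vertices `y` and `z` are adjacent in the input graph, else `x := 0` -/
  | adj (x y z : ℕ) : Prog
  /-- `x :=` the degree of vertex `y` in the input graph -/
  | deg (x y : ℕ) : Prog
  /-- `x :=` a fresh uniformly random element of `{0, …, y - 1}` (and `x := 0` if `y = 0`) -/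
  | rand (x y : ℕ) : Prog
  /-- first `p`, then `q` -/
  | seq (p q : Prog) : Prog
  /-- if `y ≠ 0` then `p` else `q` -/
  | ite (y : ℕ) (p q : Prog) : Prog
  /-- while `y ≠ 0` do `p` -/
  | loop (y : ℕ) (p : Prog) : Prog

/-- The program never queries a degree. -/
def Prog.DegFree : Prog → Prop
  | .deg _ _ => False
  | .seq p q => p.DegFree ∧ q.DegFree
  | .ite _ p q => p.DegFree ∧ q.DegFree
  | .loop _ p => p.DegFree
  | _ => True

/-- The program uses no randomness, i.e. it is deterministic. -/
def Prog.RandFree : Prog → Prop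
  | .rand _ _ => False
  | .seq p q => p.RandFree ∧ q.RandFree
  | .ite _ p q => p.RandFree ∧ q.RandFree
  | .loop _ p => p.RandFree
  | _ => True

/-- The memory contents: `reg x` is register `x`, and `arr a i` is cell `i` of array `a`. -/
structure Mem where
  reg : ℕ → ℕ
  arr : ℕ → ℕ → ℕ

/-- Write (the low-order `w` bits of) `v` to register `x`. -/
def Mem.setReg (w : ℕ) (s : Mem) (x v : ℕ) : Mem :=
  { s with reg := Function.update s.reg x (v % 2 ^ w) }

/-- Write (the low-order `w` bits of) `v` to cell `i` of array `a`. -/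
def Mem.setArr (w : ℕ) (s : Mem) (a i v : ℕ) : Mem :=
  { s with arr := Function.update s.arr a (Function.update (s.arr a) i (v % 2 ^ w)) }

/-- The initial memory: register `0` holds the number `n` of vertices, all else is `0`. -/
def Mem.init (w n : ℕ) : Mem :=
  Mem.setReg w { reg := fun _ => 0, arr := fun _ _ => 0 } 0 n

/-- A configuration: the list of programs still to be executed, in order, and the memory. -/
structure Config where
  todo : List Prog
  mem : Mem

/-- The machine has halted if nothing is left to be executed. -/
def Config.Halted (c : Config) : Prop := c.todo = []

/-- A uniformly random element of `{0, …, k - 1}`; it is `0` if `k = 0`. -/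
noncomputable def uniformBelow (k : ℕ) : PMF ℕ :=
  if h : (Finset.range k).Nonempty then PMF.uniformOfFinset (Finset.range k) h else PMF.pure 0

open Classical in
/-- One unit of time of the machine with word length `w` on the input graph `G`: the
distribution of the next configuration. A halted machine stays as it is. -/
noncomputable def step (w : ℕ) {n : ℕ} (G : SimpleGraph (Fin n)) : Config → PMF Config
  | ⟨[], s⟩ => PMF.pure ⟨[], s⟩
  | ⟨.skip :: k, s⟩ => PMF.pure ⟨k, s⟩
  | ⟨.const x v :: k, s⟩ => PMF.pure ⟨k, s.setReg w x v⟩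
  | ⟨.arith o x y z :: k, s⟩ => PMF.pure ⟨k, s.setReg w x (o.eval (s.reg y) (s.reg z))⟩
  | ⟨.load x a y :: k, s⟩ => PMF.pure ⟨k, s.setReg w x (s.arr a (s.reg y))⟩
  | ⟨.store a x y :: k, s⟩ => PMF.pure ⟨k, s.setArr w a (s.reg x) (s.reg y)⟩
  | ⟨.adj x y z :: k, s⟩ =>
      PMF.pure ⟨k, s.setReg w x (if NatAdj G (s.reg y) (s.reg z) then 1 else 0)⟩
  | ⟨.deg x y :: k, s⟩ => PMF.pure ⟨k, s.setReg w x (natDegree G (s.reg y))⟩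
  | ⟨.rand x y :: k, s⟩ => (uniformBelow (s.reg y)).map fun v => ⟨k, s.setReg w x v⟩
  | ⟨.seq p q :: k, s⟩ => PMF.pure ⟨p :: q :: k, s⟩
  | ⟨.ite y p q :: k, s⟩ => PMF.pure (if s.reg y ≠ 0 then ⟨p :: k, s⟩ else ⟨q :: k, s⟩)
  | ⟨.loop y p :: k, s⟩ => PMF.pure (if s.reg y ≠ 0 then ⟨p :: .loop y p :: k, s⟩ else ⟨k, s⟩)

/-- The distribution of the configuration after `T` units of time, started from `c`. -/
noncomputable def steps (w : ℕ) {n : ℕ} (G : SimpleGraph (Fin n)) : ℕ → Config → PMF Config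
  | 0, c => PMF.pure c
  | T + 1, c => (step w G c).bind (steps w G T)

/-- The distribution of the configuration after running program `P` for `T` units of time on
the input graph `G`, with word length `w`. -/
noncomputable def runFor (P : Prog) (w : ℕ) {n : ℕ} (G : SimpleGraph (Fin n)) (T : ℕ) :
    PMF Config :=
  steps w G T ⟨[P], Mem.init w n⟩

/-- The size `t` of the output of a computation, which is stored in register `0`. -/
def outSize (c : Config) : ℕ := c.mem.reg 0

/-- The output of a halted computation is a biclique `K_{t,t}` of `G`, where `t = outSize c`:
the first `t` cells of array `0` list `t` distinct vertices, the first `t` cells of array `1`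
list `t` distinct vertices, and each of the former is adjacent to each of the latter
(so that the two sides are disjoint). -/
def OutputsBiclique {n : ℕ} (G : SimpleGraph (Fin n)) (c : Config) : Prop :=
  (∀ i < outSize c, c.mem.arr 0 i < n ∧ c.mem.arr 1 i < n) ∧
  Set.InjOn (c.mem.arr 0) (Set.Iio (outSize c)) ∧
  Set.InjOn (c.mem.arr 1) (Set.Iio (outSize c)) ∧
  ∀ i < outSize c, ∀ j < outSize c, NatAdj G (c.mem.arr 0 i) (c.mem.arr 1 j)

/-- The target size `γ lg n / h₂(γ)` for the density `γ` of `G`. -/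
noncomputable def targetSize {n : ℕ} (G : SimpleGraph (Fin n)) : ℝ :=
  density G * Real.logb 2 n / h2 (density G)

/-- The machine has halted with a biclique `K_{t,t}` of `G` as output, where
`(1 - δ) γ lg n / h₂(γ) ≤ t ≤ (1 + δ) γ lg n / h₂(γ)`. -/
def Succeeds {n : ℕ} (G : SimpleGraph (Fin n)) (δ : ℝ) (c : Config) : Prop :=
  c.Halted ∧ OutputsBiclique G c ∧ |(outSize c : ℝ) - targetSize G| ≤ δ * targetSize G

/-- The time bound `C n lg n / h₂(γ)` for the density `γ` of `G`. -/
noncomputable def timeBound (C : ℝ) {n : ℕ} (G : SimpleGraph (Fin n)) : ℝ :=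
  C * ((n : ℝ) * Real.logb 2 n / h2 (density G))

/-- The density `γ` of `G` lies in `(0, 1)` and `max {1/γ, 1/(1-γ)} ≤ n ^ e`. -/
def DensityBounded {n : ℕ} (G : SimpleGraph (Fin n)) (e : ℝ) : Prop :=
  0 < density G ∧ density G < 1 ∧ max (density G)⁻¹ (1 - density G)⁻¹ ≤ (n : ℝ) ^ e

end BicliqueRAM

/-! Let `p` be the density (or an estimate of it), `L = log n`, and `H` the entropy of `p` in nats.
Take `r` slightly below `L / H` candidate vertices on the left with total degree about `r * p * n`
or more, and let `t` be slightly below `p * r`. On average a vertex has about `p * r` neighbours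
among the candidates, so a proportion of order `p * (1 - p) / k` of the vertices has at least `t` of
them (`GoodParams.card_le`). The key of such a vertex is the set of its first `t` neighbours among
the candidates. There are only `r.choose t` keys, about `exp (r * H)`, and the margin `3 * (L / k)`
left in `r * H` makes this so much smaller than `n` that `t` vertices share a key
(`exists_common_key`); they and their key form a `K_{t,t}`. The accuracy `k` tends to infinity, but
slowly: `k ^ 3 * max (log p⁻¹) (log (1 - p)⁻¹) = O(L)`.

Keys are stored in a binary trie, so a vertex is classified in `O(r)` steps. The deterministic
program gets the exact density from the degrees, takes a vertex of maximal degree from each of `r`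
blocks as left candidates, and classifies all `n` vertices in time `O(n * r)`. The randomized
program estimates the density from `n` sampled pairs, takes one random vertex from each of `r`
blocks of length `q = n / r` on the left, and classifies only `q` vertices, one random vertex from
each of `q` blocks of length `r`. This takes `O(n)` steps, and Chebyshev's inequality, used for the
density and for each side, shows that it rarely fails (`avgFill_edgeCount`,
`GoodParams.avgFill_forced`).

The machine has no logarithms. The number `R` of multiplications by `p` that bring `n²` down to `n`
is about `L / log p⁻¹`; with `R'` defined likewise from `1 - p`, the harmonic mean of `R` and `R'`
with weights `p` and `1 - p` is about `L / H`, and `r` is computed from it.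

Deterministic program fragments are handled by `Run`, success probabilities by `val`, and random
arrays by iterated averages `avgFill`. Everything is first proved for a fixed error `ε` and a fixed
exponent; `exists_vanishing` then produces `δ`. -/

namespace BicliqueRAM

section Semantics

variable {w n : ℕ} {G : SimpleGraph (Fin n)}

/-! ## Deterministic execution -/

/-- Started in memory `s`, the program `P` takes exactly `τ` steps, without random choices,
and ends in memory `s'`. -/
def Exec (w : ℕ) {n : ℕ} (G : SimpleGraph (Fin n)) (P : Prog) (s : Mem) (τ : ℕ) (s' : Mem) :
    Prop :=
  ∀ k T, steps w G (T + τ) ⟨P :: k, s⟩ = steps w G T ⟨k, s'⟩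

/-- Started in memory `s`, the program `P` ends deterministically, within `B` steps, in a memory
that satisfies `Q`. -/
def Run (w : ℕ) {n : ℕ} (G : SimpleGraph (Fin n)) (P : Prog) (s : Mem) (B : ℕ) (Q : Mem → Prop) :
    Prop :=
  ∃ τ ≤ B, ∃ s', Exec w G P s τ s' ∧ Q s'

theorem steps_succ_of_step {c c' : Config} (h : step w G c = PMF.pure c') (T : ℕ) :
    steps w G (T + 1) c = steps w G T c' := by
  rw [steps, h, PMF.pure_bind]

theorem Exec.seq {p q : Prog} {s s' s'' : Mem} {τ τ' : ℕ} (hp : Exec w G p s τ s')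
    (hq : Exec w G q s' τ' s'') : Exec w G (.seq p q) s (τ + τ' + 1) s'' := by
  intro k T
  rw [show T + (τ + τ' + 1) = (T + τ' + τ) + 1 by ring,
    steps_succ_of_step (c' := ⟨p :: q :: k, s⟩) (by simp [step]), hp, hq]

theorem Run.mono {P : Prog} {s : Mem} {B B' : ℕ} {Q Q' : Mem → Prop} (h : Run w G P s B Q)
    (hB : B ≤ B') (hQ : ∀ s', Q s' → Q' s') : Run w G P s B' Q' := by
  obtain ⟨τ, hτ, s', he, hs⟩ := h
  exact ⟨τ, hτ.trans hB, s', he, hQ _ hs⟩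

theorem Run.seq {p q : Prog} {s : Mem} {B B' : ℕ} {Q R : Mem → Prop} (hp : Run w G p s B Q)
    (hq : ∀ s', Q s' → Run w G q s' B' R) : Run w G (.seq p q) s (B + B' + 1) R := by
  obtain ⟨τ, hτ, s', he, hs⟩ := hp
  obtain ⟨τ', hτ', s'', he', hs'⟩ := hq s' hs
  exact ⟨_, by omega, s'', he.seq he', hs'⟩

theorem Exec.loop_done {y : ℕ} {p : Prog} {s : Mem} (h : s.reg y = 0) :
    Exec w G (.loop y p) s 1 s := by
  intro k T
  rw [steps_succ_of_step (c' := ⟨k, s⟩) (by simp [step, h])]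

theorem Exec.loop_more {y : ℕ} {p : Prog} {s s' s'' : Mem} {τ τ' : ℕ} (h : s.reg y ≠ 0)
    (hp : Exec w G p s τ s') (hq : Exec w G (.loop y p) s' τ' s'') :
    Exec w G (.loop y p) s (τ + τ' + 1) s'' := by
  intro k T
  rw [show T + (τ + τ' + 1) = (T + τ' + τ) + 1 by ring,
    steps_succ_of_step (c' := ⟨p :: .loop y p :: k, s⟩) (by simp [step, h]), hp, hq]

/-- The invariant is indexed by the number of completed rounds and the number `N` of rounds is known
in advance, so termination needs no separate argument. The loop test costs one unit per round and
one more at the end. -/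
theorem Run.loop {y : ℕ} {p : Prog} {B : ℕ} (I : ℕ → Mem → Prop) (N : ℕ)
    (hmore : ∀ i < N, ∀ s, I i s → s.reg y ≠ 0 ∧ Run w G p s B (I (i + 1)))
    (hdone : ∀ s, I N s → s.reg y = 0) {s : Mem} (h0 : I 0 s) :
    Run w G (.loop y p) s (N * (B + 1) + 1) (I N) := by
  suffices h : ∀ m i, i + m = N → ∀ s, I i s → Run w G (.loop y p) s (m * (B + 1) + 1) (I N) from
    h N 0 (by omega) s h0
  intro m
  induction m with
  | zero =>
    intro i hi s hs
    obtain rfl : i = N := by omega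
    exact ⟨1, by omega, s, Exec.loop_done (hdone s hs), hs⟩
  | succ m ih =>
    intro i hi s hs
    obtain ⟨hy, τ, hτ, s', he, hs'⟩ := hmore i (by omega) s hs
    obtain ⟨τ', hτ', s'', he', hs''⟩ := ih (i + 1) (by omega) s' hs'
    exact ⟨_, by nlinarith, s'', Exec.loop_more hy he he', hs''⟩

/-- Write `v` to register `x`. -/
def Mem.put (s : Mem) (x v : ℕ) : Mem := { s with reg := Function.update s.reg x v }

/-- Write `v` to cell `i` of array `a`. -/
def Mem.putArr (s : Mem) (a i v : ℕ) : Mem :=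
  { s with arr := Function.update s.arr a (Function.update (s.arr a) i v) }

@[simp] theorem Mem.put_reg (s : Mem) (x v y : ℕ) : (s.put x v).reg y = if y = x then v else s.reg y := by
  simp [Mem.put, Function.update_apply]

@[simp] theorem Mem.put_arr (s : Mem) (x v : ℕ) : (s.put x v).arr = s.arr := rfl

@[simp] theorem Mem.putArr_reg (s : Mem) (a i v : ℕ) : (s.putArr a i v).reg = s.reg := rfl

theorem Mem.putArr_arr (s : Mem) (a i v b j : ℕ) :
    (s.putArr a i v).arr b j = if b = a ∧ j = i then v else s.arr b j := by
  by_cases h : b = a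
  · subst h; simp [Mem.putArr, Function.update_apply]
  · simp [Mem.putArr, h]

theorem Mem.setReg_of_lt {s : Mem} {x v : ℕ} (h : v < 2 ^ w) : s.setReg w x v = s.put x v := by
  rw [Mem.setReg, Nat.mod_eq_of_lt h, Mem.put]

theorem Mem.setArr_of_lt {s : Mem} {a i v : ℕ} (h : v < 2 ^ w) :
    s.setArr w a i v = s.putArr a i v := by
  rw [Mem.setArr, Nat.mod_eq_of_lt h, Mem.putArr]

open Classical in
/-- The adjacency bit of `i` and `j`. -/
noncomputable def adjBit {n : ℕ} (G : SimpleGraph (Fin n)) (i j : ℕ) : ℕ :=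
  if NatAdj G i j then 1 else 0

theorem adjBit_le (i j : ℕ) : adjBit G i j ≤ 1 := by
  unfold adjBit; split <;> omega

/-- The result of a program without loops and randomness, ignoring truncation to words. -/
noncomputable def straight {n : ℕ} (G : SimpleGraph (Fin n)) : Prog → Mem → Mem
  | .const x v, s => s.put x v
  | .arith o x y z, s => s.put x (o.eval (s.reg y) (s.reg z))
  | .load x a y, s => s.put x (s.arr a (s.reg y))
  | .store a x y, s => s.putArr a (s.reg x) (s.reg y)
  | .adj x y z, s => s.put x (adjBit G (s.reg y) (s.reg z))
  | .deg x y, s => s.put x (natDegree G (s.reg y))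
  | .seq p q, s => straight G q (straight G p s)
  | .ite y p q, s => if s.reg y = 0 then straight G q s else straight G p s
  | _, s => s

/-- The program has no loops and no randomness, and does not write any value above the
word size when started in the given memory. -/
def Safe (w : ℕ) {n : ℕ} (G : SimpleGraph (Fin n)) : Prog → Mem → Prop
  | .skip, _ => True
  | .const _ v, _ => v < 2 ^ w
  | .arith o _ y z, s => o.eval (s.reg y) (s.reg z) < 2 ^ w
  | .load _ a y, s => s.arr a (s.reg y) < 2 ^ w
  | .store _ _ y, s => s.reg y < 2 ^ w
  | .adj _ _ _, _ => 1 < 2 ^ w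
  | .deg _ y, s => natDegree G (s.reg y) < 2 ^ w
  | .seq p q, s => Safe w G p s ∧ Safe w G q (straight G p s)
  | .ite y p q, s => (s.reg y = 0 → Safe w G q s) ∧ (s.reg y ≠ 0 → Safe w G p s)
  | _, _ => False

/-- An upper bound on the running time of a program without loops. -/
def cost : Prog → ℕ
  | .seq p q => cost p + cost q + 1
  | .ite _ p q => max (cost p) (cost q) + 1
  | _ => 1

theorem exec_one {p : Prog} {s s' : Mem} (h : ∀ k, step w G ⟨p :: k, s⟩ = PMF.pure ⟨k, s'⟩) :
    Exec w G p s 1 s' :=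
  fun k T => steps_succ_of_step (h k) T

/-- Reduces the verification of loop-free code to arithmetic: `Safe` collects the overflow
conditions, `straight` the final memory. -/
theorem run_straight (p : Prog) (s : Mem) (h : Safe w G p s) :
    Run w G p s (cost p) (fun s' => s' = straight G p s) := by
  induction p generalizing s with
  | skip => exact ⟨1, le_rfl, s, exec_one fun k => by simp [step], by simp [straight]⟩
  | const x v =>
    exact ⟨1, le_rfl, _, exec_one fun k => by simp [step], Mem.setReg_of_lt h⟩
  | arith o x y z =>
    exact ⟨1, le_rfl, _, exec_one fun k => by simp [step], Mem.setReg_of_lt h⟩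
  | load x a y =>
    exact ⟨1, le_rfl, _, exec_one fun k => by simp [step], Mem.setReg_of_lt h⟩
  | store a x y =>
    exact ⟨1, le_rfl, _, exec_one fun k => by simp [step], Mem.setArr_of_lt h⟩
  | adj x y z =>
    refine ⟨1, le_rfl, s.setReg w x (adjBit G (s.reg y) (s.reg z)), exec_one fun k => ?_,
      Mem.setReg_of_lt ((adjBit_le _ _).trans_lt h)⟩
    simp only [step, adjBit]
  | deg x y =>
    exact ⟨1, le_rfl, _, exec_one fun k => by simp [step], Mem.setReg_of_lt h⟩
  | rand x y => exact h.elim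
  | seq p q ihp ihq =>
    refine (ihp s h.1).seq fun s' hs' => ?_
    subst hs'
    exact ihq _ h.2
  | ite y p q ihp ihq =>
    by_cases hy : s.reg y = 0
    · obtain ⟨τ, hτ, s', he, rfl⟩ := ihq s (h.1 hy)
      refine ⟨τ + 1, by simp only [cost]; omega, straight G q s, fun k T => ?_, by simp [straight, hy]⟩
      rw [← add_assoc, steps_succ_of_step (c' := ⟨q :: k, s⟩) (by simp [step, hy]), he]
    · obtain ⟨τ, hτ, s', he, rfl⟩ := ihp s (h.2 hy)
      refine ⟨τ + 1, by simp only [cost]; omega, straight G p s, fun k T => ?_, by simp [straight, hy]⟩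
      rw [← add_assoc, steps_succ_of_step (c' := ⟨p :: k, s⟩) (by simp [step, hy]), he]
  | loop y p => exact h.elim

/-- Straight-line code, with the final memory substituted. -/
theorem Run.straight {p : Prog} {s : Mem} {B : ℕ} {Q : Mem → Prop} (h : Safe w G p s)
    (hB : cost p ≤ B) (hQ : Q (straight G p s)) : Run w G p s B Q :=
  (run_straight p s h).mono hB fun _ h => h ▸ hQ

/-- `for i < len do body`, with `c` used for the loop condition; register `1` has to
hold `1`. -/
def forLoop (i c len : ℕ) (body : Prog) : Prog :=
  .seq (.const i 0) (.seq (.arith .lt c i len) (.loop c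
    (.seq body (.seq (.arith .add i i 1) (.arith .lt c i len)))))

/-- By `hI` the invariant ignores the counter and the condition register, which the loop itself
overwrites. Beyond the body, a round costs five units: two instructions, two `seq` steps and the
test. -/
theorem Run.forLoop {i c len : ℕ} {body : Prog} {B N : ℕ} (I : ℕ → Mem → Prop)
    (hic : i ≠ c) (hil : i ≠ len) (hcl : c ≠ len) (hi1 : i ≠ 1) (hc1 : c ≠ 1)
    (hw : 2 ≤ 2 ^ w) (hN : N < 2 ^ w)
    (hI : ∀ j s x v, x = i ∨ x = c → I j s → I j (s.put x v))
    (hbody : ∀ j < N, ∀ s, I j s → s.reg i = j → s.reg len = N → s.reg 1 = 1 →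
      Run w G body s B fun s' => I (j + 1) s' ∧ s'.reg i = j ∧ s'.reg len = N ∧ s'.reg 1 = 1)
    {s : Mem} (hlen : s.reg len = N) (h1 : s.reg 1 = 1) (h0 : I 0 s) :
    Run w G (forLoop i c len body) s (N * (B + 5) + 5) fun s' =>
      I N s' ∧ s'.reg len = N ∧ s'.reg 1 = 1 := by
  have hcmp : ∀ a b : ℕ, Op.lt.eval a b ≤ 1 := fun a b => by simp only [Op.eval]; split <;> omega
  let J : ℕ → Mem → Prop := fun j s => I j s ∧ s.reg i = j ∧ s.reg len = N ∧ s.reg 1 = 1 ∧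
    s.reg c = if j < N then 1 else 0
  have key : Run w G (.arith .lt c i len) (s.put i 0) 1 (J 0) := by
    refine Run.straight (by simp only [Safe]; exact (hcmp _ _).trans_lt hw) le_rfl ?_
    refine ⟨?_, ?_, ?_, ?_, ?_⟩
    · exact hI _ _ _ _ (.inr rfl) (hI _ _ _ _ (.inl rfl) h0)
    · simp [BicliqueRAM.straight, Mem.put_reg, hic]
    · simp [BicliqueRAM.straight, Mem.put_reg, hcl.symm, hil.symm, hlen]
    · simp [BicliqueRAM.straight, Mem.put_reg, hi1.symm, hc1.symm, h1]
    · simp [BicliqueRAM.straight, Mem.put_reg, hil.symm, hlen, Op.eval]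
  have hloop : ∀ s', J 0 s' → Run w G (.loop c
      (.seq body (.seq (.arith .add i i 1) (.arith .lt c i len)))) s' (N * (B + 4 + 1) + 1)
      (J N) := by
    intro s' hs'
    refine Run.loop J N ?_ ?_ hs'
    · rintro j hj s ⟨hIj, hi, hl, h1', hc⟩
      refine ⟨by simp [hc, hj], ?_⟩
      refine ((hbody j hj s hIj hi hl h1').seq (B' := 3) (R := J (j + 1)) ?_)
      rintro s2 ⟨hI2, hi2, hl2, h12⟩
      refine Run.straight ?_ (by simp [cost]) ?_
      · simp only [Safe, Op.eval, hi2, h12]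
        exact ⟨by omega, by split <;> omega⟩
      · refine ⟨?_, ?_, ?_, ?_, ?_⟩
        · exact hI _ _ _ _ (.inr rfl) (hI _ _ _ _ (.inl rfl) hI2)
        · simp [BicliqueRAM.straight, Mem.put_reg, hic, Op.eval, hi2, h12]
        · simp [BicliqueRAM.straight, Mem.put_reg, hcl.symm, hil.symm, hl2]
        · simp [BicliqueRAM.straight, Mem.put_reg, hi1.symm, hc1.symm, h12]
        · simp [BicliqueRAM.straight, Mem.put_reg, hil.symm, hl2, Op.eval, hi2, h12]
    · rintro s ⟨-, -, -, -, hc⟩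
      simpa using hc
  have hfirst : Run w G (.const i 0) s 1 (fun s' => s' = s.put i 0) :=
    Run.straight (by simp [Safe]) le_rfl rfl
  refine (hfirst.seq fun s' hs' => (hs' ▸ key).seq hloop).mono (by nlinarith) ?_
  rintro s' ⟨h, -, h2, h3, -⟩
  exact ⟨h, h2, h3⟩

/-! ## Probability of reaching a set of halted configurations -/

/-- The probability of being in `S` after `T` steps from `c`. -/
noncomputable def val (w : ℕ) {n : ℕ} (G : SimpleGraph (Fin n)) (S : Set Config) (T : ℕ)
    (c : Config) : ℝ :=
  ((steps w G T c).toOuterMeasure S).toReal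

theorem toOuterMeasure_le_one {α : Type*} (p : PMF α) (S : Set α) : p.toOuterMeasure S ≤ 1 := by
  calc p.toOuterMeasure S ≤ p.toOuterMeasure p.support :=
        p.toOuterMeasure_mono Set.inter_subset_right
    _ = 1 := (p.toOuterMeasure_apply_eq_one_iff _).2 le_rfl

theorem val_nonneg (S : Set Config) (T : ℕ) (c : Config) : 0 ≤ val w G S T c :=
  ENNReal.toReal_nonneg

theorem steps_halted {c : Config} (h : c.Halted) (T : ℕ) : steps w G T c = PMF.pure c := by
  obtain ⟨l, s⟩ := c
  obtain rfl : l = [] := h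
  induction T with
  | zero => rfl
  | succ T ih => rw [steps, step, PMF.pure_bind, ih]

theorem steps_add (T D : ℕ) (c : Config) :
    steps w G (T + D) c = (steps w G T c).bind (steps w G D) := by
  induction T generalizing c with
  | zero => simp [steps]
  | succ T ih =>
    rw [show T + 1 + D = (T + D) + 1 by ring, steps, steps, PMF.bind_bind]
    congr 1
    funext c'
    exact ih c'

/-- Halted configurations are absorbing, so probability that has entered `S` never leaves it. -/
theorem val_mono {S : Set Config} (hS : ∀ c ∈ S, c.Halted) {T T' : ℕ} (h : T ≤ T') (c : Config) :
    val w G S T c ≤ val w G S T' c := by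
  obtain ⟨D, rfl⟩ := Nat.exists_eq_add_of_le h
  refine ENNReal.toReal_mono ((toOuterMeasure_le_one _ _).trans_lt ENNReal.one_lt_top).ne ?_
  rw [steps_add, PMF.toOuterMeasure_bind_apply, PMF.toOuterMeasure_apply]
  refine ENNReal.tsum_le_tsum fun a => ?_
  by_cases ha : a ∈ S
  · rw [Set.indicator_of_mem ha, steps_halted (hS a ha), PMF.toOuterMeasure_pure_apply, if_pos ha,
      mul_one]
  · rw [Set.indicator_of_notMem ha]
    exact zero_le

theorem val_done {S : Set Config} {c : Config} (hc : c ∈ S) (hS : ∀ c ∈ S, c.Halted) (T : ℕ) :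
    val w G S T c = 1 := by
  rw [val, steps_halted (hS c hc), PMF.toOuterMeasure_pure_apply, if_pos hc, ENNReal.toReal_one]

/-- Thanks to `val_mono`, the bound `B` can replace the exact running time, which may depend on the
memory. -/
theorem Run.le_val {S : Set Config} (hS : ∀ c ∈ S, c.Halted) {P : Prog} {s : Mem} {B : ℕ}
    {Q : Mem → Prop} (h : Run w G P s B Q) {T : ℕ} {k : List Prog} {p : ℝ}
    (hp : ∀ s', Q s' → p ≤ val w G S T ⟨k, s'⟩) : p ≤ val w G S (T + B) ⟨P :: k, s⟩ := by
  obtain ⟨τ, hτ, s', he, hs'⟩ := h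
  refine (hp s' hs').trans ?_
  have : val w G S T ⟨k, s'⟩ = val w G S (T + τ) ⟨P :: k, s⟩ := by rw [val, val, he]
  rw [this]
  exact val_mono hS (by omega) _

theorem val_seq (S : Set Config) (p q : Prog) (k : List Prog) (s : Mem) (T : ℕ) :
    val w G S (T + 1) ⟨.seq p q :: k, s⟩ = val w G S T ⟨p :: q :: k, s⟩ := by
  rw [val, val, steps_succ_of_step (c' := ⟨p :: q :: k, s⟩) (by simp [step])]

/-- An empty range yields the value `0`, which is also the uniform choice below `1`. This merges the
two cases of random sampling into one average. -/
theorem uniformBelow_eq_max (k : ℕ) : uniformBelow k = uniformBelow (max k 1) := by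
  rcases Nat.eq_zero_or_pos k with rfl | hk
  · have h : (Finset.range (max 0 1)).Nonempty := ⟨0, by simp⟩
    rw [uniformBelow, uniformBelow, dif_neg (by simp), dif_pos h]
    ext a
    simp [PMF.uniformOfFinset_apply]
  · rw [max_eq_left hk]

theorem val_rand (S : Set Config) (x y : ℕ) (k : List Prog) (s : Mem) (T : ℕ) :
    val w G S (T + 1) ⟨.rand x y :: k, s⟩ =
      (∑ v ∈ Finset.range (max (s.reg y) 1), val w G S T ⟨k, s.setReg w x v⟩) /
        (max (s.reg y) 1 : ℕ) := by
  have hne : (Finset.range (max (s.reg y) 1)).Nonempty := ⟨0, by simp⟩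
  have h1 : steps w G (T + 1) ⟨.rand x y :: k, s⟩ =
      (uniformBelow (max (s.reg y) 1)).bind fun v => steps w G T ⟨k, s.setReg w x v⟩ := by
    rw [steps, step, PMF.bind_map, uniformBelow_eq_max]
    rfl
  rw [val, h1, uniformBelow, dif_pos hne, PMF.toOuterMeasure_bind_apply,
    tsum_eq_sum (s := Finset.range (max (s.reg y) 1))]
  · rw [ENNReal.toReal_sum, Finset.sum_div]
    · refine Finset.sum_congr rfl fun v hv => ?_
      rw [PMF.uniformOfFinset_apply, if_pos hv, ENNReal.toReal_mul, Finset.card_range,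
        ENNReal.toReal_inv, ENNReal.toReal_natCast, val]
      field_simp
    · intro v hv
      refine ENNReal.mul_ne_top ?_ ((toOuterMeasure_le_one _ _).trans_lt ENNReal.one_lt_top).ne
      exact PMF.apply_ne_top _ _
  · intro v hv
    rw [PMF.uniformOfFinset_apply, if_neg hv, zero_mul]

end Semantics

section Trie

/-! ## Tries -/

/-- In the trie `T`, the node `p` is reached from the root by the first `i` bits of `f`. -/
def Path (T f : ℕ → ℕ) : ℕ → ℕ → Prop
  | 0, p => p = 0
  | i + 1, p => p ≠ 0 ∧ ∃ p', Path T f i p' ∧ T (2 * p' + f i) = p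

/-- Distinct edges of the trie `T` lead to distinct nodes, all of them at most `c`. -/
def IsTrie (T : ℕ → ℕ) (c : ℕ) : Prop :=
  (∀ x, T x ≤ c) ∧ ∀ x y, T x = T y → T x ≠ 0 → x = y

/-- The trie `T'` extends the trie `T`. -/
def Extends (T T' : ℕ → ℕ) : Prop := ∀ x, T x ≠ 0 → T' x = T x

theorem Path.le {T f : ℕ → ℕ} {c : ℕ} (hT : IsTrie T c) {i p : ℕ} (h : Path T f i p) : p ≤ c := by
  cases i with
  | zero => rw [Path] at h; omega
  | succ i => obtain ⟨-, p', -, rfl⟩ := h; exact hT.1 _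

theorem Path.extend {T T' f : ℕ → ℕ} (hT : Extends T T') {i p : ℕ} (h : Path T f i p) :
    Path T' f i p := by
  induction i generalizing p with
  | zero => exact h
  | succ i ih =>
    obtain ⟨h0, p', hp, rfl⟩ := h
    exact ⟨h0, p', ih hp, hT _ h0⟩

/-- Equal keys end at the same leaf; `Path.bits_eq` is the converse. -/
theorem Path.eq_of_eq {T f f' : ℕ → ℕ} {i p p' : ℕ} (h : Path T f i p) (h' : Path T f' i p')
    (hf : ∀ j < i, f j = f' j) : p = p' := by
  induction i generalizing p p' with
  | zero => rw [Path] at h h'; omega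
  | succ i ih =>
    obtain ⟨-, q, hq, rfl⟩ := h
    obtain ⟨-, q', hq', rfl⟩ := h'
    rw [ih hq hq' fun j hj => hf j (by omega), hf i (by omega)]

/-- Since distinct edges lead to distinct nodes, a path can be retraced from its end: the cell
address `2 * q + f i` determines the bit by its parity and the previous node by its half. -/
theorem Path.bits_eq {T f f' : ℕ → ℕ} {c : ℕ} (hT : IsTrie T c) (hf : ∀ i, f i ≤ 1)
    (hf' : ∀ i, f' i ≤ 1) {i p : ℕ} (h : Path T f i p) (h' : Path T f' i p) :
    ∀ j < i, f j = f' j := by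
  induction i generalizing p with
  | zero => intro j hj; omega
  | succ i ih =>
    obtain ⟨h0, q, hq, hqp⟩ := h
    obtain ⟨-, q', hq', hq'p⟩ := h'
    have e := hT.2 _ _ (hqp.trans hq'p.symm) (by rw [hqp]; exact h0)
    have := hf i
    have := hf' i
    obtain rfl : q = q' := by omega
    intro j hj
    rcases Nat.lt_succ_iff_lt_or_eq.1 hj with hj | rfl
    · exact ih hq hq' j hj
    · omega

theorem Extends.refl (T : ℕ → ℕ) : Extends T T := fun _ _ => rfl

theorem Extends.trans {T T' T'' : ℕ → ℕ} (h : Extends T T') (h' : Extends T' T'') :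
    Extends T T'' := fun x hx => by
  rw [h' x (by rw [h x hx]; exact hx), h x hx]

/-- The new node number exceeds all old ones, so distinctness persists. -/
theorem IsTrie.insert {T : ℕ → ℕ} {c : ℕ} (hT : IsTrie T c) {x : ℕ} {T' : ℕ → ℕ}
    (hT' : ∀ y, T' y = if y = x then c + 1 else T y) : IsTrie T' (c + 1) := by
  have h1 := hT.1
  refine ⟨fun y => ?_, fun y z => ?_⟩
  · rw [hT']; split
    · exact le_rfl
    · exact (h1 y).trans (by omega)
  · rw [hT', hT']
    have := h1 y
    have := h1 z
    split <;> split
    · intros; omega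
    · intros; omega
    · intros; omega
    · exact hT.2 y z

/-- A sequence of bits with partial sums attains every value of the partial sums. -/
theorem exists_sum_range_eq {f : ℕ → ℕ} (hf : ∀ i, f i ≤ 1) {m c : ℕ}
    (h : c < ∑ j ∈ Finset.range m, f j) :
    ∃ i < m, f i = 1 ∧ ∑ j ∈ Finset.range i, f j = c := by
  induction m with
  | zero => simp at h
  | succ m ih =>
    by_cases hc : c < ∑ j ∈ Finset.range m, f j
    · obtain ⟨i, hi, h⟩ := ih hc
      exact ⟨i, by omega, h⟩
    · rw [Finset.sum_range_succ] at h
      have := hf m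
      exact ⟨m, by omega, by omega, by omega⟩

variable {n : ℕ} (G : SimpleGraph (Fin n)) (A : ℕ → ℕ)

/-- The number of neighbours of `v` among `A 0, …, A (i - 1)`. -/
noncomputable def nbrCount (v i : ℕ) : ℕ := ∑ j ∈ Finset.range i, adjBit G (A j) v

/-- The indicator of the first `t` indices `i` for which `A i` is a neighbour of `v`. -/
noncomputable def keyBit (t v i : ℕ) : ℕ :=
  if nbrCount G A v i < t then adjBit G (A i) v else 0

theorem keyBit_le (t v i : ℕ) : keyBit G A t v i ≤ 1 := by
  unfold keyBit; split
  · exact adjBit_le _ _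
  · omega

/-- In particular a vertex with at least `t` neighbours has exactly `t` ones in its key, which makes
the key a `t`-subset. -/
theorem sum_keyBit (t v i : ℕ) :
    ∑ j ∈ Finset.range i, keyBit G A t v j = min t (nbrCount G A v i) := by
  induction i with
  | zero => simp [nbrCount]
  | succ i ih =>
    have hs : nbrCount G A v (i + 1) = nbrCount G A v i + adjBit G (A i) v :=
      Finset.sum_range_succ _ _
    rw [Finset.sum_range_succ, ih, hs, keyBit]
    have := adjBit_le (G := G) (A i) v
    split <;> omega

theorem natAdj_of_adjBit {i j : ℕ} (h : adjBit G i j = 1) : NatAdj G i j := by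
  unfold adjBit at h; by_contra h'; simp [h'] at h

/-- If at least `t * (r.choose t)` of `N` vertices have at least `t` neighbours among `r` vertices,
then `t` of them have the same key. -/
theorem exists_common_key {B : ℕ → ℕ} {r N t : ℕ} (ht : 1 ≤ t) (htr : t ≤ r)
    (h : t * r.choose t ≤ ((Finset.range N).filter fun j => t ≤ nbrCount G A (B j) r).card) :
    ∃ j < N, t ≤ nbrCount G A (B j) r ∧
      t ≤ ((Finset.range N).filter fun u => t ≤ nbrCount G A (B u) r ∧
        ∀ i < r, keyBit G A t (B u) i = keyBit G A t (B j) i).card := by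
  classical
  let K : ℕ → Finset ℕ := fun j => (Finset.range r).filter fun i => keyBit G A t (B j) i = 1
  have hcard : ∀ j, t ≤ nbrCount G A (B j) r → (K j).card = t := by
    intro j hj
    have h1 := sum_keyBit G A t (B j) r
    rw [min_eq_left hj] at h1
    refine Eq.trans ?_ h1
    rw [Finset.card_filter]
    refine Finset.sum_congr rfl fun i _ => ?_
    have := keyBit_le G A t (B j) i
    split <;> omega
  have hpos : 0 < r.choose t := Nat.choose_pos htr
  -- Pigeonhole over the `r.choose t` possible keys: some fibre has more than `t - 1` elements.
  obtain ⟨k, hk, hlt⟩ := Finset.exists_lt_card_fiber_of_mul_lt_card_of_maps_to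
    (s := (Finset.range N).filter fun j => t ≤ nbrCount G A (B j) r)
    (t := (Finset.range r).powersetCard t) (f := K) (n := t - 1) (fun j hj => by
      rw [Finset.mem_filter] at hj
      exact Finset.mem_powersetCard.2 ⟨Finset.filter_subset _ _, hcard j hj.2⟩) (by
      rw [Finset.card_powersetCard, Finset.card_range]
      refine lt_of_lt_of_le ?_ h
      rw [mul_comm]
      exact Nat.mul_lt_mul_of_pos_right (by omega) hpos)
  obtain ⟨j, hj⟩ := Finset.card_pos.1 (lt_of_le_of_lt (Nat.zero_le _) hlt)
  simp only [Finset.mem_filter, Finset.mem_range] at hj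
  refine ⟨j, hj.1.1, hj.1.2, ?_⟩
  refine le_trans (Nat.le_of_pred_lt hlt) (Finset.card_le_card fun u hu => ?_)
  · simp only [Finset.mem_filter, Finset.mem_range] at hu ⊢
    refine ⟨hu.1.1, hu.1.2, fun i hi => ?_⟩
    have e : K u = K j := hu.2.trans hj.2.symm
    have e' : i ∈ K u ↔ i ∈ K j := by rw [e]
    simp only [K, Finset.mem_filter, Finset.mem_range, hi, true_and] at e'
    have := keyBit_le G A t (B u) i
    have := keyBit_le G A t (B j) i
    omega

end Trie

section Finalize

/-! ## The program that finds a biclique among given candidate vertices -/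

infixr:60 " ;; " => Prog.seq

/-- `x := y`, provided that register `1` holds `1`. -/
def copyReg (x y : ℕ) : Prog := .arith .mul x y 1

/-- Registers in `R` and arrays in `A` have the same contents in both memories. -/
def Keep (R A : List ℕ) (s s' : Mem) : Prop :=
  (∀ x ∈ R, s'.reg x = s.reg x) ∧ ∀ a ∈ A, s'.arr a = s.arr a

theorem Keep.refl (R A : List ℕ) (s : Mem) : Keep R A s s :=
  ⟨fun _ _ => rfl, fun _ _ => rfl⟩

theorem Keep.reg {R A : List ℕ} {s s' : Mem} (h : Keep R A s s') (x : ℕ)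
    (hx : x ∈ R := by decide) : s'.reg x = s.reg x := h.1 x hx

theorem Keep.arr {R A : List ℕ} {s s' : Mem} (h : Keep R A s s') (a : ℕ)
    (ha : a ∈ A := by decide) : s'.arr a = s.arr a := h.2 a ha

theorem Keep.trans {R A R' A' R'' A'' : List ℕ} {s s' s'' : Mem} (h : Keep R A s s')
    (h' : Keep R' A' s' s'')
    (hR : ∀ x ∈ R'', x ∈ R ∧ x ∈ R' := by decide) (hA : ∀ x ∈ A'', x ∈ A ∧ x ∈ A' := by decide) :
    Keep R'' A'' s s'' :=
  ⟨fun x hx => (h'.1 x (hR x hx).2).trans (h.1 x (hR x hx).1),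
    fun a ha => (h'.2 a (hA a ha).2).trans (h.2 a (hA a ha).1)⟩

theorem Keep.put {R A : List ℕ} {s s' : Mem} (h : Keep R A s s') {x : ℕ} (v : ℕ) (hx : x ∉ R) :
    Keep R A s (s'.put x v) := by
  refine ⟨fun y hy => ?_, h.2⟩
  have hne : y ≠ x := fun e => hx (e ▸ hy)
  rw [Mem.put_reg, if_neg hne, h.1 y hy]

theorem Keep.putArr {R A : List ℕ} {s s' : Mem} (h : Keep R A s s') {a : ℕ} (i v : ℕ)
    (ha : a ∉ A) : Keep R A s (s'.putArr a i v) := by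
  refine ⟨h.1, fun b hb => ?_⟩
  have hne : b ≠ a := fun e => ha (e ▸ hb)
  rw [← h.2 b hb]
  exact Function.update_of_ne hne _ _

@[simp] theorem Mem.putArr_arr_same (s : Mem) (a i v : ℕ) :
    (s.putArr a i v).arr a = Function.update (s.arr a) i v := by
  simp [Mem.putArr]

@[simp] theorem Mem.putArr_arr_ne (s : Mem) {a b : ℕ} (h : b ≠ a) (i v : ℕ) :
    (s.putArr a i v).arr b = s.arr b := by
  simp [Mem.putArr, h]

/-- Extend the path of vertex `33` in the trie `5` by the bit for vertex number `20`
of array `3`. -/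
def trieStep : Prog :=
  .load 22 3 20 ;; .adj 22 22 33 ;; .arith .lt 23 35 8 ;; .arith .mul 22 22 23 ;;
  .arith .add 35 35 22 ;; .arith .add 34 34 34 ;; .arith .add 34 34 22 ;; .load 24 5 34 ;;
  .ite 24 .skip (.arith .add 40 40 1 ;; .store 5 34 40 ;; copyReg 24 40) ;; copyReg 34 24

/-- Walk vertex `33` down the trie `5`. -/
def trieWalk : Prog := .const 34 0 ;; .const 35 0 ;; forLoop 20 21 7 trieStep

/-- Increment the number of vertices at leaf `34` after vertex number `31` has been found
to belong to that leaf, and remember that vertex if the number is now `t`. -/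
def recordLeaf : Prog :=
  .arith .eq 22 35 8 ;; .ite 22 (.store 6 31 34 ;; .load 23 7 34 ;; .arith .add 23 23 1 ;;
    .store 7 34 23 ;; .arith .eq 24 23 8 ;; .ite 24 (copyReg 41 31) .skip) (.store 6 31 22)

/-- Classify the vertices in array `4` by the leaves of their keys. -/
def classify : Prog :=
  .const 40 0 ;; .const 41 0 ;; forLoop 31 32 9 (.load 33 4 31 ;; trieWalk ;; recordLeaf)

/-- List the first neighbours of vertex `43` in array `0`. -/
def listLeft : Prog :=
  .const 44 0 ;; forLoop 20 21 7 (.load 22 3 20 ;; .adj 23 22 43 ;;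
    .ite 23 (.store 0 44 22 ;; .arith .add 44 44 1) .skip)

/-- List the vertices with leaf `42` in array `1`. -/
def listRight : Prog :=
  .const 44 0 ;; forLoop 20 21 9 (.load 22 6 20 ;; .arith .eq 23 22 42 ;;
    .ite 23 (.load 24 4 20 ;; .store 1 44 24 ;; .arith .add 44 44 1) .skip)

/-- Find a biclique between the vertices in arrays `3` and `4`. -/
def finalize : Prog :=
  classify ;; .load 42 6 41 ;; .load 43 4 41 ;; listLeft ;; listRight ;; copyReg 0 8

variable {w n : ℕ} {G : SimpleGraph (Fin n)}

/-- Register `34` holds the current node, `35` the number of ones seen so far, `40` the largest node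
number in use. Each round adds at most one node, so no address `2 * node + bit` exceeds what `hw`
allows. -/
theorem run_trieWalk {s : Mem} {A : ℕ → ℕ} {r t v : ℕ} (h1 : s.reg 1 = 1) (h7 : s.reg 7 = r)
    (h8 : s.reg 8 = t) (h33 : s.reg 33 = v) (h3 : s.arr 3 = A) (hA : ∀ i < r, A i < 2 ^ w)
    (ht : t < 2 ^ w) (hw : 2 * (s.reg 40 + r) + 2 ≤ 2 ^ w)
    (hT : IsTrie (s.arr 5) (s.reg 40)) :
    Run w G trieWalk s (30 * (r + 1)) fun s' =>
      Keep [1, 7, 8, 9, 31, 33, 41] [3, 4, 6, 7] s s' ∧ Extends (s.arr 5) (s'.arr 5) ∧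
      IsTrie (s'.arr 5) (s'.reg 40) ∧ s'.reg 40 ≤ s.reg 40 + r ∧
      s'.reg 35 = min t (nbrCount G A v r) ∧ Path (s'.arr 5) (keyBit G A t v) r (s'.reg 34) := by
  let I : ℕ → Mem → Prop := fun i s' =>
    Keep [1, 7, 8, 9, 31, 33, 41] [3, 4, 6, 7] s s' ∧ Extends (s.arr 5) (s'.arr 5) ∧
      IsTrie (s'.arr 5) (s'.reg 40) ∧ s'.reg 40 ≤ s.reg 40 + i ∧
      s'.reg 35 = min t (nbrCount G A v i) ∧ Path (s'.arr 5) (keyBit G A t v) i (s'.reg 34)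
  have hw2 : 2 ≤ 2 ^ w := by omega
  have hw0 : w ≠ 0 := by rintro rfl; omega
  have hloop : ∀ s', I 0 s' → Run w G (forLoop 20 21 7 trieStep) s' (r * (24 + 5) + 5)
      fun s' => I r s' ∧ s'.reg 7 = r ∧ s'.reg 1 = 1 := by
    intro s' hs'
    refine Run.forLoop I (by decide) (by decide) (by decide) (by decide) (by decide) hw2
      (by omega) ?_ ?_ (by rw [hs'.1.reg 7, h7]) (by rw [hs'.1.reg 1, h1]) hs'
    · rintro j s' x v hx ⟨hK, hE, hT, h40, h35, hP⟩
      have hne : x ≠ 40 ∧ x ≠ 35 ∧ x ≠ 34 ∧ x ∉ [1, 7, 8, 9, 31, 33, 41] := by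
        rcases hx with rfl | rfl <;> decide
      refine ⟨hK.put _ hne.2.2.2, hE, ?_, ?_, ?_, ?_⟩ <;>
        simp only [Mem.put_reg, Mem.put_arr, hne.1.symm, hne.2.1.symm, hne.2.2.1.symm, if_false] <;>
        assumption
    · rintro j hj s' ⟨hK, hE, hT, h40, h35, hP⟩ h20 h7' h1'
      have e8 : s'.reg 8 = t := by rw [hK.reg 8, h8]
      have e33 : s'.reg 33 = v := by rw [hK.reg 33, h33]
      have e3 : s'.arr 3 = A := by rw [hK.arr 3, h3]
      have hAj := hA j hj
      have hp := hP.le hT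
      have hb := adjBit_le (G := G) (A j) v
      have hkb := keyBit_le G A t v j
      have hTle := hT.1
      -- The machine computes the key bit as adjacency bit times the outcome of the test that fewer
      -- than `t` neighbours have been seen.
      have hkey : adjBit G (A j) v * (if min t (nbrCount G A v j) < t then 1 else 0) =
          keyBit G A t v j := by
        unfold keyBit
        by_cases hlt : nbrCount G A v j < t
        · simp [hlt]
        · simp [hlt]
      have hcount : min t (nbrCount G A v j) + keyBit G A t v j =
          min t (nbrCount G A v (j + 1)) := by
        rw [← sum_keyBit, ← sum_keyBit, Finset.sum_range_succ]
      have hle1 : (if min t (nbrCount G A v j) < t then 1 else 0) ≤ 1 := by split <;> omega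
      have hmt : min t (nbrCount G A v (j + 1)) ≤ t := min_le_left _ _
      generalize hbit : (if min t (nbrCount G A v j) < t then 1 else 0) = bit at hkey hle1
      have hdbl : s'.reg 34 + s'.reg 34 + keyBit G A t v j =
        2 * s'.reg 34 + keyBit G A t v j := by ring
      generalize hc' : min t (nbrCount G A v (j + 1)) = c' at hcount hmt
      generalize min t (nbrCount G A v j) = c at hcount h35 hbit
      have hkeep : ∀ s'', Keep [1, 7, 8, 9, 31, 33, 41] [3, 4, 6, 7] s' s'' →
          Keep [1, 7, 8, 9, 31, 33, 41] [3, 4, 6, 7] s s'' := fun s'' h => hK.trans h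
      have hTl := hTle (2 * s'.reg 34 + keyBit G A t v j)
      -- The value `0` marks a missing child, which is then created with the next free number. It
      -- cannot be confused with a node, since only the root has number `0` and the root is nobody's
      -- child.
      by_cases hx : s'.arr 5 (2 * s'.reg 34 + keyBit G A t v j) = 0
      · refine Run.straight ?_ (by decide) ?_
        · simp [trieStep, copyReg, Safe, straight, Op.eval, h20, e3, e8, e33, h35, hbit, hkey,
            hcount, hdbl, hx, h1']
          omega
        · have hupd : ∀ y, Function.update (s'.arr 5) (2 * s'.reg 34 + keyBit G A t v j)
              (s'.reg 40 + 1) y = if y = 2 * s'.reg 34 + keyBit G A t v j then s'.reg 40 + 1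
              else s'.arr 5 y := fun y => by rw [Function.update_apply]
          have hext : Extends (s'.arr 5) (Function.update (s'.arr 5)
              (2 * s'.reg 34 + keyBit G A t v j) (s'.reg 40 + 1)) := by
            intro y hy
            rw [hupd, if_neg]
            rintro rfl
            exact hy hx
          have hPn : Path (Function.update (s'.arr 5) (2 * s'.reg 34 + keyBit G A t v j)
              (s'.reg 40 + 1)) (keyBit G A t v) (j + 1) (s'.reg 40 + 1) :=
            ⟨by omega, s'.reg 34, hP.extend hext, by rw [hupd, if_pos rfl]⟩
          simp [I, hc', trieStep, copyReg, straight, Op.eval, h20, e3, e8, e33, h35, hbit, hkey,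
            hcount, hdbl, hx, h1', h7', hPn, hE.trans hext, hT.insert hupd]
          refine ⟨hkeep _ ?_, by omega⟩
          simp [Keep]
      · refine Run.straight ?_ (by decide) ?_
        · simp [trieStep, copyReg, Safe, straight, Op.eval, h20, e3, e8, e33, h35, hbit, hkey,
            hcount, hdbl, hx, h1']
          omega
        · have hPn : Path (s'.arr 5) (keyBit G A t v) (j + 1)
              (s'.arr 5 (2 * s'.reg 34 + keyBit G A t v j)) := ⟨hx, s'.reg 34, hP, rfl⟩
          simp [I, hc', trieStep, copyReg, straight, Op.eval, h20, e3, e8, e33, h35, hbit, hkey,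
            hcount, hdbl, hx, h1', h7', hPn, hE, hT]
          refine ⟨hkeep _ ?_, by omega⟩
          simp [Keep]
  have hinit : ∀ x v, Run w G (.const x 0) v 1 (fun s' => s' = v.put x 0) := fun x v =>
    Run.straight (by simp [Safe]) le_rfl rfl
  refine ((hinit 34 s).seq fun s1 hs1 => (hinit 35 s1).seq fun s2 hs2 =>
    hloop s2 ?_).mono (by omega) fun s' hs' => hs'.1
  subst hs1 hs2
  refine ⟨((Keep.refl _ _ _).put _ (by decide)).put _ (by decide), Extends.refl _, ?_, ?_, ?_, ?_⟩
  · simpa [Mem.put_reg, Mem.put_arr] using hT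
  · simp [Mem.put_reg]
  · simp [Mem.put_reg, nbrCount]
  · simp [Mem.put_reg, Path]

/-- The state of the classification after `j` vertices have been processed. -/
structure Classified {n : ℕ} (G : SimpleGraph (Fin n)) (A B : ℕ → ℕ) (r t j : ℕ) (s : Mem) :
    Prop where
  trie : IsTrie (s.arr 5) (s.reg 40)
  size : s.reg 40 ≤ j * r
  path : ∀ u < j, t ≤ nbrCount G A (B u) r →
    Path (s.arr 5) (keyBit G A t (B u)) r (s.arr 6 u)
  none : ∀ u < j, nbrCount G A (B u) r < t → s.arr 6 u = 0
  card : ∀ p ≠ 0, s.arr 7 p = ((Finset.range j).filter fun u => s.arr 6 u = p).card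
  card_le : ∀ p, s.arr 7 p ≤ j
  found : 1 ≤ t → ∀ p ≠ 0, t ≤ s.arr 7 p →
    s.reg 41 < j ∧ s.arr 6 (s.reg 41) ≠ 0 ∧ t ≤ s.arr 7 (s.arr 6 (s.reg 41))

/-- In the application `c` is the number of ones in the key, capped at `t`, so `c = t` says that the
vertex has enough neighbours. All other vertices get the leaf `0` and are not counted. -/
theorem run_recordLeaf {s : Mem} {j p c t : ℕ} (h1 : s.reg 1 = 1) (h35 : s.reg 35 = c)
    (h8 : s.reg 8 = t) (h34 : s.reg 34 = p) (h31 : s.reg 31 = j) (hj : j < 2 ^ w)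
    (hp : p < 2 ^ w) (h7 : s.arr 7 p + 1 < 2 ^ w) :
    Run w G recordLeaf s 17 fun s' => Keep [1, 7, 8, 9, 31, 40] [3, 4, 5] s s' ∧
      s'.arr 6 = Function.update (s.arr 6) j (if c = t then p else 0) ∧
      s'.arr 7 = Function.update (s.arr 7) p (s.arr 7 p + if c = t then 1 else 0) ∧
      s'.reg 41 = if c = t ∧ s.arr 7 p + 1 = t then j else s.reg 41 := by
  have hw0 : w ≠ 0 := by rintro rfl; omega
  by_cases hc : c = t
  · by_cases h : s.arr 7 p + 1 = t
    · refine Run.straight ?_ (by decide) ?_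
      · simp [recordLeaf, copyReg, Safe, straight, Op.eval, h1, h35, h8, h34, h31, hc, h]
        omega
      · simp [recordLeaf, copyReg, straight, Op.eval, h1, h35, h8, h34, h31, hc, h, Keep]
    · refine Run.straight ?_ (by decide) ?_
      · simp [recordLeaf, copyReg, Safe, straight, Op.eval, h1, h35, h8, h34, h31, hc, h]
        omega
      · simp [recordLeaf, copyReg, straight, Op.eval, h1, h35, h8, h34, h31, hc, h, Keep]
  · refine Run.straight ?_ (by decide) ?_
    · simp [recordLeaf, copyReg, Safe, straight, Op.eval, h35, h8, hc]
    · simp [recordLeaf, copyReg, straight, Op.eval, h35, h8, h31, hc, Keep]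

/-- Register `41` changes only at the moment when some leaf reaches the count `t`. Counts never
decrease, so the vertex stored there keeps belonging to a leaf with at least `t` vertices. -/
theorem Classified.next {A B : ℕ → ℕ} {r t j p : ℕ} {s s' : Mem} (h : Classified G A B r t j s)
    (hE : Extends (s.arr 5) (s'.arr 5)) (hT : IsTrie (s'.arr 5) (s'.reg 40))
    (h40 : s'.reg 40 ≤ s.reg 40 + r)
    (hP : Path (s'.arr 5) (keyBit G A t (B j)) r p)
    (h6 : s'.arr 6 = Function.update (s.arr 6) j (if t ≤ nbrCount G A (B j) r then p else 0))
    (h7 : s'.arr 7 = Function.update (s.arr 7) p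
      (s.arr 7 p + if t ≤ nbrCount G A (B j) r then 1 else 0))
    (h41 : s'.reg 41 = if t ≤ nbrCount G A (B j) r ∧ s.arr 7 p + 1 = t then j else s.reg 41) :
    Classified G A B r t (j + 1) s' := by
  have e6 : ∀ u < j, s'.arr 6 u = s.arr 6 u := fun u hu => by
    rw [h6, Function.update_of_ne (by omega)]
  have e6j : s'.arr 6 j = if t ≤ nbrCount G A (B j) r then p else 0 := by
    rw [h6, Function.update_self]
  have e7 : ∀ q, s.arr 7 q ≤ s'.arr 7 q ∧ s'.arr 7 q ≤ s.arr 7 q + 1 ∧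
      s'.arr 7 q = s.arr 7 q + if q = p ∧ t ≤ nbrCount G A (B j) r then 1 else 0 := by
    intro q
    rw [h7, Function.update_apply]
    by_cases hq : q = p
    · subst hq; simp; split <;> omega
    · simp [hq]
  refine ⟨hT, ?_, ?_, ?_, ?_, ?_, ?_⟩
  · have := h.size
    rw [Nat.succ_mul]
    omega
  · intro u hu ht
    rcases Nat.lt_succ_iff_lt_or_eq.1 hu with hu | rfl
    · rw [e6 u hu]
      exact (h.path u hu ht).extend hE
    · rw [e6j, if_pos ht]
      exact hP
  · intro u hu ht
    rcases Nat.lt_succ_iff_lt_or_eq.1 hu with hu | rfl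
    · rw [e6 u hu]
      exact h.none u hu ht
    · rw [e6j, if_neg (by omega)]
  · intro q hq
    rw [(e7 q).2.2, h.card q hq, Finset.range_add_one, Finset.filter_insert, e6j]
    have hf : (Finset.range j).filter (fun u => s'.arr 6 u = q) =
        (Finset.range j).filter fun u => s.arr 6 u = q :=
      Finset.filter_congr fun u hu => by rw [e6 u (Finset.mem_range.1 hu)]
    rw [hf]
    by_cases hg : t ≤ nbrCount G A (B j) r
    · by_cases hqp : q = p
      · simp [hg, hqp]
      · simp [hg, hqp, Ne.symm hqp]
    · simp [hg, hq.symm]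
  · intro q
    have := h.card_le q
    have := (e7 q).2.1
    omega
  · intro ht q hq htq
    by_cases hn : t ≤ nbrCount G A (B j) r ∧ s.arr 7 p + 1 = t
    · rw [h41, if_pos hn, e6j, if_pos hn.1, (e7 p).2.2]
      -- The path could end at the root only for `r = 0`, but then there are no neighbours and `t`
      -- would be `0`.
      have hp0 : p ≠ 0 := by
        rintro rfl
        have := h.found ht q hq
        have h3 := (e7 q).2.2
        rw [if_neg (fun h => hq h.1)] at h3
        obtain ⟨-, h4, h5⟩ := this (by omega)
        cases r with
        | zero =>
          simp [nbrCount] at hn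
          omega
        | succ r => exact hP.1 rfl
      simp [hn.1, hp0, hn.2]
    · have hold : t ≤ s.arr 7 q := by
        have h3 := (e7 q).2.2
        by_cases hqp : q = p ∧ t ≤ nbrCount G A (B j) r
        · rw [if_pos hqp] at h3
          obtain ⟨rfl, hg⟩ := hqp
          have : ¬s.arr 7 q + 1 = t := fun h => hn ⟨hg, h⟩
          omega
        · rw [if_neg hqp] at h3
          omega
      obtain ⟨h4, h5, h6'⟩ := h.found ht q hq hold
      rw [h41, if_neg hn, e6 _ h4]
      exact ⟨by omega, h5, h6'.trans (e7 _).1⟩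

theorem run_classify {s : Mem} {A B : ℕ → ℕ} {r N t : ℕ} (h1 : s.reg 1 = 1) (h7 : s.reg 7 = r)
    (h8 : s.reg 8 = t) (h9 : s.reg 9 = N) (h3 : s.arr 3 = A) (h4 : s.arr 4 = B)
    (hA : ∀ i < r, A i < 2 ^ w) (hB : ∀ j < N, B j < 2 ^ w) (ht : t < 2 ^ w)
    (hw : 2 * ((N + 1) * (r + 1)) + 2 ≤ 2 ^ w) (z5 : ∀ x, s.arr 5 x = 0)
    (z6 : ∀ x, s.arr 6 x = 0) (z7 : ∀ x, s.arr 7 x = 0) :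
    Run w G classify s (N * (30 * (r + 1) + 25) + 10) fun s' =>
      Keep [1, 7, 8, 9] [3, 4] s s' ∧ Classified G A B r t N s' ∧
      (s'.reg 41 < N ∨ s'.reg 41 = 0) ∧ ∀ x, s'.arr 6 x < 2 ^ w := by
  let I : ℕ → Mem → Prop := fun j s' =>
    Keep [1, 7, 8, 9] [3, 4] s s' ∧ Classified G A B r t j s' ∧
      (s'.reg 41 < j ∨ s'.reg 41 = 0) ∧ ∀ x, s'.arr 6 x < 2 ^ w
  have hNr : (N + 1) * (r + 1) = N * r + N + r + 1 := by ring
  have hw2 : 2 ≤ 2 ^ w := by omega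
  have hw0 : w ≠ 0 := by rintro rfl; omega
  have hloop : ∀ s', I 0 s' → Run w G (forLoop 31 32 9 (.load 33 4 31 ;; trieWalk ;; recordLeaf))
      s' (N * ((1 + (30 * (r + 1) + 17 + 1) + 1) + 5) + 5)
      fun s' => I N s' ∧ s'.reg 9 = N ∧ s'.reg 1 = 1 := by
    intro s' hs'
    refine Run.forLoop I (by decide) (by decide) (by decide) (by decide) (by decide) hw2
      (by omega) ?_ ?_ (by rw [hs'.1.reg 9, h9]) (by rw [hs'.1.reg 1, h1]) hs'
    · rintro j s' x v hx ⟨hK, hC, h41, hlt6⟩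
      have hx' : x ∉ [1, 7, 8, 9] ∧ x ≠ 40 ∧ x ≠ 41 := by
        rcases hx with rfl | rfl <;> decide
      have e40 : (s'.put x v).reg 40 = s'.reg 40 := by simp [hx'.2.1.symm]
      have e41 : (s'.put x v).reg 41 = s'.reg 41 := by simp [hx'.2.2.symm]
      refine ⟨hK.put _ hx'.1, ⟨?_, ?_, hC.path, hC.none, hC.card, hC.card_le, ?_⟩, ?_, hlt6⟩
      · rw [e40]; exact hC.trie
      · rw [e40]; exact hC.size
      · rw [e41]; exact hC.found
      · rw [e41]; exact h41
    · rintro j hj s1 ⟨hK, hC, h41, hlt6⟩ h31 h9' h1'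
      have hjr : j * r + r ≤ N * r := by
        calc j * r + r = (j + 1) * r := by ring
          _ ≤ N * r := Nat.mul_le_mul_right _ hj
      have hsz := hC.size
      have hload : Run w G (.load 33 4 31) s1 1 (fun s2 => s2 = s1.put 33 (B j)) := by
        have e4 : s1.arr 4 = B := by rw [hK.arr 4, h4]
        refine Run.straight ?_ le_rfl ?_
        · simpa [Safe, h31, e4] using hB j hj
        · simp [straight, h31, e4]
      refine hload.seq ?_
      rintro s2 rfl
      refine (run_trieWalk (s := s1.put 33 (B j)) (A := A) (r := r) (t := t) (v := B j)
        (by simp [h1']) (by simp [hK.reg 7, h7]) (by simp [hK.reg 8, h8]) (by simp)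
        (by simp [hK.arr 3, h3]) hA ht (by simp; omega) (by simpa using hC.trie)).seq ?_
      rintro s3 ⟨hK3, hE3, hT3, h40, h35, hP⟩
      simp only [Mem.put_arr, Mem.put_reg, Nat.reduceEqDiff, if_false] at hE3 h40
      have hple := hP.le hT3
      have e7 : s3.arr 7 = s1.arr 7 := by rw [hK3.arr 7, Mem.put_arr]
      have e6 : s3.arr 6 = s1.arr 6 := by rw [hK3.arr 6, Mem.put_arr]
      have e41 : s3.reg 41 = s1.reg 41 := by rw [hK3.reg 41]; simp
      refine (run_recordLeaf (s := s3) (j := j) (t := t) (p := s3.reg 34) (by rw [hK3.reg 1]; simp [h1']) h35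
        (by rw [hK3.reg 8]; simp [hK.reg 8, h8]) rfl (by rw [hK3.reg 31]; simp [h31])
        (by omega) (by omega) (by
          have := hC.card_le (s3.reg 34)
          rw [e7]
          omega)).mono le_rfl ?_
      rintro s4 ⟨hK4, h6, h7', h41'⟩
      have hmin : (min t (nbrCount G A (B j) r) = t) = (t ≤ nbrCount G A (B j) r) :=
        propext min_eq_left_iff
      rw [e6] at h6
      rw [e7] at h7' h41'
      rw [e41] at h41'
      simp only [hmin] at h6 h7' h41'
      have e5 : s4.arr 5 = s3.arr 5 := hK4.arr 5
      have e40 : s4.reg 40 = s3.reg 40 := hK4.reg 40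
      refine ⟨⟨?_, ?_, ?_, ?_⟩, ?_, ?_, ?_⟩
      · have hK2 : Keep [1, 7, 8, 9] [3, 4] s (s1.put 33 (B j)) := hK.put _ (by decide)
        exact (hK2.trans hK3 : Keep [1, 7, 8, 9] [3, 4] s s3).trans hK4
      · exact hC.next (by rw [e5]; exact hE3) (by rw [e5, e40]; exact hT3)
          (by rw [e40]; exact h40) (by rw [e5]; exact hP) h6 h7' h41'
      · rw [h41']
        split
        · omega
        · omega
      · intro x
        have h0 : 0 < 2 ^ w := by omega
        have hp : s3.reg 34 < 2 ^ w := by omega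
        rw [h6, Function.update_apply]
        split
        · split
          · exact hp
          · exact h0
        · exact hlt6 x
      · rw [hK4.reg 31, hK3.reg 31]; simp [h31]
      · rw [hK4.reg 9, hK3.reg 9]; simp [h9']
      · rw [hK4.reg 1, hK3.reg 1]; simp [h1']
  have hinit : ∀ x v, Run w G (.const x 0) v 1 (fun s' => s' = v.put x 0) := fun x v =>
    Run.straight (by simp [Safe]) le_rfl rfl
  refine ((hinit 40 s).seq fun s1 hs1 => (hinit 41 s1).seq fun s2 hs2 =>
    hloop s2 ?_).mono (by nlinarith) fun s' hs' => hs'.1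
  subst hs1 hs2
  refine ⟨((Keep.refl _ _ _).put _ (by decide)).put _ (by decide), ⟨?_, ?_, ?_, ?_, ?_, ?_, ?_⟩,
    ?_, ?_⟩
  · refine ⟨fun x => ?_, fun x y _ h => ?_⟩
    · simp [z5]
    · simp [z5] at h
  · simp
  · intro u hu; omega
  · intro u hu; omega
  · intro p _
    rw [Finset.range_zero, Finset.filter_empty, Finset.card_empty]
    simp [z7]
  · intro p; simp [z7]
  · intro ht p _ h
    simp [z7] at h
    omega
  · simp
  · intro x
    simp [z6]

end Finalize

/-! ### Extraction of the biclique from the classified vertices -/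

section Output

variable {w n : ℕ} {G : SimpleGraph (Fin n)}

theorem run_const {s : Mem} {x v : ℕ} (h : v < 2 ^ w) :
    Run w G (.const x v) s 1 fun s' => s' = s.put x v :=
  Run.straight h le_rfl rfl

/-- A loop that lists in array `a` those `X j` for which `f j = 1`. -/
theorem run_list {s : Mem} {body : Prog} {a len N : ℕ} {f X : ℕ → ℕ} {R A : List ℕ}
    (hf : ∀ j, f j ≤ 1) (hlen : s.reg len = N) (h1 : s.reg 1 = 1) (hN : N < 2 ^ w) (hw : 2 ≤ 2 ^ w)
    (hl20 : 20 ≠ len) (hl21 : 21 ≠ len) (hl44 : len ≠ 44)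
    (hR : 1 ∈ R ∧ len ∈ R ∧ 20 ∉ R ∧ 21 ∉ R ∧ 44 ∉ R)
    (hbody : ∀ j < N, ∀ s', Keep R A s s' → s'.reg 20 = j → s'.reg 44 ≤ j →
      Run w G body s' 20 fun s'' => Keep (20 :: R) A s' s'' ∧
        s''.arr a = (if f j = 1 then Function.update (s'.arr a) (s'.reg 44) (X j)
          else s'.arr a) ∧ s''.reg 44 = s'.reg 44 + f j) :
    Run w G (.const 44 0 ;; forLoop 20 21 len body) s (N * 25 + 7) fun s' =>
      Keep R A s s' ∧ ∀ j < N, f j = 1 → s'.arr a (∑ i ∈ Finset.range j, f i) = X j := by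
  let I : ℕ → Mem → Prop := fun j s' => Keep R A s s' ∧
    s'.reg 44 = ∑ i ∈ Finset.range j, f i ∧
    ∀ i < j, f i = 1 → s'.arr a (∑ i' ∈ Finset.range i, f i') = X i
  refine ((run_const (by omega)).seq (R := I N) (B' := N * 25 + 5) ?_).mono (by omega)
    fun s' h => ⟨h.1, h.2.2⟩
  rintro s1 rfl
  refine (Run.forLoop (B := 20) (N := N) I (by decide) hl20 hl21 (by decide) (by decide) hw hN
    ?_ ?_ ?_ ?_ ?_).mono le_rfl fun s' h => h.1
  · rintro j s' x v hx ⟨hK, h44, h⟩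
    have hx' : x ∉ R ∧ x ≠ 44 := by
      rcases hx with rfl | rfl
      · exact ⟨hR.2.2.1, by decide⟩
      · exact ⟨hR.2.2.2.1, by decide⟩
    exact ⟨hK.put _ hx'.1, by simp [hx'.2.symm, h44], h⟩
  · rintro j hj s' ⟨hK, h44, h⟩ h20 hl' h1'
    have hle : ∑ i ∈ Finset.range j, f i ≤ j := by
      calc ∑ i ∈ Finset.range j, f i ≤ ∑ i ∈ Finset.range j, 1 :=
            Finset.sum_le_sum fun i _ => hf i
        _ = j := by simp
    refine (hbody j hj s' hK h20 (by omega)).mono le_rfl ?_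
    rintro s'' ⟨hK', ha, h44'⟩
    have hKR : Keep R A s s'' := hK.trans hK'
      (fun x hx => ⟨hx, List.mem_cons_of_mem _ hx⟩) fun x hx => ⟨hx, hx⟩
    refine ⟨⟨hKR, ?_, ?_⟩, ?_, ?_, ?_⟩
    · rw [h44', h44, Finset.sum_range_succ]
    · intro i hi hfi
      rw [ha]
      rcases Nat.lt_succ_iff_lt_or_eq.1 hi with hi | rfl
      · have hlt : ∑ i' ∈ Finset.range i, f i' < ∑ i' ∈ Finset.range j, f i' := by
          calc ∑ i' ∈ Finset.range i, f i' < ∑ i' ∈ Finset.range (i + 1), f i' := by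
                rw [Finset.sum_range_succ, hfi]; omega
            _ ≤ _ := Finset.sum_le_sum_of_subset (Finset.range_mono hi)
        split
        · rw [Function.update_of_ne (by omega), h i hi hfi]
        · exact h i hi hfi
      · rw [if_pos hfi, h44, Function.update_self]
    · rw [hK'.reg 20 (by simp), h20]
    · rw [hKR.reg len hR.2.1, hlen]
    · rw [hKR.reg 1 hR.1, h1]
  · simp [hl44, hlen]
  · simp [h1]
  · exact ⟨(Keep.refl _ _ _).put _ hR.2.2.2.2, by simp, fun i hi => by omega⟩

theorem run_listLeft {s : Mem} {A : ℕ → ℕ} {r v : ℕ} (h1 : s.reg 1 = 1) (h7 : s.reg 7 = r)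
    (h43 : s.reg 43 = v) (h3 : s.arr 3 = A) (hA : ∀ i < r, A i < 2 ^ w) (hr : r + 1 < 2 ^ w) :
    Run w G listLeft s (r * 25 + 7) fun s' => Keep [1, 7, 8, 9, 42] [3, 4, 6] s s' ∧
      ∀ i < r, adjBit G (A i) v = 1 → s'.arr 0 (nbrCount G A v i) = A i := by
  have hw0 : w ≠ 0 := by rintro rfl; omega
  refine (run_list (R := [1, 7, 8, 9, 42, 43]) (A := [3, 4, 6]) (a := 0)
    (f := fun i => adjBit G (A i) v) (X := A) (fun _ => adjBit_le _ _) h7 h1 (by omega) (by omega)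
    (by decide) (by decide) (by decide) (by decide) ?_).mono le_rfl fun s' h =>
      ⟨⟨fun x hx => h.1.1 x ?_, h.1.2⟩, h.2⟩
  · intro j hj s' hK h20 h44
    have e43 : s'.reg 43 = v := by rw [hK.reg 43, h43]
    have e3 : s'.arr 3 = A := by rw [hK.arr 3, h3]
    have hAj := hA j hj
    by_cases hb : adjBit G (A j) v = 1
    · refine Run.straight ?_ (by decide) ?_
      · simp [Safe, straight, Op.eval, h20, e43, e3, hb, hK.reg 1, h1]
        omega
      · simp [straight, Op.eval, h20, e43, e3, hb, hK.reg 1, h1, Keep]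
    · have hb0 : adjBit G (A j) v = 0 := by have := adjBit_le (G := G) (A j) v; omega
      refine Run.straight ?_ (by decide) ?_
      · simp [Safe, straight, h20, e43, e3, hb0]
        omega
      · simp [straight, h20, e43, e3, hb0, Keep]
  · simp only [List.mem_cons, List.not_mem_nil, or_false] at hx ⊢
    omega

theorem run_listRight {s : Mem} {B F : ℕ → ℕ} {N l : ℕ} (h1 : s.reg 1 = 1) (h9 : s.reg 9 = N)
    (h42 : s.reg 42 = l) (h4 : s.arr 4 = B) (h6 : s.arr 6 = F) (hB : ∀ j < N, B j < 2 ^ w)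
    (hF : ∀ j < N, F j < 2 ^ w) (hN : N + 1 < 2 ^ w) :
    Run w G listRight s (N * 25 + 7) fun s' => Keep [1, 8] [0] s s' ∧
      ∀ j < N, F j = l →
        s'.arr 1 (∑ i ∈ Finset.range j, if F i = l then 1 else 0) = B j := by
  have hw0 : w ≠ 0 := by rintro rfl; omega
  refine (run_list (R := [1, 8, 9, 42]) (A := [0, 4, 6]) (a := 1)
    (f := fun i => if F i = l then 1 else 0) (X := B) (fun _ => by split <;> omega) h9 h1
    (by omega) (by omega) (by decide) (by decide) (by decide) (by decide) ?_).mono le_rfl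
      fun s' h => ⟨⟨fun x hx => h.1.1 x ?_, fun x hx => h.1.2 x ?_⟩,
        fun j hj hl => h.2 j hj (if_pos hl)⟩
  · intro j hj s' hK h20 h44
    have e42 : s'.reg 42 = l := by rw [hK.reg 42, h42]
    have e4 : s'.arr 4 = B := by rw [hK.arr 4, h4]
    have e6 : s'.arr 6 = F := by rw [hK.arr 6, h6]
    have hBj := hB j hj
    have hFj := hF j hj
    by_cases hb : F j = l
    · refine Run.straight ?_ (by decide) ?_
      · simp [Safe, straight, Op.eval, h20, e42, e4, e6, hb, hK.reg 1, h1]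
        omega
      · simp [straight, Op.eval, h20, e42, e4, e6, hb, hK.reg 1, h1, Keep]
    · refine Run.straight ?_ (by decide) ?_
      · simp [Safe, straight, Op.eval, h20, e42, e6, hb]
        omega
      · simp [straight, Op.eval, h20, e42, e6, hb, Keep]
  · simp only [List.mem_cons, List.not_mem_nil, or_false] at hx ⊢
    omega
  · simp only [List.mem_cons, List.not_mem_nil, or_false] at hx ⊢
    omega

/-- There are enough candidate vertices to force a biclique. -/
structure Forced {n : ℕ} (G : SimpleGraph (Fin n)) (A B : ℕ → ℕ) (r N t : ℕ) : Prop where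
  pos : 1 ≤ t
  le : t ≤ r
  injA : Set.InjOn A (Set.Iio r)
  injB : Set.InjOn B (Set.Iio N)
  card : t * r.choose t ≤ ((Finset.range N).filter fun j => t ≤ nbrCount G A (B j) r).card

/-- Combines the pigeonhole argument with the trie: vertices with a common key share a leaf, so some
leaf reaches the count `t` and register `41` points to a vertex of such a leaf. -/
theorem Classified.found_of_forced {A B : ℕ → ℕ} {r t N : ℕ} {s : Mem}
    (h : Classified G A B r t N s) (hF : Forced G A B r N t) :
    s.reg 41 < N ∧ s.arr 6 (s.reg 41) ≠ 0 ∧ t ≤ nbrCount G A (B (s.reg 41)) r ∧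
      t ≤ ∑ i ∈ Finset.range N, if s.arr 6 i = s.arr 6 (s.reg 41) then 1 else 0 := by
  obtain ⟨j, hj, hjt, hcard⟩ := exists_common_key G A hF.pos hF.le hF.card
  have hpath := h.path j hj hjt
  have hp0 : s.arr 6 j ≠ 0 := by
    have hr : r ≠ 0 := by have := hF.pos; have := hF.le; omega
    obtain ⟨r, rfl⟩ := Nat.exists_eq_succ_of_ne_zero hr
    exact hpath.1
  have hle : t ≤ s.arr 7 (s.arr 6 j) := by
    rw [h.card _ hp0]
    refine hcard.trans (Finset.card_le_card fun u hu => ?_)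
    simp only [Finset.mem_filter, Finset.mem_range] at hu ⊢
    exact ⟨hu.1, (h.path u hu.1 hu.2.1).eq_of_eq hpath hu.2.2⟩
  obtain ⟨h1, h2, h3⟩ := h.found hF.pos _ hp0 hle
  refine ⟨h1, h2, ?_, ?_⟩
  · by_contra hlt
    exact h2 (h.none _ h1 (by omega))
  · rwa [h.card _ h2, Finset.card_filter] at h3

/-- The time bound and the announced size `t` do not depend on the quality of the candidates; only
the validity of the output needs `Forced`. This separates halting from success. -/
theorem run_finalize {s : Mem} {A B : ℕ → ℕ} {r N t : ℕ} (h1 : s.reg 1 = 1) (h7 : s.reg 7 = r)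
    (h8 : s.reg 8 = t) (h9 : s.reg 9 = N) (h3 : s.arr 3 = A) (h4 : s.arr 4 = B)
    (hA : ∀ i < r, A i < 2 ^ w) (hB : ∀ j, B j < 2 ^ w) (ht : t < 2 ^ w)
    (hw : 2 * ((N + 1) * (r + 1)) + 2 ≤ 2 ^ w) (z5 : ∀ x, s.arr 5 x = 0)
    (z6 : ∀ x, s.arr 6 x = 0)    (z7 : ∀ x, s.arr 7 x = 0) :
    Run w G finalize s (100 * ((N + 1) * (r + 1))) fun s' => s'.reg 0 = t ∧
      (Forced G A B r N t → OutputsBiclique G ⟨[], s'⟩) := by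
  have hNr : (N + 1) * (r + 1) = N * r + N + r + 1 := by ring
  have hw0 : w ≠ 0 := by rintro rfl; omega
  refine ((run_classify h1 h7 h8 h9 h3 h4 hA (fun j _ => hB j) ht hw z5 z6 z7).seq
    (B' := N * 25 + r * 25 + 23) ?_).mono (by nlinarith) fun s' h => h
  rintro s1 ⟨hK1, hC, h41, hlt6⟩
  have e3 : s1.arr 3 = A := by rw [hK1.arr 3, h3]
  have e4 : s1.arr 4 = B := by rw [hK1.arr 4, h4]
  have hl : Run w G (.load 42 6 41) s1 1 fun s' => s' = s1.put 42 (s1.arr 6 (s1.reg 41)) :=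
    Run.straight (hlt6 _) le_rfl rfl
  refine (hl.seq (B' := N * 25 + r * 25 + 21) ?_).mono (by omega) fun s' h => h
  rintro s2 rfl
  have hl' : Run w G (.load 43 4 41) (s1.put 42 (s1.arr 6 (s1.reg 41))) 1 fun s' =>
      s' = (s1.put 42 (s1.arr 6 (s1.reg 41))).put 43 (B (s1.reg 41)) :=
    Run.straight (by simpa [Safe, e4] using hB _) le_rfl (by simp [straight, e4])
  refine (hl'.seq (B' := N * 25 + r * 25 + 19) ?_).mono (by omega) fun s' h => h
  rintro s2 rfl
  refine ((run_listLeft (A := A) (r := r) (v := B (s1.reg 41)) (by simp [hK1.reg 1, h1])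
    (by simp [hK1.reg 7, h7]) (by simp) (by simp [e3]) hA (by omega)).seq
    (B' := N * 25 + 10) ?_).mono (by omega) fun s' h => h
  rintro s3 ⟨hK3, h0⟩
  have e6 : s3.arr 6 = s1.arr 6 := by rw [hK3.arr 6]; rfl
  refine ((run_listRight (B := B) (F := s1.arr 6) (N := N) (l := s1.arr 6 (s1.reg 41))
    (by rw [hK3.reg 1]; simp [hK1.reg 1, h1]) (by rw [hK3.reg 9]; simp [hK1.reg 9, h9])
    (by rw [hK3.reg 42]; simp) (by rw [hK3.arr 4]; simp [e4]) e6 (fun j _ => hB j)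
    (fun j _ => hlt6 j) (by omega)).seq (B' := 1) ?_).mono (by omega) fun s' h => h
  rintro s4 ⟨hK4, h4'⟩
  have e8 : s4.reg 8 = t := by rw [hK4.reg 8, hK3.reg 8]; simp [hK1.reg 8, h8]
  have e1 : s4.reg 1 = 1 := by rw [hK4.reg 1, hK3.reg 1]; simp [hK1.reg 1, h1]
  have e0 : s4.arr 0 = s3.arr 0 := hK4.arr 0
  refine Run.straight (by simp [copyReg, Safe, Op.eval, e1, e8, ht]) le_rfl ?_
  refine ⟨by simp [copyReg, straight, Op.eval, e1, e8], fun hF => ?_⟩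
  obtain ⟨g1, g2, g3, g4⟩ := hC.found_of_forced hF
  have hsize : outSize ⟨[], straight G (copyReg 0 8) s4⟩ = t := by
    simp [outSize, copyReg, straight, Op.eval, e1, e8]
  -- The left side consists of the first `t` neighbours of the vertex found, that is, of the ones of
  -- its key.
  have left : ∀ c < t, ∃ i < r, s4.arr 0 c = A i ∧ nbrCount G A (B (s1.reg 41)) i = c ∧
      keyBit G A t (B (s1.reg 41)) i = 1 := by
    intro c hc
    obtain ⟨i, hi, hb, hs⟩ := exists_sum_range_eq
      (fun i => adjBit_le (G := G) (A i) (B (s1.reg 41))) (lt_of_lt_of_le hc g3)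
    refine ⟨i, hi, ?_, hs, ?_⟩
    · rw [e0, ← h0 i hi hb, nbrCount, hs]
    · rw [keyBit, nbrCount, hs, if_pos hc, hb]
  have right : ∀ c < t, ∃ u < N, s4.arr 1 c = B u ∧ s1.arr 6 u = s1.arr 6 (s1.reg 41) ∧
      (∑ i ∈ Finset.range u, if s1.arr 6 i = s1.arr 6 (s1.reg 41) then 1 else 0) = c := by
    intro c hc
    obtain ⟨u, hu, hb, hs⟩ := exists_sum_range_eq
      (f := fun i => if s1.arr 6 i = s1.arr 6 (s1.reg 41) then 1 else 0)
      (fun i => by split <;> omega) (lt_of_lt_of_le hc g4)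
    have hu' : s1.arr 6 u = s1.arr 6 (s1.reg 41) := by
      by_contra hne
      simp [hne] at hb
    refine ⟨u, hu, ?_, hu', hs⟩
    rw [← h4' u hu hu', hs]
  -- A right vertex lies at the same leaf as the vertex found, so it has the same key, and a one in
  -- the key means adjacency.
  have edge : ∀ c < t, ∀ d < t, NatAdj G (s4.arr 0 c) (s4.arr 1 d) := by
    intro c hc d hd
    obtain ⟨i, hi, e, -, hb⟩ := left c hc
    obtain ⟨u, hu, e', hl, -⟩ := right d hd
    have hg : t ≤ nbrCount G A (B u) r := by
      by_contra hlt
      exact g2 (by rw [← hl]; exact hC.none u hu (by omega))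
    have hbits := (hC.path u hu hg).bits_eq hC.trie (keyBit_le _ _ _ _) (keyBit_le _ _ _ _)
      (by rw [hl]; exact hC.path _ g1 g3) i hi
    rw [e, e']
    refine natAdj_of_adjBit G ?_
    rw [hb, keyBit] at hbits
    split at hbits
    · exact hbits
    · omega
  refine ⟨?_, ?_, ?_, ?_⟩ <;> rw [hsize]
  · intro c hc
    obtain ⟨h, h', -⟩ := edge c hc c hc
    exact ⟨h, h'⟩
  · intro c hc d hd hcd
    obtain ⟨i, hi, e, hs, -⟩ := left c hc
    obtain ⟨i', hi', e', hs', -⟩ := left d hd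
    have : A i = A i' := by rw [← e, ← e']; exact hcd
    rw [← hs, ← hs', hF.injA hi hi' this]
  · intro c hc d hd hcd
    obtain ⟨i, hi, e, -, hs⟩ := right c hc
    obtain ⟨i', hi', e', -, hs'⟩ := right d hd
    have : B i = B i' := by rw [← e, ← e']; exact hcd
    rw [← hs, ← hs', hF.injB hi hi' this]
  · exact edge

end Output

section Parameters

/-! ## The program that computes the parameters of the search -/

/-- Repeatedly multiply `n²` by `a / b`, rounding down. -/
def shrink (n a b : ℕ) : ℕ → ℕ
  | 0 => n * n
  | k + 1 => shrink n a b k * a / b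

theorem exists_shrink_le (n a b : ℕ) : ∃ k, shrink n a b k ≤ n ∨ n ≤ k := ⟨n, .inr le_rfl⟩

/-- The number of steps in which `shrink` reaches `n`, or `n` if that is smaller. -/
noncomputable def shrinkTime (n a b : ℕ) : ℕ := Nat.find (exists_shrink_le n a b)

theorem shrinkTime_le (n a b : ℕ) : shrinkTime n a b ≤ n := Nat.find_le (.inr le_rfl)

theorem lt_shrink {n a b k : ℕ} (h : k < shrinkTime n a b) : n < shrink n a b k ∧ k < n := by
  have := Nat.find_min (exists_shrink_le n a b) h
  omega

theorem shrink_shrinkTime (n a b : ℕ) :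
    shrink n a b (shrinkTime n a b) ≤ n ∨ n ≤ shrinkTime n a b :=
  Nat.find_spec (exists_shrink_le n a b)

theorem shrink_le {n a b : ℕ} (h : a ≤ b) (k : ℕ) : shrink n a b k ≤ n * n := by
  induction k with
  | zero => exact le_rfl
  | succ k ih =>
    refine (Nat.div_le_of_le_mul ?_).trans ih
    rw [mul_comm]
    exact Nat.mul_le_mul_right _ h

theorem exists_le_cube (m : ℕ) : ∃ k, m ≤ k * k * k := by
  refine ⟨m, ?_⟩
  rcases Nat.eq_zero_or_pos m with rfl | h
  · simp
  · calc m = 1 * 1 * m := by ring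
      _ ≤ m * m * m := by gcongr <;> omega

/-- The cube root of `m`, rounded up. -/
noncomputable def cubeRoot (m : ℕ) : ℕ := Nat.find (exists_le_cube m)

theorem le_cubeRoot (m : ℕ) : m ≤ cubeRoot m * cubeRoot m * cubeRoot m :=
  Nat.find_spec (exists_le_cube m)

theorem cube_lt {m k : ℕ} (h : k < cubeRoot m) : k * k * k < m := by
  have := Nat.find_min (exists_le_cube m) h
  omega

theorem cubeRoot_le (m : ℕ) : cubeRoot m ≤ m := by
  refine Nat.find_le ?_
  rcases Nat.eq_zero_or_pos m with rfl | h
  · simp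
  · calc m = 1 * 1 * m := by ring
      _ ≤ m * m * m := by gcongr <;> omega

/-- The accuracy parameter for `n` vertices and estimated density `a / b`. -/
noncomputable def accuracy (n a b : ℕ) : ℕ :=
  cubeRoot (min (shrinkTime n a b) (shrinkTime n (b - a) b))

/-- The number of vertices on the left from which the biclique is chosen. -/
noncomputable def leftSize (n a b : ℕ) : ℕ :=
  shrinkTime n a b * shrinkTime n (b - a) b * b * (accuracy n a b - 4) /
    ((a * shrinkTime n (b - a) b + (b - a) * shrinkTime n a b) * accuracy n a b)

/-- The size of the biclique that is searched for. -/
noncomputable def bicliqueSize (n a b : ℕ) : ℕ :=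
  (b * accuracy n a b - (b - a)) * a * leftSize n a b / (b * b * accuracy n a b)

theorem accuracy_le (n a b : ℕ) : accuracy n a b ≤ n :=
  (cubeRoot_le _).trans ((min_le_left _ _).trans (shrinkTime_le _ _ _))

/-- Up to a factor at most `1`, this is a weighted harmonic mean of two shrinking times, each at
most `n`. -/
theorem leftSize_le {n a b : ℕ} (h : a ≤ b) : leftSize n a b ≤ n := by
  refine Nat.div_le_of_le_mul ?_
  have h1 := shrinkTime_le n a b
  have h2 := shrinkTime_le n (b - a) b
  set R := shrinkTime n a b
  set R' := shrinkTime n (b - a) b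
  set k := accuracy n a b
  obtain ⟨c, rfl⟩ := Nat.exists_eq_add_of_le h
  rw [Nat.add_sub_cancel_left]
  calc R * R' * (a + c) * (k - 4) ≤ R * R' * (a + c) * k := by gcongr; omega
    _ = (a * R' * R + c * R * R') * k := by ring
    _ ≤ (a * R' * n + c * R * n) * k := by gcongr
    _ = (a * R' + c * R) * k * n := by ring

variable {w n : ℕ} {G : SimpleGraph (Fin n)}

/-- Compute in register `26` the shrinking time for the numerator in register `25`. -/
def countShrink : Prog :=
  (.arith .mul 24 0 0 ;; .const 26 0 ;; .arith .lt 21 0 24 ;; .arith .lt 22 26 0 ;;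
    .arith .mul 21 21 22) ;;
  .loop 21 (.arith .mul 24 24 25 ;; .arith .div 24 24 3 ;; .arith .add 26 26 1 ;;
    .arith .lt 21 0 24 ;; .arith .lt 22 26 0 ;; .arith .mul 21 21 22)

/-- Compute in register `6` the cube root of register `26`. -/
def computeRoot : Prog :=
  (.const 6 0 ;; .arith .mul 22 6 6 ;; .arith .mul 22 22 6 ;; .arith .lt 21 22 26) ;;
  .loop 21 (.arith .add 6 6 1 ;; .arith .mul 22 6 6 ;; .arith .mul 22 22 6 ;;
    .arith .lt 21 22 26)

/-- Compute the parameters from the number of vertices in register `0` and the estimated density,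
which is the quotient of registers `2` and `3`. -/
def computeParams : Prog :=
  copyReg 25 2 ;; countShrink ;; copyReg 4 26 ;; .arith .sub 25 3 2 ;; countShrink ;;
  (copyReg 5 26 ;; .arith .lt 21 4 5 ;; .ite 21 (copyReg 26 4) (copyReg 26 5)) ;; computeRoot ;;
  .const 27 4 ;; .arith .sub 27 6 27 ;; .arith .mul 28 4 5 ;; .arith .mul 28 28 3 ;;
  .arith .mul 28 28 27 ;; .arith .mul 29 2 5 ;; .arith .mul 30 25 4 ;; .arith .add 29 29 30 ;;
  .arith .mul 29 29 6 ;; .arith .div 7 28 29 ;; .arith .mul 28 3 6 ;; .arith .sub 28 28 25 ;;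
  .arith .mul 28 28 2 ;; .arith .mul 28 28 7 ;; .arith .mul 29 3 3 ;; .arith .mul 29 29 6 ;;
  .arith .div 8 28 29 ;; .arith .div 10 0 7

/-- Room for all products formed by the program; the largest bounds needed are of order `n ^ 6`. -/
theorem pow_lt_word {m : ℕ} (hw : (n + 2) ^ 10 ≤ 2 ^ w) (hm : m ≤ 9) : 2 * n ^ m + 1 < 2 ^ w := by
  have h1 : n ^ m ≤ (n + 2) ^ m := Nat.pow_le_pow_left (by omega) _
  have h2 : (n + 2) ^ m ≤ (n + 2) ^ 9 := Nat.pow_le_pow_right (by omega) hm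
  have h3 : 1 ≤ (n + 2) ^ m := Nat.one_le_pow _ _ (by omega)
  have h4 : (n + 2) ^ 10 = (n + 2) ^ 9 * n + 2 * (n + 2) ^ 9 := by ring
  have h5 : n ^ m = 0 ∨ 1 ≤ (n + 2) ^ 9 * n ∨ m = 0 := by
    rcases Nat.eq_zero_or_pos n with rfl | hn
    · rcases Nat.eq_zero_or_pos m with rfl | h
      · simp
      · simp [h.ne']
    · right; left
      exact Nat.mul_pos (by positivity) hn
  rcases h5 with h5 | h5 | h5
  · rw [h5]
    have : 2 ^ 10 ≤ (n + 2) ^ 10 := Nat.pow_le_pow_left (by omega) _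
    omega
  · have : n ^ m < (n + 2) ^ 9 ∨ n ^ m = (n + 2) ^ 9 := by omega
    rcases this with h | h
    · omega
    · have : n ^ m ≤ n ^ 9 := by
        rcases Nat.eq_zero_or_pos n with rfl | hn
        · simp at h5
        · exact Nat.pow_le_pow_right hn hm
      have : n ^ 9 < (n + 2) ^ 9 := Nat.pow_lt_pow_left (by omega) (by omega)
      omega
  · subst h5
    have : 2 ^ 10 ≤ (n + 2) ^ 10 := Nat.pow_le_pow_left (by omega) _
    rw [pow_zero]
    omega

theorem run_countShrink {s : Mem} {a b : ℕ} (hw : (n + 2) ^ 10 ≤ 2 ^ w) (h0 : s.reg 0 = n)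
    (h1 : s.reg 1 = 1) (h25 : s.reg 25 = a) (h3 : s.reg 3 = b) (hab : a ≤ b) (hb : b ≤ n * n) :
    Run w G countShrink s (n * 12 + 11) fun s' =>
      Keep [0, 1, 2, 3, 4, 5, 25] [2, 3, 4, 5, 6, 7] s s' ∧ s'.reg 26 = shrinkTime n a b := by
  have hw4 := pow_lt_word (m := 4) hw (by norm_num)
  have hw2 := pow_lt_word (m := 2) hw (by norm_num)
  have hw1 := pow_lt_word (m := 1) hw (by norm_num)
  rw [pow_one] at hw1
  have hT := shrinkTime_le n a b
  let bit : ℕ → ℕ := fun k => if k < shrinkTime n a b then 1 else 0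
  -- The loop condition is a product of two tests. The test `k < n` guarantees termination even when
  -- the values do not shrink, as for `a = b`.
  have hbit : ∀ k ≤ shrinkTime n a b,
      (if n < shrink n a b k then 1 else 0) * (if k < n then 1 else 0) = bit k := by
    intro k hk
    simp only [bit]
    rcases Nat.lt_or_eq_of_le hk with hk | rfl
    · rw [if_pos (lt_shrink hk).1, if_pos (lt_shrink hk).2, if_pos hk]
    · rcases shrink_shrinkTime n a b with h | h
      · rw [if_neg (show ¬ n < _ by omega), if_neg (lt_irrefl _), zero_mul]
      · rw [if_neg (show ¬ _ < n by omega), if_neg (lt_irrefl _), mul_zero]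
  have hbit1 : ∀ k, bit k ≤ 1 := fun k => by simp only [bit]; split <;> omega
  let I : ℕ → Mem → Prop := fun k s' => Keep [0, 1, 2, 3, 4, 5, 25] [2, 3, 4, 5, 6, 7] s s' ∧
    s'.reg 24 = shrink n a b k ∧ s'.reg 26 = k ∧ s'.reg 21 = bit k
  have hite : ∀ p : Prop, ∀ [Decidable p], (if p then 1 else 0) < 2 ^ w := fun p _ => by
    split <;> omega
  have hfirst : Run w G (.arith .mul 24 0 0 ;; .const 26 0 ;; .arith .lt 21 0 24 ;;
      .arith .lt 22 26 0 ;; .arith .mul 21 21 22) s 9 (I 0) := by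
    have e := hbit 0 (Nat.zero_le _)
    rw [shrink] at e
    have := hbit1 0
    refine Run.straight ?_ (by decide) ?_
    · simp only [Safe, straight, Op.eval, h0, Mem.put_reg, Nat.reduceEqDiff, if_true, if_false]
      simp only [e, hite]
      refine ⟨by nlinarith, by omega, trivial, trivial, by omega⟩
    · refine ⟨?_, ?_, ?_, ?_⟩
      · simp [straight, Keep]
      · simp [straight, Op.eval, h0, shrink]
      · simp [straight]
      · simp only [straight, Op.eval, h0, Mem.put_reg, Nat.reduceEqDiff, if_true, if_false]
        exact e
  refine (hfirst.seq (B' := n * 12 + 1) (R := I (shrinkTime n a b)) ?_).mono (by omega)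
    fun s' h => ⟨h.1, h.2.2.1⟩
  intro s1 hs1
  refine (Run.loop (B := 11) I (shrinkTime n a b) ?_ ?_ hs1).mono (by omega) fun s' h => h
  · rintro k hk s2 ⟨hK, h24, h26, h21⟩
    refine ⟨by rw [h21]; simp [bit, hk], ?_⟩
    have e := hbit (k + 1) hk
    have e0 : s2.reg 0 = n := by rw [hK.reg 0, h0]
    have e1 : s2.reg 1 = 1 := by rw [hK.reg 1, h1]
    have e3 : s2.reg 3 = b := by rw [hK.reg 3, h3]
    have e25 : s2.reg 25 = a := by rw [hK.reg 25, h25]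
    have e' : shrink n a b k * a / b = shrink n a b (k + 1) := rfl
    have hsl := shrink_le (n := n) hab k
    have hsl' := shrink_le (n := n) hab (k + 1)
    have hmul : shrink n a b k * a ≤ n ^ 4 := by
      calc shrink n a b k * a ≤ (n * n) * (n * n) := Nat.mul_le_mul hsl (hab.trans hb)
        _ = n ^ 4 := by ring
    have := hbit1 (k + 1)
    have hkeep : ∀ s'', Keep [0, 1, 2, 3, 4, 5, 25] [2, 3, 4, 5, 6, 7] s2 s'' →
      Keep [0, 1, 2, 3, 4, 5, 25] [2, 3, 4, 5, 6, 7] s s'' := fun s'' h => hK.trans h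
    refine Run.straight ?_ (by decide) ?_
    · simp only [Safe, straight, Op.eval, h24, h26, e0, e1, e3, e25, Mem.put_reg,
        Nat.reduceEqDiff, if_true, if_false, e']
      simp only [e, hite]
      refine ⟨by omega, by nlinarith, by omega, trivial, trivial, by omega⟩
    · refine ⟨hkeep _ ?_, ?_, ?_, ?_⟩
      · simp [straight, Keep]
      · simp [straight, Op.eval, h24, e25, e3, e']
      · simp [straight, Op.eval, h26, e1]
      · simp only [straight, Op.eval, h24, h26, e0, e1, e3, e25, Mem.put_reg,
          Nat.reduceEqDiff, if_true, if_false, e']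
        exact e
  · rintro s2 ⟨-, -, -, h21⟩
    rw [h21]
    simp [bit]

theorem run_computeRoot {s : Mem} {m : ℕ} (hw : (n + 2) ^ 10 ≤ 2 ^ w)
    (h1 : s.reg 1 = 1) (h26 : s.reg 26 = m) (hm : m ≤ n) :
    Run w G computeRoot s (n * 8 + 9) fun s' =>
      Keep [0, 1, 2, 3, 4, 5, 25] [2, 3, 4, 5, 6, 7] s s' ∧ s'.reg 6 = cubeRoot m := by
  have hw3 := pow_lt_word (m := 3) hw (by norm_num)
  have hw2 := pow_lt_word (m := 2) hw (by norm_num)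
  have hw1 := pow_lt_word (m := 1) hw (by norm_num)
  rw [pow_one] at hw1
  have hT := cubeRoot_le m
  let I : ℕ → Mem → Prop := fun k s' => Keep [0, 1, 2, 3, 4, 5, 25, 26] [2, 3, 4, 5, 6, 7] s s' ∧
    s'.reg 6 = k ∧ s'.reg 21 = if k < cubeRoot m then 1 else 0
  have hbit : ∀ k ≤ cubeRoot m, (if k * k * k < m then 1 else 0) =
      if k < cubeRoot m then 1 else 0 := by
    intro k hk
    rcases Nat.lt_or_eq_of_le hk with hk | rfl
    · rw [if_pos (cube_lt hk), if_pos hk]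
    · have := le_cubeRoot m
      rw [if_neg (by omega), if_neg (lt_irrefl _)]
  have hite : ∀ p : Prop, ∀ [Decidable p], (if p then 1 else 0) < 2 ^ w := fun p _ => by
    split <;> omega
  have hfirst : Run w G (.const 6 0 ;; .arith .mul 22 6 6 ;; .arith .mul 22 22 6 ;;
      .arith .lt 21 22 26) s 7 (I 0) := by
    have e := hbit 0 (Nat.zero_le _)
    refine Run.straight ?_ (by decide) ?_
    · simp [Safe, straight, Op.eval, hite]
    · refine ⟨?_, ?_, ?_⟩
      · simp [straight, Keep]
      · simp [straight]
      · simpa [straight, Op.eval, h26] using e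
  refine (hfirst.seq (B' := n * 8 + 1) (R := I (cubeRoot m)) ?_).mono (by omega)
    fun s' h => ⟨h.1.trans (Keep.refl [0, 1, 2, 3, 4, 5, 25, 26] [2, 3, 4, 5, 6, 7] s'), h.2.1⟩
  intro s1 hs1
  refine (Run.loop (B := 7) I (cubeRoot m) ?_ ?_ hs1).mono (by omega) fun s' h => h
  · rintro k hk s2 ⟨hK, h6, h21⟩
    refine ⟨by rw [h21]; simp [hk], ?_⟩
    have e := hbit (k + 1) hk
    have e1 : s2.reg 1 = 1 := by rw [hK.reg 1, h1]
    have e26 : s2.reg 26 = m := by rw [hK.reg 26, h26]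
    have hk1 : k + 1 ≤ n := by omega
    have hsq : (k + 1) * (k + 1) ≤ n ^ 2 := by nlinarith
    have hcu : (k + 1) * (k + 1) * (k + 1) ≤ n ^ 3 := by
      calc (k + 1) * (k + 1) * (k + 1) ≤ n ^ 2 * n := Nat.mul_le_mul hsq hk1
        _ = n ^ 3 := by ring
    have hkeep : ∀ s'', Keep [0, 1, 2, 3, 4, 5, 25, 26] [2, 3, 4, 5, 6, 7] s2 s'' →
      Keep [0, 1, 2, 3, 4, 5, 25, 26] [2, 3, 4, 5, 6, 7] s s'' := fun s'' h => hK.trans h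
    refine Run.straight ?_ (by decide) ?_
    · simp [Safe, straight, Op.eval, h6, e1, hite]
      omega
    · refine ⟨hkeep _ ?_, ?_, ?_⟩
      · simp [straight, Keep]
      · simp [straight, Op.eval, h6, e1]
      · simpa [straight, Op.eval, h6, e1, e26] using e
  · rintro s2 ⟨-, -, h21⟩
    rw [h21]
    simp

end Parameters

/-! ### Execution of the parameter formulas in integer arithmetic -/

section Parameters

variable {w n : ℕ} {G : SimpleGraph (Fin n)}

/-- Numerators and denominators stay integral until the divisions, and from `b ≤ n * n` and `R, R',
k, r ≤ n` no intermediate sum or product exceeds `2 * n ^ 6`. -/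
theorem run_formulas {s : Mem} {a b R R' k r t : ℕ} (hw : (n + 2) ^ 10 ≤ 2 ^ w) (h0 : s.reg 0 = n)
    (h2 : s.reg 2 = a) (h3 : s.reg 3 = b) (h4 : s.reg 4 = R) (h5 : s.reg 5 = R')
    (h6 : s.reg 6 = k) (h25 : s.reg 25 = b - a) (hn : 1 ≤ n)
    (hab : a ≤ b) (hb : b ≤ n * n) (hR : R ≤ n) (hR' : R' ≤ n) (hk : k ≤ n)
    (hr : R * R' * b * (k - 4) / ((a * R' + (b - a) * R) * k) = r) (hrn : r ≤ n)
    (ht : (b * k - (b - a)) * a * r / (b * b * k) = t) :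
    Run w G (.const 27 4 ;; .arith .sub 27 6 27 ;; .arith .mul 28 4 5 ;; .arith .mul 28 28 3 ;;
      .arith .mul 28 28 27 ;; .arith .mul 29 2 5 ;; .arith .mul 30 25 4 ;; .arith .add 29 29 30 ;;
      .arith .mul 29 29 6 ;; .arith .div 7 28 29 ;; .arith .mul 28 3 6 ;; .arith .sub 28 28 25 ;;
      .arith .mul 28 28 2 ;; .arith .mul 28 28 7 ;; .arith .mul 29 3 3 ;; .arith .mul 29 29 6 ;;
      .arith .div 8 28 29 ;; .arith .div 10 0 7) s 40 fun s' =>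
      Keep [0, 1] [2, 3, 4, 5, 6, 7] s s' ∧ s'.reg 7 = r ∧ s'.reg 8 = t ∧ s'.reg 10 = n / r ∧
        t < 2 ^ w := by
  have hword : ∀ x m, m ≤ 9 → x ≤ 2 * n ^ m → x < 2 ^ w := fun x m hm hx => by
    have := pow_lt_word (m := m) hw hm
    omega
  have hle : ∀ i j, i ≤ j → n ^ i ≤ n ^ j := fun i j h => Nat.pow_le_pow_right hn h
  have ha : a ≤ n * n := hab.trans hb
  have hc : b - a ≤ n * n := (Nat.sub_le _ _).trans hb
  have hk4 : k - 4 ≤ n := by omega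
  have b1 : R * R' ≤ n ^ 2 := by rw [pow_two]; exact Nat.mul_le_mul hR hR'
  have b2 : R * R' * b ≤ n ^ 4 := by
    calc R * R' * b ≤ n ^ 2 * (n * n) := Nat.mul_le_mul b1 hb
      _ = n ^ 4 := by ring
  have b3 : R * R' * b * (k - 4) ≤ n ^ 5 := by
    calc R * R' * b * (k - 4) ≤ n ^ 4 * n := Nat.mul_le_mul b2 hk4
      _ = n ^ 5 := by ring
  have b4 : a * R' ≤ n ^ 3 := by
    calc a * R' ≤ (n * n) * n := Nat.mul_le_mul ha hR'
      _ = n ^ 3 := by ring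
  have b5 : (b - a) * R ≤ n ^ 3 := by
    calc (b - a) * R ≤ (n * n) * n := Nat.mul_le_mul hc hR
      _ = n ^ 3 := by ring
  have b6 : (a * R' + (b - a) * R) * k ≤ 2 * n ^ 4 := by
    calc (a * R' + (b - a) * R) * k ≤ (n ^ 3 + n ^ 3) * n :=
          Nat.mul_le_mul (Nat.add_le_add b4 b5) hk
      _ = 2 * n ^ 4 := by ring
  have b7 : b * k ≤ n ^ 3 := by
    calc b * k ≤ (n * n) * n := Nat.mul_le_mul hb hk
      _ = n ^ 3 := by ring
  have b8 : b * k - (b - a) ≤ n ^ 3 := (Nat.sub_le _ _).trans b7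
  have b9 : (b * k - (b - a)) * a ≤ n ^ 5 := by
    calc (b * k - (b - a)) * a ≤ n ^ 3 * (n * n) := Nat.mul_le_mul b8 ha
      _ = n ^ 5 := by ring
  have b10 : (b * k - (b - a)) * a * r ≤ n ^ 6 := by
    calc (b * k - (b - a)) * a * r ≤ n ^ 5 * n := Nat.mul_le_mul b9 hrn
      _ = n ^ 6 := by ring
  have b11 : b * b ≤ n ^ 4 := by
    calc b * b ≤ (n * n) * (n * n) := Nat.mul_le_mul hb hb
      _ = n ^ 4 := by ring
  have b12 : b * b * k ≤ n ^ 5 := by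
    calc b * b * k ≤ n ^ 4 * n := Nat.mul_le_mul b11 hk
      _ = n ^ 5 := by ring
  have b13 : t ≤ n ^ 6 := by
    rw [← ht]
    exact (Nat.div_le_self _ _).trans b10
  have b14 : n / r ≤ n := Nat.div_le_self _ _
  have hn1 : n ≤ n ^ 1 := by simp
  have h4w : 4 < 2 ^ w := lt_of_lt_of_le (by
    have : 3 ^ 10 ≤ (n + 2) ^ 10 := Nat.pow_le_pow_left (by omega) _
    omega) hw
  have htw := hword t 6 (by norm_num) (by omega)
  refine Run.straight ?_ (by decide) ?_
  · simp only [Safe, straight, Op.eval, h0, h2, h3, h4, h5, h6, h25, Mem.put_reg, Nat.reduceEqDiff,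
      if_true, if_false, OfNat.zero_ne_ofNat, hr, ht]
    refine ⟨h4w, ?_, ?_, ?_, ?_, ?_, ?_, ?_, ?_, ?_, ?_, ?_, ?_, ?_, ?_, ?_, htw, ?_⟩
    · exact hword _ 1 (by norm_num) (by omega)
    · exact hword _ 2 (by norm_num) (by omega)
    · exact hword _ 4 (by norm_num) (by omega)
    · exact hword _ 5 (by norm_num) (by omega)
    · exact hword _ 3 (by norm_num) (by omega)
    · exact hword _ 3 (by norm_num) (by omega)
    · exact hword _ 3 (by norm_num) (by omega)
    · exact hword _ 4 (by norm_num) (by omega)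
    · exact hword _ 1 (by norm_num) (by omega)
    · exact hword _ 3 (by norm_num) (by omega)
    · exact hword _ 3 (by norm_num) (by omega)
    · exact hword _ 5 (by norm_num) (by omega)
    · exact hword _ 6 (by norm_num) (by omega)
    · exact hword _ 4 (by norm_num) (by omega)
    · exact hword _ 5 (by norm_num) (by omega)
    · exact hword _ 1 (by norm_num) (by omega)
  · refine ⟨?_, ?_, ?_, ?_, htw⟩
    · simp [straight, Keep]
    · simp [straight, Op.eval, h2, h3, h4, h5, h6, h25, hr]
    · simp [straight, Op.eval, h2, h3, h4, h5, h6, h25, hr, ht]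
    · simp [straight, Op.eval, h0, h2, h3, h4, h5, h6, h25, hr]

theorem run_copyReg {s : Mem} {x y : ℕ} (h1 : s.reg 1 = 1) (h : s.reg y < 2 ^ w) :
    Run w G (copyReg x y) s 1 fun s' => s' = s.put x (s.reg y) :=
  Run.straight (by simpa [copyReg, Safe, Op.eval, h1] using h) le_rfl
    (by simp [copyReg, straight, Op.eval, h1])

theorem run_computeParams {s : Mem} {a b : ℕ} (hw : (n + 2) ^ 10 ≤ 2 ^ w) (h0 : s.reg 0 = n)
    (h1 : s.reg 1 = 1) (h2 : s.reg 2 = a) (h3 : s.reg 3 = b) (hn : 1 ≤ n) (hab : a ≤ b)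
    (hb : b ≤ n * n) :
    Run w G computeParams s (n * 32 + 100) fun s' =>
      Keep [0, 1] [2, 3, 4, 5, 6, 7] s s' ∧ s'.reg 7 = leftSize n a b ∧
        s'.reg 8 = bicliqueSize n a b ∧ s'.reg 10 = n / leftSize n a b ∧
        bicliqueSize n a b < 2 ^ w := by
  have hw2 := pow_lt_word (m := 2) hw (by norm_num)
  have hnn : n ≤ n ^ 2 := by nlinarith
  have hbw : b < 2 ^ w := by nlinarith
  have hR := shrinkTime_le n a b
  have hR' := shrinkTime_le n (b - a) b
  refine ((run_copyReg h1 (by omega)).seq (B' := n * 32 + 98) ?_).mono (by omega) fun s' h => h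
  rintro s1 rfl
  refine ((run_countShrink (a := a) (b := b) hw (by simp [h0]) (by simp [h1]) (by simp [h2])
    (by simp [h3]) hab hb).seq (B' := n * 20 + 86) ?_).mono (by omega) fun s' h => h
  rintro s2 ⟨hK2, h26⟩
  have h1' : s2.reg 1 = 1 := by rw [hK2.reg 1]; simp [h1]
  refine ((run_copyReg h1' (by omega)).seq (B' := n * 20 + 84) ?_).mono (by omega) fun s' h => h
  rintro s3 rfl
  have hsub : Run w G (.arith .sub 25 3 2) (s2.put 4 (s2.reg 26)) 1 fun s' =>
      s' = (s2.put 4 (shrinkTime n a b)).put 25 (b - a) := by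
    have e3 : s2.reg 3 = b := by rw [hK2.reg 3]; simp [h3]
    have e2 : s2.reg 2 = a := by rw [hK2.reg 2]; simp [h2]
    refine Run.straight ?_ le_rfl ?_
    · simp [Safe, Op.eval, e3, e2]; omega
    · simp [straight, Op.eval, e3, e2, h26]
  refine (hsub.seq (B' := n * 20 + 82) ?_).mono (by omega) fun s' h => h
  rintro s4 rfl
  have hK4 : Keep [0, 1, 2, 3, 5] [2, 3, 4, 5, 6, 7] s
      ((s2.put 4 (shrinkTime n a b)).put 25 (b - a)) :=
    ((((Keep.refl [0, 1, 2, 3, 4, 5] [2, 3, 4, 5, 6, 7] s).put _ (by decide)).trans hK2 :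
      Keep [0, 1, 2, 3, 5] [2, 3, 4, 5, 6, 7] s s2).put _ (by decide)).put _ (by decide)
  refine ((run_countShrink (a := b - a) (b := b) hw (by rw [hK4.reg 0, h0])
    (by rw [hK4.reg 1, h1]) (by simp)
    (by rw [hK4.reg 3, h3]) (Nat.sub_le _ _) hb).seq (B' := n * 8 + 70) ?_).mono (by omega)
      fun s' h => h
  rintro s5 ⟨hK5, h26'⟩
  have e1 : s5.reg 1 = 1 := by rw [hK5.reg 1, hK4.reg 1, h1]
  have e4 : s5.reg 4 = shrinkTime n a b := by rw [hK5.reg 4]; simp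
  have e25 : s5.reg 25 = b - a := by rw [hK5.reg 25]; simp
  have hmin : Run w G (copyReg 5 26 ;; .arith .lt 21 4 5 ;; .ite 21 (copyReg 26 4) (copyReg 26 5))
      s5 7 fun s' => Keep [0, 1, 2, 3, 4, 25] [2, 3, 4, 5, 6, 7] s5 s' ∧
        s'.reg 5 = shrinkTime n (b - a) b ∧
        s'.reg 26 = min (shrinkTime n a b) (shrinkTime n (b - a) b) := by
    by_cases hlt : shrinkTime n a b < shrinkTime n (b - a) b
    · refine Run.straight ?_ (by decide) ?_
      · simp [copyReg, Safe, straight, Op.eval, e1, e4, h26', hlt]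
        refine ⟨by omega, by rintro rfl; omega, by omega⟩
      · simp [copyReg, straight, Op.eval, e1, e4, h26', hlt, Keep]
        omega
    · refine Run.straight ?_ (by decide) ?_
      · simp [copyReg, Safe, straight, Op.eval, e1, e4, h26', hlt]
        omega
      · simp [copyReg, straight, Op.eval, e1, e4, h26', hlt, Keep]
        omega
  refine (hmin.seq (B' := n * 8 + 62) ?_).mono (by omega) fun s' h => h
  rintro s6 ⟨hK6, h5, h26''⟩
  refine ((run_computeRoot hw (by rw [hK6.reg 1, e1]) h26'' (by omega)).seq (B' := 40)
    ?_).mono (by omega) fun s' h => h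
  rintro s7 ⟨hK7, h6⟩
  have hK : Keep [0, 1, 2, 3] [2, 3, 4, 5, 6, 7] s s7 :=
    ((hK4.trans hK5 : Keep [0, 1, 2, 3] [2, 3, 4, 5, 6, 7] s s5).trans hK6 :
      Keep [0, 1, 2, 3] [2, 3, 4, 5, 6, 7] s s6).trans hK7
  refine (run_formulas (a := a) (b := b) (k := accuracy n a b) hw (by rw [hK.reg 0, h0])
    (by rw [hK.reg 2, h2])
    (by rw [hK.reg 3, h3]) (by rw [hK7.reg 4, hK6.reg 4, e4]) (by rw [hK7.reg 5, h5]) h6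
    (by rw [hK7.reg 25, hK6.reg 25, e25]) hn hab hb hR hR' (accuracy_le _ _ _) rfl
    (leftSize_le hab) rfl).mono le_rfl ?_
  rintro s8 ⟨hK8, h7, h8, h10, ht⟩
  exact ⟨hK.trans hK8, h7, h8, h10, ht⟩

end Parameters

section Random

/-! ## Random arrays -/

/-- The average of `F` over all arrays obtained from `arr` by filling the `m` cells `j`
from `i` on with independent random elements of the blocks `{j * q, …, j * q + q - 1}`. -/
noncomputable def avgFill (q : ℕ) : ℕ → ℕ → (ℕ → ℕ) → ((ℕ → ℕ) → ℝ) → ℝ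
  | 0, _, arr, F => F arr
  | m + 1, i, arr, F =>
    (∑ v ∈ Finset.range (max q 1), avgFill q m (i + 1) (Function.update arr i (i * q + v)) F) /
      (max q 1 : ℕ)

/-- The array `arr'` may result from `arr` by random filling. -/
def Filled (q m i : ℕ) (arr arr' : ℕ → ℕ) : Prop :=
  (∀ j, i ≤ j → j < i + m → j * q ≤ arr' j ∧ arr' j < j * q + max q 1) ∧
    ∀ j, (j < i ∨ i + m ≤ j) → arr' j = arr j

theorem Filled.cons {q m i v : ℕ} {arr arr' : ℕ → ℕ} (hv : v < max q 1)
    (h : Filled q m (i + 1) (Function.update arr i (i * q + v)) arr') :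
    Filled q (m + 1) i arr arr' ∧ arr' i = i * q + v := by
  have hi : arr' i = i * q + v := by
    rw [h.2 i (by omega), Function.update_self]
  refine ⟨⟨fun j hj1 hj2 => ?_, fun j hj => ?_⟩, hi⟩
  · rcases Nat.lt_or_eq_of_le hj1 with hj | rfl
    · exact h.1 j (by omega) (by omega)
    · rw [hi]; omega
  · rw [h.2 j (by omega), Function.update_of_ne (by omega)]

/-- The second moment method for random arrays. -/
theorem le_avgFill {q m i : ℕ} {arr : ℕ → ℕ} {F : (ℕ → ℕ) → ℝ} (α β c : ℝ) (h : ℕ → ℕ → ℝ)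
    (hz : ∀ j, i ≤ j → j < i + m → ∑ v ∈ Finset.range (max q 1), h j (j * q + v) = 0)
    (hF : ∀ arr', Filled q m i arr arr' →
      α - β * (c + ∑ j ∈ Finset.Ico i (i + m), h j (arr' j)) ^ 2 ≤ F arr') :
    α - β * (c ^ 2 + ∑ j ∈ Finset.Ico i (i + m),
      (∑ v ∈ Finset.range (max q 1), h j (j * q + v) ^ 2) / (max q 1 : ℕ)) ≤
      avgFill q m i arr F := by
  have hQ : (0 : ℝ) < (max q 1 : ℕ) := by
    have : 0 < max q 1 := by omega
    exact_mod_cast this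
  -- The number `c` is the total deviation of the cells already filled.
  induction m generalizing i arr c with
  | zero =>
    have := hF arr ⟨fun j h1 h2 => by omega, fun _ _ => rfl⟩
    simpa [avgFill] using this
  | succ m ih =>
    have hico : Finset.Ico i (i + (m + 1)) = insert i (Finset.Ico (i + 1) (i + 1 + m)) := by
      ext x
      simp only [Finset.mem_Ico, Finset.mem_insert]
      omega
    have hni : i ∉ Finset.Ico (i + 1) (i + 1 + m) := by simp
    have step : ∀ v ∈ Finset.range (max q 1),
        α - β * ((c + h i (i * q + v)) ^ 2 + ∑ j ∈ Finset.Ico (i + 1) (i + 1 + m),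
          (∑ v ∈ Finset.range (max q 1), h j (j * q + v) ^ 2) / (max q 1 : ℕ)) ≤
        avgFill q m (i + 1) (Function.update arr i (i * q + v)) F := by
      intro v hv
      rw [Finset.mem_range] at hv
      refine ih (c + h i (i * q + v)) (fun j h1 h2 => hz j (by omega) (by omega)) ?_
      intro arr' h'
      obtain ⟨h1, hi⟩ := h'.cons hv
      have := hF arr' h1
      rw [hico, Finset.sum_insert hni, hi, ← add_assoc] at this
      exact this
    rw [avgFill, le_div_iff₀ hQ]
    refine le_trans (le_of_eq ?_) (Finset.sum_le_sum step)
    set V := ∑ j ∈ Finset.Ico (i + 1) (i + 1 + m),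
      (∑ v ∈ Finset.range (max q 1), h j (j * q + v) ^ 2) / (max q 1 : ℕ) with hV
    rw [hico, Finset.sum_insert hni, ← hV]
    -- After expanding the square, the cross term is linear in `h i` and averages to zero by `hz`.
    -- This is where independence enters: only the variances add up.
    have e : ∀ v ∈ Finset.range (max q 1), α - β * ((c + h i (i * q + v)) ^ 2 + V) =
        (α - β * (c ^ 2 + V)) - β * (2 * c) * h i (i * q + v) - β * h i (i * q + v) ^ 2 :=
      fun v _ => by ring
    rw [Finset.sum_congr rfl e, Finset.sum_sub_distrib, Finset.sum_sub_distrib,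
      ← Finset.mul_sum, ← Finset.mul_sum, hz i le_rfl (by omega), Finset.sum_const,
      Finset.card_range, nsmul_eq_mul]
    field_simp
    ring

theorem avgFill_ge {q m i : ℕ} {arr : ℕ → ℕ} {F : (ℕ → ℕ) → ℝ} {α : ℝ}
    (hF : ∀ arr', Filled q m i arr arr' → α ≤ F arr') : α ≤ avgFill q m i arr F := by
  have := le_avgFill (F := F) (q := q) (m := m) (i := i) (arr := arr) α 0 0 (fun _ _ => 0)
    (by simp) (fun arr' h => by simpa using hF arr' h)
  simpa using this

/-- The mean of `g j` over the block with number `j`. -/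
noncomputable def blockMean (q : ℕ) (g : ℕ → ℕ → ℝ) (j : ℕ) : ℝ :=
  (∑ v ∈ Finset.range q, g j (j * q + v)) / q

/-- Chebyshev's inequality for random arrays. -/
theorem avgFill_chebyshev {q m : ℕ} (hq : 1 ≤ q) {arr : ℕ → ℕ} {F : (ℕ → ℕ) → ℝ} {α l V : ℝ}
    (g : ℕ → ℕ → ℝ) (hl : 0 < l) (hα : α ≤ 1)
    (hV : ∑ j ∈ Finset.range m,
      (∑ v ∈ Finset.range q, (g j (j * q + v) - blockMean q g j) ^ 2) / q ≤ V)
    (hF0 : ∀ arr', Filled q m 0 arr arr' → 0 ≤ F arr')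
    (hF : ∀ arr', Filled q m 0 arr arr' →
      |∑ j ∈ Finset.range m, g j (arr' j) - ∑ j ∈ Finset.range m, blockMean q g j| < l →
        α ≤ F arr') :
    α - V / l ^ 2 ≤ avgFill q m 0 arr F := by
  have hq0 : (0 : ℝ) < q := by exact_mod_cast hq
  have hmax : max q 1 = q := max_eq_left hq
  -- With `β = 1 / l ^ 2`, the lower bound is at most `α` for every deviation, and at most `α - 1 ≤
  -- 0` for deviations of at least `l`.
  have key := le_avgFill (F := F) (q := q) (m := m) (i := 0) (arr := arr) α (1 / l ^ 2) 0
    (fun j v => g j v - blockMean q g j) (fun j _ _ => by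
      rw [hmax, Finset.sum_sub_distrib, Finset.sum_const, Finset.card_range, nsmul_eq_mul,
        blockMean, mul_div_cancel₀ _ hq0.ne', sub_self]) (fun arr' h => by
      rw [zero_add, zero_add, ← Finset.range_eq_Ico, Finset.sum_sub_distrib]
      by_cases hd : |∑ j ∈ Finset.range m, g j (arr' j) -
          ∑ j ∈ Finset.range m, blockMean q g j| < l
      · exact le_trans (sub_le_self _ (by positivity)) (hF arr' h hd)
      · refine le_trans ?_ (hF0 arr' h)
        rw [not_lt] at hd
        have : l ^ 2 ≤ (∑ j ∈ Finset.range m, g j (arr' j) -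
            ∑ j ∈ Finset.range m, blockMean q g j) ^ 2 := by
          rw [← sq_abs (_ - _)]
          exact pow_le_pow_left₀ hl.le hd 2
        have h2 : 1 ≤ 1 / l ^ 2 * (∑ j ∈ Finset.range m, g j (arr' j) -
            ∑ j ∈ Finset.range m, blockMean q g j) ^ 2 := by
          rw [one_div, inv_mul_eq_div, one_le_div (by positivity)]
          exact this
        linarith)
  refine le_trans ?_ key
  rw [hmax, zero_add, ← Finset.range_eq_Ico, div_eq_mul_one_div V, mul_comm V]
  have : 1 / l ^ 2 * (0 ^ 2 + ∑ j ∈ Finset.range m,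
      (∑ v ∈ Finset.range q, (g j (j * q + v) - blockMean q g j) ^ 2) / q) ≤ 1 / l ^ 2 * V :=
    mul_le_mul_of_nonneg_left (by simpa using hV) (by positivity)
  linarith

/-- The variance of a `[0,1]`-valued function is at most `(1 - p) μ + p (1 - μ)`. -/
theorem block_variance_le {q : ℕ} (hq : 1 ≤ q) (f : ℕ → ℝ) (h0 : ∀ v < q, 0 ≤ f v)
    (h1 : ∀ v < q, f v ≤ 1) {μ p : ℝ} (hμ : (∑ v ∈ Finset.range q, f v) / q = μ)
    (hp0 : 0 ≤ p) (hp1 : p ≤ 1) :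
    (∑ v ∈ Finset.range q, (f v - μ) ^ 2) / q ≤ (1 - p) * μ + p * (1 - μ) := by
  have hq0 : (0 : ℝ) < q := by exact_mod_cast hq
  have hsum : ∑ v ∈ Finset.range q, f v = μ * q := by rw [← hμ]; field_simp
  have hμ0 : 0 ≤ μ := by
    rw [← hμ]
    exact div_nonneg (Finset.sum_nonneg fun v hv => h0 v (Finset.mem_range.1 hv)) hq0.le
  have hμ1 : μ ≤ 1 := by
    rw [← hμ, div_le_one hq0]
    calc ∑ v ∈ Finset.range q, f v ≤ ∑ v ∈ Finset.range q, (1 : ℝ) :=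
          Finset.sum_le_sum fun v hv => h1 v (Finset.mem_range.1 hv)
      _ = q := by simp
  rw [div_le_iff₀ hq0]
  have hle : ∀ v ∈ Finset.range q, (f v - μ) ^ 2 ≤ f v - 2 * μ * f v + μ ^ 2 := fun v hv => by
    have a := h0 v (Finset.mem_range.1 hv)
    have b := h1 v (Finset.mem_range.1 hv)
    nlinarith
  refine (Finset.sum_le_sum hle).trans ?_
  rw [Finset.sum_add_distrib, Finset.sum_sub_distrib, ← Finset.mul_sum, hsum, Finset.sum_const,
    Finset.card_range, nsmul_eq_mul]
  -- The right side exceeds the left by `(μ - p) ^ 2 + p * (1 - p)`. It is linear in `μ`, so it can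
  -- be summed over blocks when only the sum of the block means is known.
  have : (μ - μ ^ 2) ≤ (1 - p) * μ + p * (1 - μ) := by nlinarith [mul_nonneg hp0 (sub_nonneg.2 hμ1)]
  nlinarith

variable {w n : ℕ} {G : SimpleGraph (Fin n)}

/-- Fill the first cells of array `a`, as many as register `len` says, with random elements of
consecutive blocks of the size in register `q`. -/
def fillRandom (a len q : ℕ) : Prog :=
  (.const 20 0 ;; .arith .lt 21 20 len) ;;
  .loop 21 (.rand 22 q ;; .arith .mul 23 20 q ;; .arith .add 23 23 22 ;; .store a 20 23 ;;
    .arith .add 20 20 1 ;; .arith .lt 21 20 len)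

theorem val_loop (S : Set Config) {y : ℕ} (p : Prog) (k : List Prog) {s : Mem} (h : s.reg y ≠ 0)
    (T : ℕ) : val w G S (T + 1) ⟨.loop y p :: k, s⟩ = val w G S T ⟨p :: .loop y p :: k, s⟩ := by
  rw [val, val, steps_succ_of_step (c' := ⟨p :: .loop y p :: k, s⟩) (by simp [step, h])]

/-- Turns the random part of a run into the average `avgFill`: a lower bound `F` for the
continuation, given the filled array, passes to a lower bound for the whole. -/
theorem le_val_fillRandom {S : Set Config} (hS : ∀ c ∈ S, c.Halted) {s : Mem} {a len q N Q T : ℕ}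
    {R A : List ℕ} {k : List Prog} {F : (ℕ → ℕ) → ℝ} (h1 : s.reg 1 = 1) (hlen : s.reg len = N)
    (hq : s.reg q = Q) (hw : N * Q + N + Q + 2 ≤ 2 ^ w)
    (hR : 1 ∈ R ∧ len ∈ R ∧ q ∈ R ∧ 20 ∉ R ∧ 21 ∉ R ∧ 22 ∉ R ∧ 23 ∉ R) (hA : a ∉ A)
    (hF : ∀ s', Keep R A s s' → Filled Q N 0 (s.arr a) (s'.arr a) →
      F (s'.arr a) ≤ val w G S T ⟨k, s'⟩) :
    avgFill Q N 0 (s.arr a) F ≤ val w G S (T + (N * 12 + 6)) ⟨fillRandom a len q :: k, s⟩ := by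
  have hne : ∀ x ∈ R, x ≠ 20 ∧ x ≠ 21 ∧ x ≠ 22 ∧ x ≠ 23 := fun x hx =>
    ⟨fun e => hR.2.2.2.1 (e ▸ hx), fun e => hR.2.2.2.2.1 (e ▸ hx),
      fun e => hR.2.2.2.2.2.1 (e ▸ hx), fun e => hR.2.2.2.2.2.2 (e ▸ hx)⟩
  have hite : ∀ p : Prop, ∀ [Decidable p], (if p then 1 else 0) < 2 ^ w := fun p _ => by
    split <;> omega
  obtain ⟨l20, l21, l22, l23⟩ := hne len hR.2.1
  obtain ⟨q20, q21, q22, q23⟩ := hne q hR.2.2.1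
  have loop : ∀ m i, i + m = N → ∀ s', Keep R A s s' → s'.reg 20 = i →
      (s'.reg 21 = if i < N then 1 else 0) →
      (∀ s'', Keep R A s s'' → Filled Q m i (s'.arr a) (s''.arr a) →
        F (s''.arr a) ≤ val w G S T ⟨k, s''⟩) →
      avgFill Q m i (s'.arr a) F ≤ val w G S (T + (m * 12 + 1)) ⟨.loop 21 (.rand 22 q ;;
        .arith .mul 23 20 q ;; .arith .add 23 23 22 ;; .store a 20 23 ;; .arith .add 20 20 1 ;;
        .arith .lt 21 20 len) :: k, s'⟩ := by
    intro m
    induction m with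
    | zero =>
      intro i hi s' hK h20 h21 hF'
      have hrun : Run w G (.loop 21 (.rand 22 q ;;
        .arith .mul 23 20 q ;; .arith .add 23 23 22 ;; .store a 20 23 ;; .arith .add 20 20 1 ;;
        .arith .lt 21 20 len)) s' 1 fun s'' => s'' = s' :=
        ⟨1, le_rfl, s', Exec.loop_done (by rw [h21, if_neg (by omega)]), rfl⟩
      rw [avgFill, zero_mul, zero_add]
      exact hrun.le_val hS fun s'' h => h ▸ hF' s' hK
        ⟨fun j h1 h2 => by omega, fun _ _ => rfl⟩
    | succ m ih =>
      intro i hi s' hK h20 h21 hF'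
      have hN : s'.reg len = N := by rw [hK.1 len hR.2.1, hlen]
      have hQ : s'.reg q = Q := by rw [hK.1 q hR.2.2.1, hq]
      have h1' : s'.reg 1 = 1 := by rw [hK.1 1 hR.1, h1]
      -- Of the twelve units per cell, three are for the loop test, the first `seq` and `rand`; the
      -- deterministic rest of the body takes at most nine.
      rw [show T + ((m + 1) * 12 + 1) = (T + (m * 12 + 1) + 9) + 1 + 1 + 1 by ring,
        val_loop S _ _ (by rw [h21, if_pos (by omega)]; simp), val_seq, val_rand, hQ, avgFill]
      refine div_le_div_of_nonneg_right (Finset.sum_le_sum fun v hv => ?_) (by positivity)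
      rw [Finset.mem_range] at hv
      have hiN : i * Q + Q ≤ N * Q := by
        calc i * Q + Q = (i + 1) * Q := by ring
          _ ≤ N * Q := Nat.mul_le_mul_right _ (by omega)
      rw [Mem.setReg_of_lt (by omega)]
      have hrun : Run w G (.arith .mul 23 20 q ;; .arith .add 23 23 22 ;; .store a 20 23 ;;
          .arith .add 20 20 1 ;; .arith .lt 21 20 len) (s'.put 22 v) 9 fun s'' =>
          Keep R A s s'' ∧ s''.reg 20 = i + 1 ∧ (s''.reg 21 = if i + 1 < N then 1 else 0) ∧
          s''.arr a = Function.update (s'.arr a) i (i * Q + v) := by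
        refine Run.straight ?_ (by simp [cost]) ?_
        · simp [Safe, straight, Op.eval, h20, q22, hQ, h1', hite]
          omega
        · refine ⟨?_, ?_, ?_, ?_⟩
          · simp only [straight]
            exact (((((hK.put _ hR.2.2.2.2.2.1).put _ hR.2.2.2.2.2.2).put _
              hR.2.2.2.2.2.2).putArr _ _ hA).put _ hR.2.2.2.1).put _ hR.2.2.2.2.1
          · simp [straight, Op.eval, h20, h1']
          · simp [straight, Op.eval, h20, h1', l20, l22, l23, hN]
          · simp [straight, Op.eval, h20, q22, hQ]
      refine hrun.le_val hS ?_
      rintro s'' ⟨hK', h20', h21', ha⟩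
      rw [← ha]
      refine ih (i + 1) (by omega) s'' hK' h20' h21' fun s3 hK3 hf => hF' s3 hK3 ?_
      rw [ha] at hf
      exact (hf.cons hv).1
  have hfirst : Run w G (.const 20 0 ;; .arith .lt 21 20 len) s 3 fun s' =>
      Keep R A s s' ∧ s'.reg 20 = 0 ∧ (s'.reg 21 = if 0 < N then 1 else 0) ∧
      s'.arr a = s.arr a := by
    refine Run.straight ?_ (by simp [cost]) ?_
    · simp [Safe, straight, Op.eval, hite]
    · refine ⟨?_, ?_, ?_, ?_⟩
      · simp only [straight]
        exact ((Keep.refl _ _ _).put _ hR.2.2.2.1).put _ hR.2.2.2.2.1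
      · simp [straight]
      · simp [straight, Op.eval, l20, hlen]
      · simp [straight]
  rw [fillRandom, show T + (N * 12 + 6) = (T + (N * 12 + 1) + 1 + 3) + 1 by ring, val_seq]
  refine hfirst.le_val hS ?_
  rintro s' ⟨hK, h20, h21, ha⟩
  rw [← ha]
  refine (loop N 0 (by omega) s' hK h20 h21 (by rw [ha]; exact hF)).trans (val_mono hS (by omega) _)

end Random

section Programs

variable {w n : ℕ} {G : SimpleGraph (Fin n)}

theorem natDegree_eq_sum (i : ℕ) : natDegree G i = ∑ j ∈ Finset.range n, adjBit G i j := by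
  classical
  have h : {j : ℕ | NatAdj G i j} = ((Finset.range n).filter fun j => NatAdj G i j : Finset ℕ) := by
    ext j
    simp only [Set.mem_ofPred_eq, Finset.coe_filter, Finset.mem_range]
    exact ⟨fun h => ⟨h.2.1, h⟩, fun h => h.2⟩
  rw [natDegree, h, Set.ncard_coe_finset, Finset.card_filter]
  refine Finset.sum_congr rfl fun j _ => ?_
  unfold adjBit
  congr

theorem adjBit_self (i : ℕ) : adjBit G i i = 0 := by
  rw [adjBit, if_neg]
  rintro ⟨h, _, h'⟩
  exact G.loopless.irrefl _ h'

theorem natDegree_le (i : ℕ) : natDegree G i ≤ n := by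
  rw [natDegree_eq_sum]
  calc ∑ j ∈ Finset.range n, adjBit G i j ≤ ∑ j ∈ Finset.range n, 1 :=
        Finset.sum_le_sum fun j _ => adjBit_le _ _
    _ = n := by simp

theorem natDegree_le_pred {i : ℕ} (hi : i < n) : natDegree G i ≤ n - 1 := by
  rw [natDegree_eq_sum, ← Finset.sum_erase _ (adjBit_self (G := G) i)]
  calc ∑ j ∈ (Finset.range n).erase i, adjBit G i j ≤ ∑ j ∈ (Finset.range n).erase i, 1 :=
        Finset.sum_le_sum fun j _ => adjBit_le _ _
    _ = n - 1 := by simp [hi]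

/-- The sum of all degrees. -/
noncomputable def degreeSum {n : ℕ} (G : SimpleGraph (Fin n)) : ℕ :=
  ∑ v ∈ Finset.range n, natDegree G v

theorem degreeSum_le : degreeSum G ≤ (n - 1) * n := by
  calc degreeSum G ≤ ∑ v ∈ Finset.range n, (n - 1) :=
        Finset.sum_le_sum fun v hv => natDegree_le_pred (Finset.mem_range.1 hv)
    _ = (n - 1) * n := by simp [mul_comm]

/-! ## The deterministic program -/

/-- Compute numerator and denominator of the density, in registers `2` and `3`. -/
def readDensity : Prog :=
  (.const 2 0 ;; forLoop 20 21 0 (.deg 23 20 ;; .arith .add 2 2 23)) ;;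
  .arith .sub 3 0 1 ;; .arith .mul 3 3 0

/-- Find a vertex of maximal degree in the block with number `31`, in register `34`. -/
def maxInBlock : Prog :=
  (.arith .mul 33 31 10 ;; copyReg 34 33) ;; forLoop 20 21 10
    (.deg 22 33 ;; .deg 23 34 ;; .arith .lt 24 23 22 ;; .ite 24 (copyReg 34 33) .skip ;;
      .arith .add 33 33 1)

/-- List vertices of maximal degree in the blocks in array `3`, and all vertices in array `4`. -/
def selectVertices : Prog :=
  forLoop 31 32 7 (maxInBlock ;; .store 3 31 34) ;; copyReg 9 0 ;;
    forLoop 20 21 9 (.store 4 20 20)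

/-- The deterministic program. -/
def detProg : Prog :=
  .const 1 1 ;; readDensity ;; computeParams ;; selectVertices ;; finalize

/-- The degree sum is twice the number of edges, so the quotient of the two registers is exactly the
density. -/
theorem run_readDensity {s : Mem} (hw : (n + 2) ^ 10 ≤ 2 ^ w) (h0 : s.reg 0 = n)
    (h1 : s.reg 1 = 1) :
    Run w G readDensity s (n * 8 + 11) fun s' => Keep [0, 1] [2, 3, 4, 5, 6, 7] s s' ∧
      s'.reg 2 = degreeSum G ∧ s'.reg 3 = (n - 1) * n := by
  have hw2 := pow_lt_word (m := 2) hw (by norm_num)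
  have hw1 := pow_lt_word (m := 1) hw (by norm_num)
  rw [pow_one] at hw1
  have hw0 : w ≠ 0 := by rintro rfl; omega
  let I : ℕ → Mem → Prop := fun j s' => Keep [0, 1] [2, 3, 4, 5, 6, 7] s s' ∧
    s'.reg 2 = ∑ v ∈ Finset.range j, natDegree G v
  refine (((run_const (by omega)).seq (R := I n) (B' := n * 8 + 5) ?_).seq (B' := 3)
    ?_).mono (by omega) fun s' h => h
  · rintro s1 rfl
    refine (Run.forLoop (B := 3) (N := n) I (by decide) (by decide) (by decide) (by decide)
      (by decide) (by omega) (by omega) ?_ ?_ ?_ ?_ ?_).mono (by omega) fun s' h => h.1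
    · rintro j s' x v hx ⟨hK, h2⟩
      have hx' : x ∉ [0, 1] ∧ x ≠ 2 := by rcases hx with rfl | rfl <;> decide
      exact ⟨hK.put _ hx'.1, by simp [hx'.2.symm, h2]⟩
    · rintro j hj s' ⟨hK, h2⟩ h20 - -
      have hd := natDegree_le (G := G) j
      have hsum : ∑ v ∈ Finset.range j, natDegree G v + natDegree G j ≤ n ^ 2 := by
        rw [← Finset.sum_range_succ]
        calc ∑ v ∈ Finset.range (j + 1), natDegree G v ≤ ∑ v ∈ Finset.range (j + 1), n :=
              Finset.sum_le_sum fun v _ => natDegree_le v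
          _ = (j + 1) * n := by simp
          _ ≤ n * n := Nat.mul_le_mul_right _ hj
          _ = n ^ 2 := by ring
      have hkeep : ∀ s'', Keep [0, 1] [2, 3, 4, 5, 6, 7] s' s'' →
          Keep [0, 1] [2, 3, 4, 5, 6, 7] s s'' := fun s'' h => hK.trans h
      refine Run.straight ?_ (by decide) ?_
      · simp [Safe, straight, Op.eval, h20, h2]
        omega
      · refine ⟨⟨hkeep _ ?_, ?_⟩, ?_, ?_, ?_⟩
        · simp [straight, Keep]
        · simp [straight, Op.eval, h20, h2, Finset.sum_range_succ]
        · simp [straight, h20]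
        · simp [straight, hK.reg 0, h0]
        · simp [straight, hK.reg 1, h1]
    · simp [h0]
    · simp [h1]
    · exact ⟨(Keep.refl _ _ _).put _ (by decide), by simp⟩
  · rintro s1 ⟨hK, h2⟩
    have hmul : (n - 1) * n ≤ n ^ 2 := by
      rw [pow_two]; exact Nat.mul_le_mul_right _ (Nat.sub_le _ _)
    have hkeep : ∀ s'', Keep [0, 1] [2, 3, 4, 5, 6, 7] s1 s'' →
      Keep [0, 1] [2, 3, 4, 5, 6, 7] s s'' := fun s'' h => hK.trans h
    refine Run.straight ?_ (by decide) ?_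
    · simp [Safe, straight, Op.eval, hK.reg 0, h0, hK.reg 1, h1]
      omega
    · refine ⟨hkeep _ ?_, ?_, ?_⟩
      · simp [straight, Keep]
      · simp [straight, h2, degreeSum]
      · simp [straight, Op.eval, hK.reg 0, h0, hK.reg 1, h1]

/-- The bound `max q 1` covers an empty block, for which the starting candidate `i * q` is kept. -/
theorem run_maxInBlock {s : Mem} {i q : ℕ} (hw : n + 1 < 2 ^ w) (h1 : s.reg 1 = 1)
    (h31 : s.reg 31 = i) (h10 : s.reg 10 = q) (hiq : i * q + q + 1 < 2 ^ w) :
    Run w G maxInBlock s (q * 16 + 10) fun s' =>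
      Keep [0, 1, 7, 8, 10, 31] [3, 4, 5, 6, 7] s s' ∧
      i * q ≤ s'.reg 34 ∧ s'.reg 34 < i * q + max q 1 ∧
      ∀ v, i * q ≤ v → v < i * q + q → natDegree G v ≤ natDegree G (s'.reg 34) := by
  have hw0 : w ≠ 0 := by rintro rfl; omega
  have hite : ∀ p : Prop, ∀ [Decidable p], (if p then 1 else 0) < 2 ^ w := fun p _ => by
    split <;> omega
  let I : ℕ → Mem → Prop := fun j s' => Keep [0, 1, 7, 8, 10, 31] [3, 4, 5, 6, 7] s s' ∧
    s'.reg 33 = i * q + j ∧ i * q ≤ s'.reg 34 ∧ s'.reg 34 < i * q + max j 1 ∧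
    ∀ v, i * q ≤ v → v < i * q + j → natDegree G v ≤ natDegree G (s'.reg 34)
  have hfirst : Run w G (.arith .mul 33 31 10 ;; copyReg 34 33) s 3 (I 0) := by
    refine Run.straight ?_ (by decide) ?_
    · simp [copyReg, Safe, straight, Op.eval, h31, h10, h1]
      omega
    · refine ⟨?_, ?_, ?_, ?_, ?_⟩
      · simp [copyReg, straight, Keep]
      · simp [copyReg, straight, Op.eval, h31, h10]
      · simp [copyReg, straight, Op.eval, h31, h10, h1]
      · simp [copyReg, straight, Op.eval, h31, h10, h1]
      · intro v h h'; omega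
  refine (hfirst.seq (B' := q * 16 + 5) ?_).mono (by omega) fun s' h => h
  intro s1 hs1
  refine (Run.forLoop (B := 11) (N := q) I (by decide) (by decide) (by decide) (by decide)
    (by decide) (by omega) (by omega) ?_ ?_ ?_ ?_ hs1).mono (by omega)
    fun s' h => ⟨h.1.1, h.1.2.2⟩
  · rintro j s' x v hx ⟨hK, h33, h34⟩
    have hx' : x ∉ [0, 1, 7, 8, 10, 31] ∧ x ≠ 33 ∧ x ≠ 34 := by rcases hx with rfl | rfl <;> decide
    exact ⟨hK.put _ hx'.1, by simp [hx'.2.1.symm, h33], by simpa [hx'.2.2.symm] using h34⟩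
  · rintro j hj s' ⟨hK, h33, h34, h34', hmax⟩ h20 h10' h1'
    have hd := natDegree_le (G := G) (i * q + j)
    have hd' := natDegree_le (G := G) (s'.reg 34)
    have hkeep : ∀ s'', Keep [0, 1, 7, 8, 10, 31] [3, 4, 5, 6, 7] s' s'' →
      Keep [0, 1, 7, 8, 10, 31] [3, 4, 5, 6, 7] s s'' := fun s'' h => hK.trans h
    by_cases hlt : natDegree G (s'.reg 34) < natDegree G (i * q + j)
    · refine Run.straight ?_ (by decide) ?_
      · simp [copyReg, Safe, straight, Op.eval, h33, h1', hlt]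
        omega
      · refine ⟨⟨hkeep _ ?_, ?_, ?_, ?_, ?_⟩, ?_, ?_, ?_⟩
        · simp [copyReg, straight, Op.eval, h33, hlt, Keep]
        · simp [copyReg, straight, Op.eval, h33, h1', hlt, add_assoc]
        · simp [copyReg, straight, Op.eval, h33, h1', hlt]
        · simp [copyReg, straight, Op.eval, h33, h1', hlt]
        · intro v hv hv'
          simp only [copyReg, straight, Op.eval, h33, h1', hlt, Mem.put_reg, Nat.reduceEqDiff,
            if_true, if_false]
          simp only [mul_one]
          rcases Nat.lt_or_eq_of_le (show v ≤ i * q + j by omega) with h | rfl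
          · exact (hmax v hv h).trans hlt.le
          · simp
        · simp [copyReg, straight, Op.eval, h33, hlt, h20]
        · simp [copyReg, straight, Op.eval, h33, hlt, h10']
        · simp [copyReg, straight, Op.eval, h33, hlt, h1']
    · refine Run.straight ?_ (by decide) ?_
      · simp [copyReg, Safe, straight, Op.eval, h33, h1', hlt]
        omega
      · refine ⟨⟨hkeep _ ?_, ?_, ?_, ?_, ?_⟩, ?_, ?_, ?_⟩
        · simp [straight, Op.eval, h33, hlt, Keep]
        · simp [straight, Op.eval, h33, h1', hlt, add_assoc]
        · simpa [straight, Op.eval, h33, h1', hlt] using h34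
        · simp [straight, Op.eval, h33, h1', hlt]
          omega
        · intro v hv hv'
          have : natDegree G v ≤ natDegree G (s'.reg 34) := by
            rcases Nat.lt_or_eq_of_le (show v ≤ i * q + j by omega) with h | rfl
            · exact hmax v hv h
            · omega
          simpa [straight, Op.eval, h33, h1', hlt] using this
        · simp [straight, Op.eval, h33, hlt, h20]
        · simp [straight, Op.eval, h33, hlt, h10']
        · simp [straight, Op.eval, h33, hlt, h1']
  · rw [hs1.1.reg 10, h10]
  · rw [hs1.1.reg 1, h1]

theorem run_selectVertices {s : Mem} {r q : ℕ} (hw : (n + 2) ^ 10 ≤ 2 ^ w) (h0 : s.reg 0 = n)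
    (h1 : s.reg 1 = 1) (h7 : s.reg 7 = r) (h10 : s.reg 10 = q) (hr : r ≤ n)
    (hrq : r * q ≤ n) :
    Run w G selectVertices s (n * 50 + 50) fun s' => Keep [1, 7, 8] [5, 6, 7] s s' ∧
      s'.reg 9 = n ∧ (∀ i < r, i * q ≤ s'.arr 3 i ∧ s'.arr 3 i < i * q + max q 1 ∧
        ∀ v, i * q ≤ v → v < i * q + q → natDegree G v ≤ natDegree G (s'.arr 3 i)) ∧
      ∀ j, s'.arr 4 j = if j < n then j else s.arr 4 j := by
  have hw2 := pow_lt_word (m := 2) hw (by norm_num)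
  have hw1 := pow_lt_word (m := 1) hw (by norm_num)
  rw [pow_one] at hw1
  have hw0 : w ≠ 0 := by rintro rfl; omega
  let I : ℕ → Mem → Prop := fun i s' => Keep [0, 1, 7, 8, 10] [4, 5, 6, 7] s s' ∧
    ∀ i' < i, i' * q ≤ s'.arr 3 i' ∧ s'.arr 3 i' < i' * q + max q 1 ∧
      ∀ v, i' * q ≤ v → v < i' * q + q → natDegree G v ≤ natDegree G (s'.arr 3 i')
  have hloop : Run w G (forLoop 31 32 7 (maxInBlock ;; .store 3 31 34)) s
      (r * (q * 16 + 12 + 5) + 5) (I r) := by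
    refine (Run.forLoop (N := r) I (by decide) (by decide) (by decide) (by decide)
      (by decide) (by omega) (by omega) ?_ ?_ h7 h1 ?_).mono le_rfl fun s' h => h.1
    · rintro j s' x v hx ⟨hK, h⟩
      exact ⟨hK.put _ (by rcases hx with rfl | rfl <;> decide), h⟩
    · rintro i hi s' ⟨hK, h⟩ h31 h7' h1'
      have hiq : i * q + q ≤ r * q := by
        calc i * q + q = (i + 1) * q := by ring
          _ ≤ r * q := Nat.mul_le_mul_right _ hi
      refine ((run_maxInBlock (n := n) (i := i) (q := q) (by omega) h1' h31
        (by rw [hK.reg 10, h10]) (by omega)).seq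
        (B' := 1) ?_).mono le_rfl fun s' h => h
      rintro s2 ⟨hK2, h34, h34', hmax⟩
      have e31 : s2.reg 31 = i := by rw [hK2.reg 31, h31]
      have e3 : s2.arr 3 = s'.arr 3 := hK2.arr 3
      have hK3 : Keep [0, 1, 7, 8, 10] [4, 5, 6, 7] s s2 := hK.trans hK2
      refine Run.straight ?_ (by decide) ?_
      · simp only [Safe]
        have : max q 1 ≤ q + 1 := by omega
        omega
      · refine ⟨⟨hK3.putArr _ _ (by decide), ?_⟩, ?_, ?_, ?_⟩
        · intro i' hi'
          simp only [straight, Mem.putArr_arr_same, e31, e3]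
          rcases Nat.lt_succ_iff_lt_or_eq.1 hi' with hi' | rfl
          · rw [Function.update_of_ne (by omega)]
            exact h i' hi'
          · rw [Function.update_self]
            exact ⟨h34, h34', hmax⟩
        · simp [straight, e31]
        · simp [straight, hK3.reg 7, h7]
        · simp [straight, hK3.reg 1, h1]
    · exact ⟨Keep.refl _ _ _, fun i hi => by omega⟩
  have hcost : r * (q * 16 + 12 + 5) + 5 ≤ n * 33 + 5 := by nlinarith
  refine (hloop.seq (B' := n * 6 + 10) ?_).mono (by omega) fun s' h => h
  rintro s1 ⟨hK1, hA⟩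
  refine ((run_copyReg (by rw [hK1.reg 1, h1]) (by rw [hK1.reg 0, h0]; omega)).seq
    (B' := n * 6 + 5) ?_).mono (by omega) fun s' h => h
  rintro s2 rfl
  let J : ℕ → Mem → Prop := fun j s' => Keep [1, 7, 8] [5, 6, 7] s s' ∧
    s'.arr 3 = s1.arr 3 ∧ ∀ j', s'.arr 4 j' = if j' < j then j' else s.arr 4 j'
  refine (Run.forLoop (B := 1) (N := n) J (by decide) (by decide) (by decide) (by decide)
    (by decide) (by omega) (by omega) ?_ ?_ ?_ ?_ ?_).mono (by omega)
    fun s' h => ⟨h.1.1, h.2.1, ?_, h.1.2.2⟩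
  · rintro j s' x v hx ⟨hK, h⟩
    exact ⟨hK.put _ (by rcases hx with rfl | rfl <;> decide), h⟩
  · rintro j hj s' ⟨hK, h3, h4⟩ h20 h9 h1'
    refine Run.straight (by simp only [Safe]; omega) (by decide) ?_
    refine ⟨⟨hK.putArr _ _ (by decide), by simp [straight, h3], ?_⟩, ?_, ?_, ?_⟩
    · intro j'
      simp only [straight, Mem.putArr_arr_same, h20, Function.update_apply, h4]
      split_ifs <;> omega
    · simp [straight, h20]
    · simp [straight, h9]
    · simp [straight, h1']
  · simp [hK1.reg 0, h0]
  · simp [hK1.reg 1, h1]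
  · refine ⟨(hK1.trans (Keep.refl [1, 7, 8] [5, 6, 7] s1) : Keep [1, 7, 8] [5, 6, 7] s s1).put _
      (by decide), rfl, fun j' => ?_⟩
    simp [hK1.arr 4]
  · rw [h.1.2.1]
    exact hA

theorem init_eq (hn : n < 2 ^ w) : Mem.init w n = Mem.put ⟨fun _ => 0, fun _ _ => 0⟩ 0 n :=
  Mem.setReg_of_lt hn

theorem run_detProg (hw : (n + 2) ^ 10 ≤ 2 ^ w) (hn : 1 ≤ n) {a b r t q : ℕ}
    (ha : degreeSum G = a) (hb : (n - 1) * n = b) (hr : leftSize n a b = r)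
    (ht : bicliqueSize n a b = t) (hq : n / r = q) :
    Run w G detProg (Mem.init w n) (1000 * ((n + 1) * (r + 1))) fun s' => s'.reg 0 = t ∧
      ∃ A B : ℕ → ℕ, (∀ i < r, i * q ≤ A i ∧ A i < i * q + max q 1 ∧
        ∀ v, i * q ≤ v → v < i * q + q → natDegree G v ≤ natDegree G (A i)) ∧
      (∀ j < n, B j = j) ∧ (Forced G A B r n t → OutputsBiclique G ⟨[], s'⟩) := by
  have hw3 := pow_lt_word (m := 3) hw (by norm_num)
  have hw2 := pow_lt_word (m := 2) hw (by norm_num)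
  have hw1 := pow_lt_word (m := 1) hw (by norm_num)
  rw [pow_one] at hw1
  have hw0 : w ≠ 0 := by rintro rfl; omega
  have hab : a ≤ b := by rw [← ha, ← hb]; exact degreeSum_le
  have hbn : b ≤ n * n := by rw [← hb]; exact Nat.mul_le_mul_right _ (Nat.sub_le _ _)
  have hrn : r ≤ n := hr ▸ leftSize_le hab
  have hrq : r * q ≤ n := by rw [← hq]; exact Nat.mul_div_le n r
  have hqn : q ≤ n := hq ▸ Nat.div_le_self _ _
  have hword : 2 * ((n + 1) * (r + 1)) + 2 ≤ 2 ^ w := by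
    have h1 : (n + 1) * (r + 1) ≤ (n + 2) ^ 2 := by nlinarith
    have h2 : (n + 2) ^ 2 * 3 ≤ (n + 2) ^ 2 * (n + 2) ^ 8 := by
      refine Nat.mul_le_mul_left _ ?_
      have : 3 ^ 8 ≤ (n + 2) ^ 8 := Nat.pow_le_pow_left (by omega) _
      omega
    have h3 : (n + 2) ^ 2 * (n + 2) ^ 8 = (n + 2) ^ 10 := by ring
    have h4 : 2 ^ 2 ≤ (n + 2) ^ 2 := Nat.pow_le_pow_left (by omega) _
    omega
  rw [init_eq (by omega)]
  have hBt : n * 90 + 400 + 100 * ((n + 1) * (r + 1)) ≤ 1000 * ((n + 1) * (r + 1)) := by nlinarith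
  refine ((run_const (by omega)).seq (B' := n * 90 + 300 + 100 * ((n + 1) * (r + 1)))
    ?_).mono (by omega) fun s' h => h
  rintro s1 rfl
  refine ((run_readDensity hw (by simp) (by simp)).seq
    (B' := n * 82 + 250 + 100 * ((n + 1) * (r + 1))) ?_).mono (by omega) fun s' h => h
  rintro s2 ⟨hK2, h2, h3⟩
  refine ((run_computeParams hw (by rw [hK2.reg 0]; simp) (by rw [hK2.reg 1]; simp)
    (h2.trans ha) (h3.trans hb) hn hab hbn).seq
    (B' := n * 50 + 100 + 100 * ((n + 1) * (r + 1))) ?_).mono (by omega) fun s' h => h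
  rintro s3 ⟨hK3, h7, h8, h10, htw⟩
  rw [hr] at h7 h10
  rw [hq] at h10
  rw [ht] at h8 htw
  have hK : Keep [0, 1] [3, 4, 5, 6, 7] _ s3 := hK2.trans hK3
  have z : ∀ c ∈ [3, 4, 5, 6, 7], ∀ x, s3.arr c x = 0 := by
    intro c hc x
    rw [hK.arr c hc]
    simp
  refine ((run_selectVertices hw (by rw [hK.reg 0]; simp) (by rw [hK.reg 1]; simp) h7 h10 hrn hrq).seq (B' := 100 * ((n + 1) * (r + 1))) ?_).mono (by omega) fun s' h => h
  rintro s4 ⟨hK4, h9, hA, hB⟩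
  refine (run_finalize (A := s4.arr 3) (B := s4.arr 4) (r := r) (N := n) (t := t)
    (by rw [hK4.reg 1, hK.reg 1]; simp) (by rw [hK4.reg 7, h7]) (by rw [hK4.reg 8, h8]) h9 rfl rfl
    ?_ ?_ htw hword ?_ ?_ ?_).mono le_rfl fun s' h => ⟨h.1, s4.arr 3, s4.arr 4, hA, ?_, h.2⟩
  · intro i hi
    have h1 := (hA i hi).2.1
    have h2 : max q 1 ≤ q + 1 := by omega
    have hiq : i * q + q ≤ r * q := by
      calc i * q + q = (i + 1) * q := by ring
        _ ≤ r * q := Nat.mul_le_mul_right _ hi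
    omega
  · intro j
    rw [hB, z 4 (by decide)]
    split <;> omega
  · intro x; rw [hK4.arr 5, z 5 (by decide)]
  · intro x; rw [hK4.arr 6, z 6 (by decide)]
  · intro x; rw [hK4.arr 7, z 7 (by decide)]
  · intro j hj
    rw [hB, if_pos hj]

end Programs

section RandomProgram

/-! ## The randomized program -/

/-- Estimate the density from the samples in array `2`, as the quotient of
registers `2` and `3`. -/
def estimateDensity : Prog :=
  (.const 2 0 ;; forLoop 20 21 0 (.load 22 2 20 ;; .arith .mod 22 22 0 ;; .adj 23 20 22 ;;
    .arith .add 2 2 23)) ;; copyReg 3 0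

/-- The randomized program. -/
def randProg : Prog :=
  .const 1 1 ;; fillRandom 2 0 0 ;; estimateDensity ;; computeParams ;; fillRandom 3 7 10 ;;
    copyReg 9 10 ;; fillRandom 4 10 7 ;; finalize

variable {w n : ℕ} {G : SimpleGraph (Fin n)}

/-- The number of edges among the sampled pairs. -/
noncomputable def edgeCount {n : ℕ} (G : SimpleGraph (Fin n)) (Z : ℕ → ℕ) : ℕ :=
  ∑ i ∈ Finset.range n, adjBit G i (Z i % n)

theorem edgeCount_le (Z : ℕ → ℕ) : edgeCount G Z ≤ n := by
  calc edgeCount G Z ≤ ∑ i ∈ Finset.range n, 1 := Finset.sum_le_sum fun j _ => adjBit_le _ _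
    _ = n := by simp

/-- One pair is sampled for each vertex `i`. The sample in cell `i` comes from the block `{i * n, …,
i * n + n - 1}`, and reduction modulo `n` makes it a uniform vertex. -/
theorem run_estimateDensity {s : Mem} (hw : (n + 2) ^ 10 ≤ 2 ^ w) (h0 : s.reg 0 = n)
    (h1 : s.reg 1 = 1) (hZ : ∀ i < n, s.arr 2 i < 2 ^ w) :
    Run w G estimateDensity s (n * 12 + 11) fun s' => Keep [0, 1] [3, 4, 5, 6, 7] s s' ∧
      s'.reg 2 = edgeCount G (s.arr 2) ∧ s'.reg 3 = n := by
  have hw1 := pow_lt_word (m := 1) hw (by norm_num)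
  rw [pow_one] at hw1
  have hw0 : w ≠ 0 := by rintro rfl; omega
  let I : ℕ → Mem → Prop := fun j s' => Keep [0, 1] [2, 3, 4, 5, 6, 7] s s' ∧
    s'.reg 2 = ∑ i ∈ Finset.range j, adjBit G i (s.arr 2 i % n)
  refine (((run_const (by omega)).seq (R := I n) (B' := n * 12 + 5) ?_).seq (B' := 1)
    ?_).mono (by omega) fun s' h => h
  · rintro s1 rfl
    refine (Run.forLoop (B := 7) (N := n) I (by decide) (by decide) (by decide) (by decide)
      (by decide) (by omega) (by omega) ?_ ?_ ?_ ?_ ?_).mono (by omega) fun s' h => h.1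
    · rintro j s' x v hx ⟨hK, h2⟩
      have hx' : x ∉ [0, 1] ∧ x ≠ 2 := by rcases hx with rfl | rfl <;> decide
      exact ⟨hK.put _ hx'.1, by simp [hx'.2.symm, h2]⟩
    · rintro j hj s' ⟨hK, h2⟩ h20 h0' h1'
      have e2 : s'.arr 2 = s.arr 2 := hK.arr 2
      have hZj := hZ j hj
      have hmod : s.arr 2 j % n < n := Nat.mod_lt _ (by omega)
      have hsum : ∑ i ∈ Finset.range j, adjBit G i (s.arr 2 i % n) +
          adjBit G j (s.arr 2 j % n) ≤ n := by
        rw [← Finset.sum_range_succ]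
        calc ∑ i ∈ Finset.range (j + 1), adjBit G i (s.arr 2 i % n)
            ≤ ∑ i ∈ Finset.range (j + 1), 1 := Finset.sum_le_sum fun v _ => adjBit_le _ _
          _ = j + 1 := by simp
          _ ≤ n := hj
      have hkeep : ∀ s'', Keep [0, 1] [2, 3, 4, 5, 6, 7] s' s'' →
          Keep [0, 1] [2, 3, 4, 5, 6, 7] s s'' := fun s'' h => hK.trans h
      refine Run.straight ?_ (by decide) ?_
      · simp [Safe, straight, Op.eval, h20, h2, e2, h0']
        omega
      · refine ⟨⟨hkeep _ ?_, ?_⟩, ?_, ?_, ?_⟩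
        · simp [straight, Keep]
        · simp [straight, Op.eval, h20, h2, e2, h0', Finset.sum_range_succ]
        · simp [straight, h20]
        · simp [straight, h0']
        · simp [straight, h1']
    · simp [h0]
    · simp [h1]
    · exact ⟨(Keep.refl _ _ _).put _ (by decide), by simp⟩
  · rintro s1 ⟨hK, h2⟩
    refine (run_copyReg (by rw [hK.reg 1, h1]) (by rw [hK.reg 0, h0]; omega)).mono le_rfl ?_
    rintro s' rfl
    refine ⟨(hK.trans (Keep.refl [0, 1] [3, 4, 5, 6, 7] s1) :
      Keep [0, 1] [3, 4, 5, 6, 7] s s1).put _ (by decide), ?_, ?_⟩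
    · simpa [edgeCount] using h2
    · simp [hK.reg 0, h0]

/-- The whole run becomes an iterated average over the samples `Z` and the candidates `A` and `B`.
The time is linear in `n` because `r Z * q Z ≤ n`, whatever the estimate turns out to be. -/
theorem le_val_randProg {S : Set Config} (hS : ∀ c ∈ S, c.Halted) (hw : (n + 2) ^ 10 ≤ 2 ^ w)
    (hn : 1 ≤ n) {r t q : (ℕ → ℕ) → ℕ} (hr : ∀ Z, leftSize n (edgeCount G Z) n = r Z)
    (ht : ∀ Z, bicliqueSize n (edgeCount G Z) n = t Z) (hq : ∀ Z, n / r Z = q Z)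
    {F : (ℕ → ℕ) → (ℕ → ℕ) → (ℕ → ℕ) → ℝ}
    (hF : ∀ Z A B s', s'.reg 0 = t Z →
      (Forced G A B (r Z) (q Z) (t Z) → OutputsBiclique G ⟨[], s'⟩) →
      F Z A B ≤ val w G S 0 ⟨[], s'⟩) :
    avgFill n n 0 (fun _ => 0) (fun Z => avgFill (q Z) (r Z) 0 (fun _ => 0) fun A =>
      avgFill (r Z) (q Z) 0 (fun _ => 0) fun B => F Z A B) ≤
      val w G S (1000 * (n + 1)) ⟨[randProg], Mem.init w n⟩ := by
  have hw2 := pow_lt_word (m := 2) hw (by norm_num)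
  have hw3 := pow_lt_word (m := 3) hw (by norm_num)
  have hw1 := pow_lt_word (m := 1) hw (by norm_num)
  rw [pow_one] at hw1
  have hw0 : w ≠ 0 := by rintro rfl; omega
  have hbig : 8 * n + 8 ≤ 2 ^ w := by
    refine le_trans ?_ hw
    have h1 : 8 ≤ (n + 2) ^ 9 := by
      have : 2 ^ 9 ≤ (n + 2) ^ 9 := Nat.pow_le_pow_left (by omega) _
      omega
    calc 8 * n + 8 ≤ 8 * (n + 2) := by omega
      _ ≤ (n + 2) ^ 9 * (n + 2) := Nat.mul_le_mul_right _ h1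
      _ = (n + 2) ^ 10 := by ring
  have hsq : n * n + n + n + 2 ≤ 2 ^ w := by
    refine le_trans ?_ hw
    have h1 : 1 ≤ (n + 2) ^ 8 := Nat.one_le_pow _ _ (by omega)
    calc n * n + n + n + 2 ≤ 1 * (n + 2) ^ 2 := by nlinarith
      _ ≤ (n + 2) ^ 8 * (n + 2) ^ 2 := Nat.mul_le_mul_right _ h1
      _ = (n + 2) ^ 10 := by ring
  have hmono : ∀ c T T', T ≤ T' → val w G S T c ≤ val w G S T' c := fun c T T' h =>
    val_mono hS h c
  rw [init_eq (by omega)]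
  -- Time budgets, backwards from the end: `B7` is for `finalize`, since `(q + 1) * (r + 1) ≤ 3 * n
  -- + 1`, and each further one adds the preceding stage.
  let B7 := 100 * (3 * n + 1)
  let B6 := B7 + (n * 12 + 6) + 1
  let B5 := B6 + 1 + 1
  let B4 := B5 + (n * 12 + 6) + 1
  let B3 := B4 + (n * 32 + 100) + 1
  let B2 := B3 + (n * 12 + 11) + 1
  let B1 := B2 + (n * 12 + 6) + 1
  refine le_trans ?_ (hmono _ (B1 + 1 + 1) _ (by simp only [B1, B2, B3, B4, B5, B6, B7]; omega))
  rw [randProg, val_seq]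
  refine (run_const (by omega)).le_val hS ?_
  rintro s1 rfl
  rw [val_seq]
  refine le_val_fillRandom hS (s := (Mem.put ⟨fun _ => 0, fun _ _ => 0⟩ 0 n).put 1 1)
    (a := 2) (len := 0) (q := 0) (T := B2) (N := n) (Q := n) (R := [0, 1]) (A := [3, 4, 5, 6, 7]) (by simp)
    (by simp) (by simp) (by omega) (by decide) (by decide) ?_
  intro s2 hK2 hf2
  have hZ : ∀ i < n, s2.arr 2 i < 2 ^ w := by
    intro i hi
    have h1 := (hf2.1 i (by omega) (by omega)).2
    have h2 : max n 1 = n := by omega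
    have : i * n + n ≤ n * n := by
      calc i * n + n = (i + 1) * n := by ring
        _ ≤ n * n := Nat.mul_le_mul_right _ hi
    omega
  generalize hZdef : s2.arr 2 = Z at hZ
  have hab := edgeCount_le (G := G) Z
  have hrn : r Z ≤ n := hr Z ▸ leftSize_le hab
  have hrq : r Z * q Z ≤ n := by rw [← hq]; exact Nat.mul_div_le n _
  have hqr : q Z * r Z ≤ n := by rw [mul_comm]; exact hrq
  have hqn : q Z ≤ n := hq Z ▸ Nat.div_le_self _ _
  rw [show B2 = B3 + (n * 12 + 11) + 1 from rfl, val_seq]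
  refine (run_estimateDensity hw (by rw [hK2.reg 0]; simp) (by rw [hK2.reg 1]; simp)
    (hZdef ▸ hZ)).le_val hS ?_
  rintro s3 ⟨hK3, h2, h3⟩
  rw [hZdef] at h2
  have hK23 : Keep [0, 1] [3, 4, 5, 6, 7] _ s3 := hK2.trans hK3
  rw [show B3 = B4 + (n * 32 + 100) + 1 from rfl, val_seq]
  refine (run_computeParams hw (by rw [hK23.reg 0]; simp) (by rw [hK23.reg 1]; simp) h2 h3 hn hab
    (Nat.le_mul_of_pos_left n hn)).le_val hS ?_
  rintro s4 ⟨hK4, h7, h8, h10, htw⟩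
  rw [hr] at h7 h10
  rw [hq] at h10
  rw [ht] at h8 htw
  have hK : Keep [0, 1] [3, 4, 5, 6, 7] _ s4 := hK23.trans hK4
  rw [show B4 = B5 + (n * 12 + 6) + 1 from rfl, val_seq,
    show (fun _ : ℕ => 0) = s4.arr 3 from (hK.arr 3).symm]
  refine le_trans ?_ (hmono _ (B5 + (r Z * 12 + 6)) _ (by omega))
  refine le_val_fillRandom hS (R := [0, 1, 7, 8, 10]) (A := [4, 5, 6, 7]) (by rw [hK.reg 1]; simp)
    h7 h10 (by omega) (by decide) (by decide) ?_
  intro s5 hK5 hf5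
  have h1s5 : s5.reg 1 = 1 := by rw [hK5.reg 1, hK.reg 1]; simp
  rw [show B5 = B6 + 1 + 1 from rfl, val_seq]
  refine (run_copyReg h1s5 (by rw [hK5.reg 10, h10]; omega)).le_val hS ?_
  rintro s6 rfl
  have hK45 : Keep [0, 1] [4, 5, 6, 7] _ s5 := hK.trans hK5
  rw [show B6 = B7 + (n * 12 + 6) + 1 from rfl, val_seq,
    show s4.arr 3 = (s5.put 9 (s5.reg 10)).arr 4 from (hK.arr 3).trans (hK45.arr 4).symm]
  refine le_trans ?_ (hmono _ (B7 + (q Z * 12 + 6)) _ (by omega))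
  refine le_val_fillRandom hS (R := [0, 1, 7, 8, 9, 10]) (A := [3, 5, 6, 7]) (by simpa using h1s5)
    (by simp [hK5.reg 10, h10]) (by simp [hK5.reg 7, h7]) (by omega) (by decide) (by decide) ?_
  intro s7 hK7 hf7
  have z : ∀ c ∈ [5, 6, 7], ∀ x, s7.arr c x = 0 := by
    intro c hc x
    have hc' : c ∈ [3, 5, 6, 7] ∧ c ∈ [4, 5, 6, 7] := by
      simp only [List.mem_cons, List.not_mem_nil, or_false] at hc ⊢
      omega
    rw [hK7.arr c hc'.1, Mem.put_arr, hK45.arr c hc'.2]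
    simp
  have h4z : ∀ x, s5.arr 4 x = 0 := by
    intro x
    rw [hK45.arr 4]
    simp
  have h3z : ∀ x, s4.arr 3 x = 0 := by
    intro x
    rw [hK.arr 3]
    simp
  have h73 : s7.arr 3 = s5.arr 3 := by rw [hK7.arr 3, Mem.put_arr]
  have hword : 2 * ((q Z + 1) * (r Z + 1)) + 2 ≤ 2 ^ w := by
    have : (q Z + 1) * (r Z + 1) = q Z * r Z + q Z + r Z + 1 := by ring
    omega
  have hrun := run_finalize (G := G) (A := s5.arr 3) (B := s7.arr 4) (r := r Z) (N := q Z)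
    (t := t Z) (w := w) (s := s7)
    (by rw [hK7.reg 1]; simpa using h1s5) (by rw [hK7.reg 7]; simp [hK5.reg 7, h7])
    (by rw [hK7.reg 8]; simp [hK5.reg 8, h8]) (by rw [hK7.reg 9]; simp [hK5.reg 10, h10]) h73 rfl
    (by
      intro i hi
      have h1 := (hf5.1 i (by omega) (by omega)).2
      have h2 : max (q Z) 1 ≤ q Z + 1 := by omega
      have : i * q Z + q Z ≤ r Z * q Z := by
        calc i * q Z + q Z = (i + 1) * q Z := by ring
          _ ≤ r Z * q Z := Nat.mul_le_mul_right _ hi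
      omega)
    (by
      intro j
      by_cases hj : j < q Z
      · have h1 := (hf7.1 j (by omega) (by omega)).2
        have h2 : max (r Z) 1 ≤ r Z + 1 := by omega
        have : j * r Z + r Z ≤ q Z * r Z := by
          calc j * r Z + r Z = (j + 1) * r Z := by ring
            _ ≤ q Z * r Z := Nat.mul_le_mul_right _ hj
        omega
      · rw [hf7.2 j (by omega), Mem.put_arr, h4z]
        omega)
    htw hword (z 5 (by decide)) (z 6 (by decide)) (z 7 (by decide))
  have hcost : 100 * ((q Z + 1) * (r Z + 1)) ≤ B7 := by
    have : (q Z + 1) * (r Z + 1) = q Z * r Z + q Z + r Z + 1 := by ring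
    simp only [B7]
    omega
  refine ((hrun.mono hcost fun _ h => h).le_val (T := 0) hS ?_).trans_eq (by rw [zero_add])
  rintro s8 ⟨h8, hout⟩
  exact hF Z (s5.arr 3) (s7.arr 4) s8 h8 hout

end RandomProgram

section Analysis

/-! ## Analysis of the parameters -/

open Real

theorem shrink_le_pow {n a b : ℕ} (hb : 0 < b) (k : ℕ) :
    (shrink n a b k : ℝ) ≤ (n : ℝ) ^ 2 * ((a : ℝ) / b) ^ k := by
  have hb' : (0 : ℝ) < b := by exact_mod_cast hb
  induction k with
  | zero => simp [shrink, pow_two]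
  | succ k ih =>
    calc (shrink n a b (k + 1) : ℝ) ≤ ((shrink n a b k * a : ℕ) : ℝ) / b := Nat.cast_div_le
      _ = shrink n a b k * ((a : ℝ) / b) := by push_cast; ring
      _ ≤ (n : ℝ) ^ 2 * ((a : ℝ) / b) ^ k * ((a : ℝ) / b) := by gcongr
      _ = _ := by ring

/-- Each rounding loses at most `1`, and multiplying by `a / b ≤ 1` does not amplify earlier losses,
so `k` steps lose at most `k`. -/
theorem pow_le_shrink {n a b : ℕ} (hb : 0 < b) (hab : a ≤ b) (k : ℕ) :
    (n : ℝ) ^ 2 * ((a : ℝ) / b) ^ k - k ≤ shrink n a b k := by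
  have hb' : (0 : ℝ) < b := by exact_mod_cast hb
  have hp : (a : ℝ) / b ≤ 1 := by
    rw [div_le_one hb']; exact_mod_cast hab
  have hp0 : 0 ≤ (a : ℝ) / b := by positivity
  induction k with
  | zero => simp [shrink, pow_two]
  | succ k ih =>
    have h1 : ((shrink n a b k * a : ℕ) : ℝ) / b - 1 ≤ (shrink n a b (k + 1) : ℝ) := by
      have := Nat.lt_div_mul_add (a := shrink n a b k * a) hb
      have h2 : ((shrink n a b k * a : ℕ) : ℝ) < (shrink n a b (k + 1) : ℝ) * b + b := by
        exact_mod_cast this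
      rw [sub_le_iff_le_add, div_le_iff₀ hb']
      linarith
    have h3 : ((shrink n a b k * a : ℕ) : ℝ) / b = shrink n a b k * ((a : ℝ) / b) := by
      push_cast; ring
    have h4 := mul_le_mul_of_nonneg_right ih hp0
    have h5 : (k : ℝ) * ((a : ℝ) / b) ≤ k := mul_le_of_le_one_right (by positivity) hp
    rw [pow_succ ((a : ℝ) / b)]
    push_cast
    linarith

/-- Starting at `n²` instead of `n` keeps all values above `n` until the end, so that the rounding
error, at most one per step, only costs `log 2`. -/
theorem shrinkTime_bounds {n a b : ℕ} (ha : 0 < a) (hab : a < b) (hn : 1 ≤ n) {l : ℝ}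
    (hl : log ((a : ℝ) / b)⁻¹ = l) (hbig : log n ≤ (n - 1) * l) :
    log n - log 2 ≤ shrinkTime n a b * l ∧ shrinkTime n a b * l ≤ log n + l := by
  have hb : 0 < b := by omega
  have hb' : (0 : ℝ) < b := by exact_mod_cast hb
  have ha' : (0 : ℝ) < a := by exact_mod_cast ha
  have hn' : (0 : ℝ) < n := by exact_mod_cast hn
  have hp0 : 0 < (a : ℝ) / b := by positivity
  have hlogp : log ((a : ℝ) / b) = -l := by rw [← hl, log_inv, neg_neg]
  have hl0 : 0 < l := by
    rw [← hl, log_inv, neg_pos]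
    refine log_neg hp0 ?_
    rw [div_lt_one hb']
    exact_mod_cast hab
  set R := shrinkTime n a b with hR
  have upper : (R : ℝ) * l ≤ log n + l ∧ (R ≠ 0 → (R : ℝ) * l < log n + l) := by
    rcases Nat.eq_zero_or_pos R with h | h
    · rw [h]
      refine ⟨?_, fun h => absurd rfl h⟩
      have : 0 ≤ log n := log_natCast_nonneg n
      push_cast
      linarith
    · have h1 := (lt_shrink (n := n) (a := a) (b := b) (k := R - 1) (by omega)).1
      have h2 := shrink_le_pow (n := n) (a := a) hb (R - 1)
      have h3 : (n : ℝ) < (n : ℝ) ^ 2 * ((a : ℝ) / b) ^ (R - 1) :=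
        lt_of_lt_of_le (by exact_mod_cast h1) h2
      have h4 := log_lt_log hn' h3
      rw [log_mul (by positivity) (by positivity), log_pow, log_pow, hlogp,
        Nat.cast_sub (by omega)] at h4
      push_cast at h4
      have : (R : ℝ) * l < log n + l := by nlinarith
      exact ⟨this.le, fun _ => this⟩
  refine ⟨?_, upper.1⟩
  -- Reaching the cap `n` would give `n * l < log n + l`, contrary to `hbig`.
  have hlt : R < n := by
    by_contra hge
    have h1 : (n : ℝ) ≤ R := by exact_mod_cast not_lt.1 hge
    have h2 := upper.2 (by omega)
    nlinarith
  have h1 : shrink n a b R ≤ n := by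
    have := shrink_shrinkTime n a b
    rw [← hR] at this
    omega
  have h2 := pow_le_shrink (n := n) hb hab.le R
  have h3 : (shrink n a b R : ℝ) ≤ n := by exact_mod_cast h1
  have h4 : (R : ℝ) ≤ n := by exact_mod_cast hlt.le
  -- At the stopping time, `n² * (a / b) ^ R ≤ n + R ≤ 2 * n`.
  have h5 : (n : ℝ) * ((a : ℝ) / b) ^ R ≤ 2 := by
    have : (n : ℝ) * ((n : ℝ) * ((a : ℝ) / b) ^ R) ≤ n * 2 := by nlinarith
    exact le_of_mul_le_mul_left this hn'
  have h6 := log_le_log (by positivity) h5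
  rw [log_mul (by positivity) (by positivity), log_pow, hlogp] at h6
  linarith

theorem log_inv_le {p : ℝ} (hp : 0 < p) : p * log p⁻¹ ≤ 1 - p := by
  have h := log_le_sub_one_of_pos (inv_pos.2 hp)
  calc p * log p⁻¹ ≤ p * (p⁻¹ - 1) := mul_le_mul_of_nonneg_left h hp.le
    _ = 1 - p := by field_simp

theorem one_sub_le_log_inv {p : ℝ} (hp : 0 < p) : 1 - p ≤ log p⁻¹ := by
  have h := log_le_sub_one_of_pos hp
  rw [log_inv]
  linarith

/-- A single term of the binomial expansion of `(p + (1 - p)) ^ r = 1` is at most `1`. -/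
theorem choose_le_exp {r t : ℕ} (htr : t ≤ r) {p : ℝ} (hp0 : 0 < p) (hp1 : p < 1) :
    (r.choose t : ℝ) ≤ exp (t * log p⁻¹ + (r - t) * log (1 - p)⁻¹) := by
  have hq0 : 0 < 1 - p := by linarith
  have h1 : p ^ t * (1 - p) ^ (r - t) * (r.choose t : ℝ) ≤ 1 := by
    have hsum := add_pow p (1 - p) r
    rw [add_sub_cancel, one_pow] at hsum
    refine le_of_le_of_eq ?_ hsum.symm
    exact Finset.single_le_sum (f := fun m => p ^ m * (1 - p) ^ (r - m) * (r.choose m : ℝ))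
      (a := t) (fun m _ => by positivity) (Finset.mem_range.2 (Nat.lt_succ_of_le htr))
  have h2 : exp (t * log p⁻¹ + (r - t) * log (1 - p)⁻¹) * (p ^ t * (1 - p) ^ (r - t)) = 1 := by
    have e1 : p ^ t = exp (t * log p) := by rw [← log_pow, exp_log (by positivity)]
    have e2 : (1 - p) ^ (r - t) = exp ((r - t) * log (1 - p)) := by
      rw [← Nat.cast_sub htr, ← log_pow, exp_log (by positivity)]
    rw [e1, e2, ← exp_add, ← exp_add, log_inv, log_inv, exp_eq_one_iff]
    ring
  have h3 : 0 < p ^ t * (1 - p) ^ (r - t) := by positivity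
  by_contra hlt
  rw [not_le] at hlt
  have := mul_lt_mul_of_pos_left hlt h3
  nlinarith

end Analysis

/-! ### Inequalities between sizes, entropy and accuracy -/

section Parameters

open Real

/-- What the search for a biclique needs to know about its parameters: `n` is the number of
vertices, `p` the estimated density, `k` the accuracy, `r` the number of vertices on the left from
which the biclique is chosen, and `t` its size. -/
structure GoodParams (n : ℕ) (p : ℝ) (k r t : ℕ) : Prop where
  k_le : k ≤ t
  t_le : t ≤ r
  t_le_mul : (t : ℝ) ≤ p * r * (1 - (1 - p) / k)
  choose_le : (t * r.choose t : ℕ) ≤ n * (p * (1 - p)) / (16 * k * (r + 1))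
  lower : (1 - 7 / k) * (p * log n / binEntropy p) ≤ t
  upper : t ≤ p * log n / binEntropy p
  cube_le : (k : ℝ) ^ 3 / 200 ≤ r * (p * (1 - p))
  root_le : exp (-(log n / 4)) ≤ p * (1 - p) / (8 * k)
  r_le : r ≤ log n / binEntropy p

/-- The sizes of the quantities in terms of which the parameters are chosen: `L` is the logarithm of
the number of vertices, `p` the estimated density, `H` its entropy and `k` the accuracy. -/
structure EntropyScale (L p l l' u H k : ℝ) : Prop where
  p_pos : 0 < p
  p_lt_one : p < 1
  log_inv_eq : log p⁻¹ = l
  log_inv_eq' : log (1 - p)⁻¹ = l'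
  l_pos : 0 < l
  l'_pos : 0 < l'
  l_le : l ≤ u
  l'_le : l' ≤ u
  half_le : 1 / 2 ≤ u
  entropy_eq : H = p * l + (1 - p) * l'
  entropy_pos : 0 < H
  entropy_le_one : H ≤ 1
  le_k : 32 ≤ k
  cube_mul_le : k ^ 3 * u ≤ 16 * L
  sq_le : k ^ 2 ≤ L
  le_L : 1000 ≤ L
  mul_u_le : 16 * u ≤ L / k

/-- Since `min R R' * u ≤ L + u`, taking `k` as a cube root of `min R R'` gives `k ^ 3 * u = O(L)`.
This is what makes the error terms `16 * u` and `√L` at most `L / k`. -/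
theorem entropyScale_of_bounds {L p l l' u R R' k : ℝ} (hp0 : 0 < p)
    (hp1 : p < 1) (hl : log p⁻¹ = l) (hl' : log (1 - p)⁻¹ = l') (hu : max l l' = u)
    (hk : 32 ≤ k) (hRu : R * l ≤ L + l) (hRu' : R' * l' ≤ L + l')
    (hkM : (k - 1) ^ 3 ≤ min R R') : EntropyScale L p l l' u (binEntropy p) k := by
  have hH : binEntropy p = p * l + (1 - p) * l' := by rw [binEntropy, hl, hl']
  have hq0 : 0 < 1 - p := by linarith
  have hl0 : 0 < l := by
    rw [← hl, log_inv, neg_pos]; exact log_neg hp0 hp1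
  have hl0' : 0 < l' := by
    rw [← hl', log_inv, neg_pos]; exact log_neg hq0 (by linarith)
  have hlu : l ≤ u := hu ▸ le_max_left _ _
  have hlu' : l' ≤ u := hu ▸ le_max_right _ _
  have hk0 : (0 : ℝ) < k := by linarith
  have hlog2 : log 2 ≤ 1 := by have := log_two_lt_d9; linarith
  have hu2 : 1 / 2 ≤ u := by
    rcases le_total p (1 / 2) with h | h
    · refine le_trans ?_ hlu
      have h1 := one_sub_le_log_inv hp0
      linarith
    · refine le_trans ?_ hlu'
      have h1 := one_sub_le_log_inv hq0
      linarith
  have hMu : min R R' * u ≤ L + u := by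
    rcases max_choice l l' with h | h
    · rw [h] at hu; subst hu
      exact (mul_le_mul_of_nonneg_right (min_le_left _ _) hl0.le).trans hRu
    · rw [h] at hu; subst hu
      exact (mul_le_mul_of_nonneg_right (min_le_right _ _) hl0'.le).trans hRu'
  have hk3 : (k : ℝ) ^ 3 * u ≤ 16 * L := by
    have h1 : (k : ℝ) ^ 3 ≤ 8 * ((k : ℝ) - 1) ^ 3 := by
      have : (k : ℝ) ≤ 2 * (k - 1) := by linarith
      calc (k : ℝ) ^ 3 ≤ (2 * (k - 1)) ^ 3 := pow_le_pow_left₀ hk0.le this 3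
        _ = 8 * ((k : ℝ) - 1) ^ 3 := by ring
    have h2 : (16 : ℝ) ≤ (k : ℝ) ^ 3 := by
      calc (16 : ℝ) ≤ 32 ^ 3 := by norm_num
        _ ≤ (k : ℝ) ^ 3 := pow_le_pow_left₀ (by norm_num) hk 3
    have h3 : (k : ℝ) ^ 3 * u ≤ 8 * (L + u) := by
      calc (k : ℝ) ^ 3 * u ≤ 8 * min R R' * u :=
            mul_le_mul_of_nonneg_right (by linarith) (by linarith)
        _ ≤ 8 * (L + u) := by linarith
    have h4 : 16 * u ≤ (k : ℝ) ^ 3 * u := mul_le_mul_of_nonneg_right h2 (by linarith)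
    linarith
  have hk2 : (k : ℝ) ^ 2 ≤ L := by
    have h1 : (k : ℝ) ^ 3 * (1 / 2) ≤ 16 * L :=
      (mul_le_mul_of_nonneg_left hu2 (by positivity)).trans hk3
    have h2 : (k : ℝ) ^ 2 * 32 ≤ (k : ℝ) ^ 2 * k := mul_le_mul_of_nonneg_left hk (by positivity)
    have h3 : (k : ℝ) ^ 2 * k = (k : ℝ) ^ 3 := by ring
    linarith
  have hk2' : (32 : ℝ) ^ 2 ≤ k ^ 2 := pow_le_pow_left₀ (by norm_num) hk 2
  refine ⟨hp0, hp1, hl, hl', hl0, hl0', hlu, hlu', hu2, hH, ?_, (binEntropy_le_log_two).trans hlog2,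
    hk, hk3, hk2, by linarith, ?_⟩
  · rw [hH]; positivity
  · rw [le_div_iff₀ hk0]
    have h1 : (k : ℝ) ^ 3 * u = (k : ℝ) ^ 2 * (k * u) := by ring
    have h2 : 32 ^ 2 * ((k : ℝ) * u) ≤ (k : ℝ) ^ 2 * (k * u) :=
      mul_le_mul_of_nonneg_right hk2' (mul_nonneg hk0.le (by linarith))
    have h3 : 0 ≤ k * u := mul_nonneg hk0.le (by linarith)
    linarith

namespace EntropyScale

variable {L p l l' u H k : ℝ} (h : EntropyScale L p l l' u H k)
include h

theorem k_pos : 0 < k := by linarith [h.le_k]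

theorem L_pos : 0 < L := by linarith [h.le_L]

theorem k_le_div : k ≤ L / k := by
  rw [le_div_iff₀ h.k_pos]; linarith [h.sq_le]

theorem L_div_nonneg : 0 ≤ L / k := div_nonneg h.L_pos.le h.k_pos.le

theorem L_div_le : L / k ≤ L / 32 :=
  div_le_div_of_nonneg_left h.L_pos.le (by norm_num) h.le_k

/-- The quotient `ρ = R * R' / (p * R' + (1 - p) * R)` is the weighted harmonic mean of `R ≈ L / l`
and `R' ≈ L / l'`, so `ρ * H ≈ L`. The factor `1 - 4 / k` creates the margin in which the keys can
be counted; all errors together cost at most `L / k` in either direction. -/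
theorem size_bounds {R R' r : ℝ} (hR0 : 0 < R) (hR0' : 0 < R')
    (hR : L - log 2 ≤ R * l) (hRu : R * l ≤ L + l)
    (hR' : L - log 2 ≤ R' * l') (hRu' : R' * l' ≤ L + l')
    (hr : r ≤ R * R' * (k - 4) / ((p * R' + (1 - p) * R) * k))
    (hr' : R * R' * (k - 4) / ((p * R' + (1 - p) * R) * k) - 1 ≤ r) :
    L - 5 * (L / k) ≤ r * H ∧ r * H ≤ L - 3 * (L / k) := by
  have hk0 := h.k_pos
  have hL0 := h.L_pos
  have hp0 := h.p_pos
  have hq0 : 0 < 1 - p := by linarith [h.p_lt_one]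
  have hH0 := h.entropy_pos
  have hlog2 : log 2 ≤ 1 := by have := log_two_lt_d9; linarith
  obtain ⟨D, hD⟩ : ∃ D, D = p * R' + (1 - p) * R := ⟨_, rfl⟩
  rw [← hD] at hr hr'
  have hD0 : 0 < D := by rw [hD]; positivity
  obtain ⟨ρ, hρ⟩ : ∃ ρ, ρ = R * R' / D := ⟨_, rfl⟩
  have hρ0 : 0 < ρ := by rw [hρ]; positivity
  have hρH : ρ * H * D = p * R' * (R * l) + (1 - p) * R * (R' * l') := by
    rw [hρ, h.entropy_eq]; field_simp
  have hρup : ρ * H ≤ L + u := by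
    have h1 := mul_le_mul_of_nonneg_left (hRu.trans (by linarith [h.l_le] : L + l ≤ L + u))
      (mul_nonneg hp0.le hR0'.le)
    have h2 := mul_le_mul_of_nonneg_left (hRu'.trans (by linarith [h.l'_le] : L + l' ≤ L + u))
      (mul_nonneg hq0.le hR0.le)
    have h3 : (L + u) * D = p * R' * (L + u) + (1 - p) * R * (L + u) := by rw [hD]; ring
    exact le_of_mul_le_mul_right (by linarith) hD0
  have hρlow : L - 1 ≤ ρ * H := by
    have h1 := mul_le_mul_of_nonneg_left ((by linarith : L - 1 ≤ L - log 2).trans hR)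
      (mul_nonneg hp0.le hR0'.le)
    have h2 := mul_le_mul_of_nonneg_left ((by linarith : L - 1 ≤ L - log 2).trans hR')
      (mul_nonneg hq0.le hR0.le)
    have h3 : (L - 1) * D = p * R' * (L - 1) + (1 - p) * R * (L - 1) := by rw [hD]; ring
    exact le_of_mul_le_mul_right (by linarith) hD0
  have hrarg : R * R' * (k - 4) / (D * k) = ρ * (1 - 4 / k) := by
    rw [hρ]; field_simp
  rw [hrarg] at hr hr'
  have h4k : 4 / k ≤ 1 := by rw [div_le_one hk0]; linarith [h.le_k]
  have h4 : 0 ≤ 4 / k := by positivity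
  constructor
  · have h1 : (ρ * (1 - 4 / k) - 1) * H ≤ r * H := mul_le_mul_of_nonneg_right hr' hH0.le
    have h2 : (L - 1) * (1 - 4 / k) ≤ ρ * H * (1 - 4 / k) :=
      mul_le_mul_of_nonneg_right hρlow (by linarith)
    have h3 : (L - 1) * (1 - 4 / k) = L - 4 * (L / k) - (1 - 4 / k) := by field_simp
    have h5 : (ρ * (1 - 4 / k) - 1) * H = ρ * H * (1 - 4 / k) - H := by ring
    linarith [h.k_le_div, h.le_k, h.entropy_le_one]
  · have h1 : r * H ≤ ρ * (1 - 4 / k) * H := mul_le_mul_of_nonneg_right hr hH0.le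
    have h2 : ρ * H * (1 - 4 / k) ≤ (L + L / k) * (1 - 4 / k) :=
      mul_le_mul_of_nonneg_right (by linarith [h.mul_u_le, h.half_le]) (by linarith)
    have h3 : (L + L / k) * (1 - 4 / k) = L - 3 * (L / k) - 4 * (L / k) / k := by
      field_simp; ring
    have h5 : 0 ≤ 4 * (L / k) / k := by positivity
    have h6 : ρ * (1 - 4 / k) * H = ρ * H * (1 - 4 / k) := by ring
    linarith

theorem entropy_le : H ≤ 3 * u * p := by
  have hp0 := h.p_pos
  have hq0 : 0 < 1 - p := by linarith [h.p_lt_one]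
  have h1 := log_inv_le hq0
  rw [h.log_inv_eq'] at h1
  have h2 : p * l ≤ p * u := mul_le_mul_of_nonneg_left h.l_le hp0.le
  have h3 : p * (1 / 2) ≤ p * u := mul_le_mul_of_nonneg_left h.half_le hp0.le
  rw [h.entropy_eq]
  linarith

/-- On each side of `1 / 2`, the term of the rarer outcome is bounded by means of `u`, the other one
by `log x ≤ x - 1`. -/
theorem entropy_le' : H ≤ 6 * u * (p * (1 - p)) := by
  have hp0 := h.p_pos
  have hq0 : 0 < 1 - p := by linarith [h.p_lt_one]
  have h1 := log_inv_le hp0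
  have h2 := log_inv_le hq0
  have hu := h.half_le
  rw [h.log_inv_eq] at h1
  rw [h.log_inv_eq'] at h2
  have h6 : 2 * (p * (1 - p)) ≤ 4 * u * (p * (1 - p)) :=
    mul_le_mul_of_nonneg_right (by linarith) (by positivity)
  rw [h.entropy_eq]
  rcases le_total p (1 / 2) with hp | hp
  · have h3 : p * l ≤ p * u := mul_le_mul_of_nonneg_left h.l_le hp0.le
    have h4 : p * (1 / 2) ≤ p * (1 - p) := mul_le_mul_of_nonneg_left (by linarith) hp0.le
    have h5 : p * u ≤ 2 * (p * (1 - p)) * u :=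
      mul_le_mul_of_nonneg_right (by linarith) (by linarith)
    linarith
  · have h3 : (1 - p) * l' ≤ (1 - p) * u := mul_le_mul_of_nonneg_left h.l'_le hq0.le
    have h4 : 1 / 2 * (1 - p) ≤ p * (1 - p) := mul_le_mul_of_nonneg_right hp hq0.le
    have h5 : (1 - p) * u ≤ 2 * (p * (1 - p)) * u :=
      mul_le_mul_of_nonneg_right (by linarith) (by linarith)
    linarith

/-- The size is kept below `p * r` by the factor `1 - (1 - p) / k`; this gap later forces many
vertices to have `t` neighbours among the candidates. -/
theorem bicliqueSize_bounds {r t : ℝ} (hr : L - 5 * (L / k) ≤ r * H) (hr' : r * H ≤ L - 3 * (L / k))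
    (ht : t ≤ (k - (1 - p)) * p * r / k) (ht' : (k - (1 - p)) * p * r / k - 1 ≤ t) :
    k ≤ t ∧ t ≤ p * r ∧ t ≤ p * r * (1 - (1 - p) / k) ∧ (1 - 7 / k) * (p * L / H) ≤ t ∧
      t ≤ p * L / H := by
  have hk0 := h.k_pos
  have hL0 := h.L_pos
  have hp0 := h.p_pos
  have hp1 := h.p_lt_one
  have hH0 := h.entropy_pos
  have hr0 : 0 ≤ r := by
    by_contra hneg
    have h1 : r * H ≤ 0 := mul_nonpos_of_nonpos_of_nonneg (not_le.1 hneg).le hH0.le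
    linarith [h.L_div_le]
  obtain ⟨tgt, htgt⟩ : ∃ tgt, tgt = p * L / H := ⟨_, rfl⟩
  have htH : tgt * H = p * L := by rw [htgt]; field_simp
  rw [← htgt]
  have htgtk : 2 * k ≤ tgt := by
    rw [htgt, le_div_iff₀ hH0]
    have h1 : 16 * u * k ≤ L := (le_div_iff₀ hk0).1 h.mul_u_le
    have hku : 0 ≤ u * k := mul_nonneg (by linarith [h.half_le]) hk0.le
    calc 2 * k * H ≤ 2 * k * (3 * u * p) :=
          mul_le_mul_of_nonneg_left h.entropy_le (by positivity)
      _ = 6 * (u * k) * p := by ring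
      _ ≤ L * p := mul_le_mul_of_nonneg_right (by linarith) hp0.le
      _ = p * L := by ring
  have hpr : tgt * (1 - 5 / k) ≤ p * r := by
    have h1 : tgt * (1 - 5 / k) = p * (L - 5 * (L / k)) / H := by rw [htgt]; field_simp
    rw [h1, div_le_iff₀ hH0, mul_assoc]
    exact mul_le_mul_of_nonneg_left hr hp0.le
  have hpr' : p * r ≤ tgt := by
    rw [htgt, le_div_iff₀ hH0, mul_assoc]
    exact mul_le_mul_of_nonneg_left (by linarith [h.L_div_nonneg]) hp0.le
  have htarg : (k - (1 - p)) * p * r / k = p * r * (1 - (1 - p) / k) := by field_simp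
  rw [htarg] at ht ht'
  have hqk : (1 - p) / k ≤ 1 / k := div_le_div_of_nonneg_right (by linarith) hk0.le
  have h1k : 1 / k ≤ 1 := by rw [div_le_one hk0]; linarith [h.le_k]
  have hqk0 : 0 ≤ (1 - p) / k := div_nonneg (by linarith) hk0.le
  have hpr0 : 0 ≤ p * r := by positivity
  have htpr : t ≤ p * r := ht.trans (mul_le_of_le_one_right hpr0 (by linarith))
  -- Of the loss `7 / k`, five parts come from `r`, one from the factor `1 - (1 - p) / k`, and one
  -- pays for rounding down, because the target is at least `2 * k`.
  have htlow : (1 - 7 / k) * tgt ≤ t := by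
    have h1 : p * r * (1 - 1 / k) ≤ p * r * (1 - (1 - p) / k) :=
      mul_le_mul_of_nonneg_left (by linarith) hpr0
    have h2 : tgt * (1 - 5 / k) * (1 - 1 / k) ≤ p * r * (1 - 1 / k) :=
      mul_le_mul_of_nonneg_right hpr (by linarith)
    have h3 : tgt * (1 - 5 / k) * (1 - 1 / k) = tgt - 6 * (tgt / k) + 5 * (tgt / k) / k := by
      field_simp; ring
    have h4 : (1 - 7 / k) * tgt = tgt - 7 * (tgt / k) := by field_simp
    have h5 : 1 ≤ tgt / k := by rw [le_div_iff₀ hk0]; linarith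
    have h6 : 0 ≤ 5 * (tgt / k) / k := by
      have : 0 ≤ tgt := by linarith
      positivity
    linarith
  refine ⟨?_, htpr, ht, htlow, htpr.trans hpr'⟩
  have h7 : 7 / k ≤ 1 / 2 := by rw [div_le_iff₀ hk0]; linarith [h.le_k]
  have h8 : 1 / 2 * tgt ≤ (1 - 7 / k) * tgt :=
    mul_le_mul_of_nonneg_right (by linarith) (by linarith)
  linarith

theorem exp_le_mul : exp (-(2 * u)) ≤ p * (1 - p) := by
  have hp0 := h.p_pos
  have hq0 : 0 < 1 - p := by linarith [h.p_lt_one]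
  have hpe : exp (-u) ≤ p := by
    have h1 := h.log_inv_eq
    rw [← log_le_log_iff (exp_pos _) hp0, log_exp]
    rw [log_inv] at h1
    linarith [h.l_le]
  have hqe : exp (-u) ≤ 1 - p := by
    have h1 := h.log_inv_eq'
    rw [← log_le_log_iff (exp_pos _) hq0, log_exp]
    rw [log_inv] at h1
    linarith [h.l'_le]
  calc exp (-(2 * u)) = exp (-u) * exp (-u) := by rw [← exp_add]; ring_nf
    _ ≤ p * (1 - p) := mul_le_mul hpe hqe (exp_pos _).le hp0.le

theorem mul_le_entropy : p * (1 - p) ≤ H := by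
  have hp0 := h.p_pos
  have hq0 : 0 < 1 - p := by linarith [h.p_lt_one]
  have h1 := one_sub_le_log_inv hp0
  rw [h.log_inv_eq] at h1
  rw [h.entropy_eq]
  have h2 : p * (1 - p) ≤ p * l := mul_le_mul_of_nonneg_left h1 hp0.le
  have h3 : 0 ≤ (1 - p) * l' := mul_nonneg hq0.le h.l'_pos.le
  linarith

theorem le_exp_of_mul_le {r : ℝ} (hr : r * H ≤ L) : r ≤ exp (log L + 2 * u) := by
  refine le_of_mul_le_mul_right (hr.trans ?_) h.entropy_pos
  calc L = exp (log L + 2 * u) * exp (-(2 * u)) := by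
        rw [← exp_add, add_neg_cancel_right, exp_log h.L_pos]
    _ ≤ exp (log L + 2 * u) * H :=
        mul_le_mul_of_nonneg_left (h.exp_le_mul.trans h.mul_le_entropy) (exp_pos _).le

/-- For `t = p * r` the exponent in `choose_le_exp` would be exactly `r * H`. Taking `t` smaller by
a proportion of order `1 / k` adds at most `L / k`, and rounding adds at most `u`. -/
theorem choose_le {r t : ℕ} (htr : t ≤ r) (hr : r * H ≤ L - 3 * (L / k)) (ht : (t : ℝ) ≤ p * r)
    (ht' : (k - (1 - p)) * p * r / k - 1 ≤ t) : (r.choose t : ℝ) ≤ exp (L - 2 * (L / k) + u) := by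
  have hk0 := h.k_pos
  have hp0 := h.p_pos
  have hq0 : 0 < 1 - p := by linarith [h.p_lt_one]
  have hl0 := h.l_pos
  have hl0' := h.l'_pos
  refine (choose_le_exp htr hp0 h.p_lt_one).trans (exp_le_exp.2 ?_)
  rw [h.log_inv_eq, h.log_inv_eq']
  have h1 : (t : ℝ) * l ≤ p * r * l := mul_le_mul_of_nonneg_right ht hl0.le
  have h2 : (r : ℝ) - t ≤ (1 - p) * r * (1 + 1 / k) + 1 := by
    have h3 : (k - (1 - p)) * p * r / k = p * r - p * ((1 - p) * r * (1 / k)) := by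
      field_simp
    have h4 : p * ((1 - p) * r * (1 / k)) ≤ (1 - p) * r * (1 / k) :=
      mul_le_of_le_one_left (by positivity) h.p_lt_one.le
    linarith
  have h3 := mul_le_mul_of_nonneg_right h2 hl0'.le
  have h4 : p * r * l + (1 - p) * r * l' = r * H := by rw [h.entropy_eq]; ring
  have h5 : (1 - p) * r * l' ≤ L := by
    have h6 : 0 ≤ p * r * l := by positivity
    linarith [h.L_div_nonneg]
  have h6 : ((1 - p) * r * (1 + 1 / k) + 1) * l' =
    (1 - p) * r * l' + (1 - p) * r * l' / k + l' := by field_simp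
  have h7 : (1 - p) * r * l' / k ≤ L / k := div_le_div_of_nonneg_right h5 hk0.le
  linarith [h.l'_le]

theorem sqrt_le : √L ≤ L / k := by
  have hk0 := h.k_pos
  have hkL : k ≤ √L := le_sqrt_of_sq_le h.sq_le
  have hsq : √L * √L = L := mul_self_sqrt h.L_pos.le
  rw [le_div_iff₀ hk0]
  have := mul_le_mul_of_nonneg_left hkL (sqrt_nonneg L)
  linarith

/-- Needed for Chebyshev's inequality on the left side, where the failure probability is of order `k
^ 2 / (r * (p * (1 - p)))`. It follows from `r * H ≥ L / 2` and `H ≤ 6 * u * (p * (1 - p))`. -/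
theorem cube_le {r : ℝ} (hr0 : 0 ≤ r) (hr : L - 5 * (L / k) ≤ r * H) :
    k ^ 3 / 200 ≤ r * (p * (1 - p)) := by
  have hp0 := h.p_pos
  have hq0 : 0 < 1 - p := by linarith [h.p_lt_one]
  have hu0 : 0 < u := by linarith [h.half_le]
  have h1 : L / 2 ≤ r * H := by linarith [h.L_div_le, h.L_pos]
  have h2 : L / 2 ≤ 6 * u * (r * (p * (1 - p))) := by
    calc L / 2 ≤ r * H := h1
      _ ≤ r * (6 * u * (p * (1 - p))) := mul_le_mul_of_nonneg_left h.entropy_le' hr0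
      _ = _ := by ring
  have h3 : k ^ 3 * u ≤ 200 * (r * (p * (1 - p))) * u := by
    have : 0 ≤ r * (p * (1 - p)) * u := by positivity
    linarith [h.cube_mul_le]
  have h4 := le_of_mul_le_mul_right h3 hu0
  linarith

/-- The error `n ^ (-1/4)` allowed in the sampled density is within the tolerance of the search. -/
theorem root_le (hL : 3 * log L + log 32 ≤ √L) : exp (-(L / 4)) ≤ p * (1 - p) / (8 * k) := by
  have hk0 := h.k_pos
  have hL0 := h.L_pos
  rw [le_div_iff₀ (by positivity)]
  refine le_trans ?_ h.exp_le_mul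
  have h8 : 8 * k ≤ exp (log 32 + log L) := by
    rw [exp_add, exp_log (by norm_num), exp_log hL0]
    have : k ≤ k ^ 2 := le_self_pow₀ (by linarith [h.le_k]) (by norm_num)
    linarith [h.sq_le]
  calc exp (-(L / 4)) * (8 * k) ≤ exp (-(L / 4)) * exp (log 32 + log L) :=
        mul_le_mul_of_nonneg_left h8 (exp_pos _).le
    _ = exp (-(L / 4) + (log 32 + log L)) := by rw [← exp_add]
    _ ≤ exp (-(2 * u)) := exp_le_exp.2 (by
        have h10 : 0 ≤ log L := log_nonneg (by linarith [h.le_L])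
        linarith [h.sqrt_le, h.L_div_le, h.mul_u_le])

end EntropyScale

theorem goodParams_of_bounds {n : ℕ} (hn : 1 ≤ n) {p l l' u R R' : ℝ} {k r t : ℕ} (hp0 : 0 < p)
    (hp1 : p < 1) (hl : log p⁻¹ = l) (hl' : log (1 - p)⁻¹ = l') (hu : max l l' = u)
    (hk : 32 ≤ k) (hR0 : 0 < R) (hR0' : 0 < R')
    (hR : log n - log 2 ≤ R * l) (hRu : R * l ≤ log n + l)
    (hR' : log n - log 2 ≤ R' * l') (hRu' : R' * l' ≤ log n + l')
    (hkM : ((k : ℝ) - 1) ^ 3 ≤ min R R')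
    (hr : r = ⌊R * R' * (k - 4) / ((p * R' + (1 - p) * R) * k)⌋₊)
    (ht : t = ⌊(k - (1 - p)) * p * r / k⌋₊)
    (hL : 3 * log (log n) + log 32 ≤ √(log n)) : GoodParams n p k r t := by
  have hk' : (32 : ℝ) ≤ k := by exact_mod_cast hk
  have h := entropyScale_of_bounds hp0 hp1 hl hl' hu hk' hRu hRu' hkM
  have hn' : (0 : ℝ) < n := by exact_mod_cast hn
  have hL0 := h.L_pos
  have hk0 := h.k_pos
  have hq0 : 0 < 1 - p := by linarith
  have hH0 := h.entropy_pos
  have hr1 : (r : ℝ) ≤ R * R' * (k - 4) / ((p * R' + (1 - p) * R) * k) := by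
    rw [hr]
    refine Nat.floor_le (div_nonneg (mul_nonneg (by positivity) (by linarith)) (by positivity))
  have hr2 : R * R' * (k - 4) / ((p * R' + (1 - p) * R) * k) - 1 ≤ r := by
    rw [hr]; exact (Nat.sub_one_lt_floor _).le
  have ht1 : (t : ℝ) ≤ (k - (1 - p)) * p * r / k := by
    rw [ht]
    have : 0 ≤ (k : ℝ) - (1 - p) := by linarith
    exact Nat.floor_le (by positivity)
  have ht2 : ((k : ℝ) - (1 - p)) * p * r / k - 1 ≤ t := by
    rw [ht]; exact (Nat.sub_one_lt_floor _).le
  obtain ⟨hrH', hrH⟩ := h.size_bounds hR0 hR0' hR hRu hR' hRu' hr1 hr2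
  obtain ⟨htk, htpr, htle, htlow, htup⟩ := h.bicliqueSize_bounds hrH' hrH ht1 ht2
  have htr : (t : ℝ) ≤ r := htpr.trans (mul_le_of_le_one_left (by positivity) hp1.le)
  have htr' : t ≤ r := by exact_mod_cast htr
  have hr1 : (1 : ℝ) ≤ r := by linarith
  have hrL : (r : ℝ) * binEntropy p ≤ log n := by linarith [h.L_div_nonneg]
  have hre := h.le_exp_of_mul_le hrL
  have hce := h.choose_le htr' hrH htpr ht2
  refine ⟨by exact_mod_cast htk, htr', htle, ?_, htlow, htup, h.cube_le (by positivity) hrH',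
    h.root_le hL, (le_div_iff₀ hH0).2 hrL⟩
  have hke : (k : ℝ) ≤ exp (log (log n)) := by
    rw [exp_log hL0]
    exact (le_self_pow₀ (by linarith) (by norm_num)).trans h.sq_le
  rw [le_div_iff₀ (by positivity)]
  have h32 : (32 : ℝ) = exp (log 32) := (exp_log (by norm_num)).symm
  have hnL : (n : ℝ) = exp (log n) := (exp_log hn').symm
  push_cast
  calc (t : ℝ) * r.choose t * (16 * k * (r + 1)) ≤ r * r.choose t * (16 * k * (r + r)) := by
        gcongr
    _ = r * r.choose t * (32 * k * r) := by ring
    _ ≤ exp (log (log n) + 2 * u) * exp (log n - 2 * (log n / k) + u) *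
        (exp (log 32) * exp (log (log n)) * exp (log (log n) + 2 * u)) := by
        rw [← h32]
        gcongr
    _ = exp (log n + (3 * log (log n) + log 32) + 5 * u - 2 * (log n / k)) := by
        rw [← exp_add, ← exp_add, ← exp_add, ← exp_add]
        ring_nf
    -- One `L / k` absorbs `3 * log L + log 32 ≤ √L`, the other absorbs `7 * u`.
    _ ≤ exp (log n + -(2 * u)) := exp_le_exp.2 (by linarith [h.sqrt_le, h.mul_u_le])
    _ = n * exp (-(2 * u)) := by rw [exp_add, ← hnL]
    _ ≤ n * (p * (1 - p)) := mul_le_mul_of_nonneg_left h.exp_le_mul hn'.le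

end Parameters

/-! ### Good parameters for all large `n` and moderate densities -/

section Parameters

open Real

theorem three_mul_log_add_le : ∀ᶠ x in atTop, 3 * log x + log 32 ≤ √x := by
  have h1 := (isLittleO_log_rpow_atTop (show (0 : ℝ) < 1 / 2 by norm_num)).bound
    (show (0 : ℝ) < 1 / 6 by norm_num)
  filter_upwards [h1, eventually_ge_atTop (64 : ℝ), eventually_ge_atTop ((2 * log 32) ^ 2)]
    with x hx hx1 hx2
  rw [← sqrt_eq_rpow, norm_of_nonneg (sqrt_nonneg x), norm_of_nonneg (log_nonneg (by linarith))]
    at hx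
  have := le_sqrt_of_sq_le hx2
  linarith

theorem log_le_pred_mul_exp :
    ∀ᶠ n : ℕ in atTop, log n ≤ ((n : ℝ) - 1) * exp (-(log n / 2)) := by
  have h1 := (isLittleO_log_rpow_atTop (show (0 : ℝ) < 1 / 2 by norm_num)).bound
    (show (0 : ℝ) < 1 / 2 by norm_num)
  filter_upwards [tendsto_natCast_atTop_atTop.eventually h1, eventually_ge_atTop 2] with n hn hn2
  have hn2' : (2 : ℝ) ≤ n := by exact_mod_cast hn2
  rw [← sqrt_eq_rpow, norm_of_nonneg (sqrt_nonneg _), norm_of_nonneg (log_natCast_nonneg n)] at hn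
  have hs : 0 < √(n : ℝ) := sqrt_pos.2 (by linarith)
  rw [exp_neg, exp_half, exp_log (by linarith), ← div_eq_mul_inv, le_div_iff₀ hs]
  have h2 := mul_self_sqrt (show (0 : ℝ) ≤ n by linarith)
  nlinarith

theorem leftSize_eq_floor {n a b : ℕ} (hb : 0 < b) (hab : a ≤ b) (hk : 4 ≤ accuracy n a b) :
    leftSize n a b = ⌊(shrinkTime n a b : ℝ) * shrinkTime n (b - a) b * (accuracy n a b - 4) /
      (((a : ℝ) / b * shrinkTime n (b - a) b + (1 - (a : ℝ) / b) * shrinkTime n a b) *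
        accuracy n a b)⌋₊ := by
  have hb' : (0 : ℝ) < b := by exact_mod_cast hb
  rw [leftSize, ← Nat.floor_div_eq_div (K := ℝ)]
  congr 1
  push_cast [Nat.cast_sub hk, Nat.cast_sub hab]
  rw [show (a : ℝ) / b * shrinkTime n (b - a) b + (1 - (a : ℝ) / b) * shrinkTime n a b =
    (a * shrinkTime n (b - a) b + (b - a) * shrinkTime n a b) / b by field_simp]
  rw [div_mul_eq_mul_div, div_div_eq_mul_div]
  ring

theorem bicliqueSize_eq_floor {n a b : ℕ} (hb : 0 < b) (hab : a ≤ b) (hk : 4 ≤ accuracy n a b) :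
    bicliqueSize n a b = ⌊((accuracy n a b : ℝ) - (1 - (a : ℝ) / b)) * ((a : ℝ) / b) *
      leftSize n a b / accuracy n a b⌋₊ := by
  have hb' : (0 : ℝ) < b := by exact_mod_cast hb
  have hk' : (0 : ℝ) < accuracy n a b := by exact_mod_cast (by omega : 0 < accuracy n a b)
  have h1 : b - a ≤ b * accuracy n a b :=
    (Nat.sub_le _ _).trans (Nat.le_mul_of_pos_right _ (by omega))
  rw [bicliqueSize, ← Nat.floor_div_eq_div (K := ℝ)]
  congr 1
  push_cast [Nat.cast_sub h1, Nat.cast_sub hab]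
  field_simp

/-- For a large number of vertices and moderate densities, the parameters are good, and the accuracy
is high. -/
theorem exists_goodParams (K : ℕ) : ∃ ε > 0, ∃ n₀ : ℕ, ∀ n ≥ n₀, ∀ a b : ℕ, 0 < a → a < b →
    log ((a : ℝ) / b)⁻¹ ≤ ε * log n → log (1 - (a : ℝ) / b)⁻¹ ≤ ε * log n →
    K ≤ accuracy n a b ∧
      GoodParams n ((a : ℝ) / b) (accuracy n a b) (leftSize n a b) (bicliqueSize n a b) := by
  obtain ⟨K', hK'⟩ : ∃ K', K' = max K 32 := ⟨_, rfl⟩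
  have hK32 : (32 : ℝ) ≤ K' := by exact_mod_cast hK' ▸ le_max_right K 32
  have hK3 : (32 : ℝ) ^ 3 ≤ (K' : ℝ) ^ 3 := pow_le_pow_left₀ (by norm_num) hK32 3
  have hlog := tendsto_log_atTop.comp (tendsto_natCast_atTop_atTop (R := ℝ))
  obtain ⟨n₀, hn₀⟩ := eventually_atTop.1 ((hlog.eventually three_mul_log_add_le).and
    (log_le_pred_mul_exp.and ((hlog.eventually_ge_atTop 2).and (eventually_ge_atTop 2))))
  -- If `l ≤ log n / (2 * K' ^ 3)`, then a shrinking time `R` with `R * l ≥ log n / 2` is at least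
  -- `K' ^ 3`, so its cube root is at least `K'`.
  refine ⟨1 / (2 * (K' : ℝ) ^ 3), by positivity, n₀, fun n hn a b ha hab hl hl' => ?_⟩
  obtain ⟨h3, hpred, hL2, hn2⟩ := hn₀ n hn
  simp only [Function.comp] at h3 hL2
  have hb : 0 < b := by omega
  have hb' : (0 : ℝ) < b := by exact_mod_cast hb
  have ha' : (0 : ℝ) < a := by exact_mod_cast ha
  have hp0 : 0 < (a : ℝ) / b := by positivity
  have hp1 : (a : ℝ) / b < 1 := by rw [div_lt_one hb']; exact_mod_cast hab
  have hc : ((b - a : ℕ) : ℝ) / b = 1 - (a : ℝ) / b := by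
    rw [Nat.cast_sub hab.le]; field_simp
  have hε : 1 / (2 * (K' : ℝ) ^ 3) * log n ≤ log n / 2 := by
    rw [one_div, ← div_eq_inv_mul]
    exact div_le_div_of_nonneg_left (by linarith) (by norm_num) (by linarith)
  -- Here `x ≥ n ^ (-1/2)`, so `log (1 - x)⁻¹ ≥ x` is far above `log n / (n - 1)`. This ensures that
  -- the cap in `shrinkTime` is not reached.
  have key : ∀ x : ℝ, 0 < x → x < 1 → log x⁻¹ ≤ log n / 2 → log n ≤ (n - 1) * log (1 - x)⁻¹ := by
    intro x hx hx1 hlx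
    have h1 := one_sub_le_log_inv (sub_pos.2 hx1)
    rw [sub_sub_cancel] at h1
    refine hpred.trans (mul_le_mul_of_nonneg_left (le_trans ?_ h1) ?_)
    · rw [← log_le_log_iff (exp_pos _) hx, log_exp]
      rw [log_inv] at hlx
      linarith
    · rw [sub_nonneg]; exact_mod_cast (by omega : 1 ≤ n)
  have hbig := key (1 - a / b) (by linarith) (by linarith) (hl'.trans hε)
  rw [sub_sub_cancel] at hbig
  have hbig' := key (a / b) hp0 hp1 (hl.trans hε)
  obtain ⟨hR, hRu⟩ := shrinkTime_bounds ha hab (by omega) rfl hbig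
  obtain ⟨hR', hRu'⟩ := shrinkTime_bounds (n := n) (a := b - a) (b := b) (by omega) (by omega)
    (by omega) (by rw [hc]) hbig'
  have hlog2 : log 2 ≤ 1 := by have := log_two_lt_d9; linarith
  have size : ∀ (R : ℕ) (l : ℝ), log n - log 2 ≤ R * l →
      l ≤ 1 / (2 * (K' : ℝ) ^ 3) * log n → K' ^ 3 ≤ R := by
    intro R l h1 h2
    have h4 : log n / 2 ≤ R * (1 / (2 * (K' : ℝ) ^ 3) * log n) :=
      le_trans (by linarith) (mul_le_mul_of_nonneg_left h2 (by positivity))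
    have h5 : (R : ℝ) * (1 / (2 * (K' : ℝ) ^ 3) * log n) = R / (K' : ℝ) ^ 3 * (log n / 2) := by
      field_simp
    rw [h5] at h4
    have h6 : 1 ≤ R / (K' : ℝ) ^ 3 := by
      by_contra hlt
      rw [not_le] at hlt
      nlinarith
    rw [one_le_div (by positivity)] at h6
    exact_mod_cast h6
  have hs := size _ _ hR hl
  have hs' := size _ _ hR' hl'
  have hk : K' ≤ accuracy n a b := by
    by_contra hlt
    rw [not_le] at hlt
    have h1 := le_cubeRoot (min (shrinkTime n a b) (shrinkTime n (b - a) b))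
    have h2 : accuracy n a b ^ 3 < K' ^ 3 := Nat.pow_lt_pow_left hlt (by norm_num)
    have h4 : K' ^ 3 ≤ accuracy n a b ^ 3 := by
      refine (le_min hs hs').trans (h1.trans (le_of_eq ?_))
      rw [accuracy]; ring
    omega
  have hk32 : 32 ≤ accuracy n a b := by
    have : 32 ≤ K' := hK' ▸ le_max_right K 32
    omega
  have hpos : 0 < K' ^ 3 := by
    have : 0 < K' := by rw [hK']; omega
    positivity
  refine ⟨(hK' ▸ le_max_left K 32).trans hk, goodParams_of_bounds (by omega) hp0 hp1 rfl rfl rfl hk32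
    (R := shrinkTime n a b) (R' := shrinkTime n (b - a) b) (by exact_mod_cast hpos.trans_le hs)
    (by exact_mod_cast hpos.trans_le hs') hR hRu hR' hRu' ?_
    (leftSize_eq_floor hb hab.le (by omega)) (bicliqueSize_eq_floor hb hab.le (by omega)) h3⟩
  have h1 := cube_lt (m := min (shrinkTime n a b) (shrinkTime n (b - a) b))
    (k := accuracy n a b - 1) (by rw [← accuracy]; omega)
  rw [← Nat.cast_min, ← Nat.cast_one, ← Nat.cast_sub (by omega)]
  calc ((accuracy n a b - 1 : ℕ) : ℝ) ^ 3 = ((accuracy n a b - 1) * (accuracy n a b - 1) *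
      (accuracy n a b - 1) : ℕ) := by push_cast; ring
    _ ≤ _ := by exact_mod_cast h1.le

end Parameters

section Counting

/-! ## Counting neighbours -/

variable {n : ℕ} {G : SimpleGraph (Fin n)}

theorem natDegree_eq_degree [DecidableRel G.Adj] (i : Fin n) : natDegree G i = G.degree i := by
  have h := G.degree_eq_sum_if_adj (R := ℕ) i
  rw [natDegree_eq_sum, Finset.sum_range, ← Nat.cast_id (G.degree i), h]
  refine Finset.sum_congr rfl fun j _ => ?_
  unfold adjBit
  congr 1
  exact propext ⟨fun ⟨_, _, h⟩ => h, fun h => ⟨i.2, j.2, h⟩⟩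

theorem degreeSum_eq (G : SimpleGraph (Fin n)) :
    (degreeSum G : ℝ) = density G * n * ((n : ℝ) - 1) := by
  classical
  rcases Nat.lt_or_ge n 2 with hn | hn
  · have h := degreeSum_le (G := G)
    interval_cases n <;> simp_all [density]
  · have h1 : degreeSum G = 2 * G.edgeFinset.card := by
      rw [← G.sum_degrees_eq_twice_card_edges, degreeSum, Finset.sum_range]
      exact Finset.sum_congr rfl fun i _ => natDegree_eq_degree i
    have hn' : (2 : ℝ) ≤ n := by exact_mod_cast hn
    have h2 : G.edgeSet.ncard = G.edgeFinset.card := by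
      rw [Set.ncard_eq_toFinset_card', SimpleGraph.edgeFinset]
    rw [h1, density, h2, Nat.cast_choose_two]
    have h3 : (n : ℝ) - 1 ≠ 0 := by linarith
    push_cast
    field_simp

theorem sum_blocks (f : ℕ → ℝ) (r q : ℕ) :
    ∑ i ∈ Finset.range r, ∑ v ∈ Finset.range q, f (i * q + v) =
      ∑ v ∈ Finset.range (r * q), f v := by
  induction r with
  | zero => simp
  | succ r ih => rw [Finset.sum_range_succ, ih, Nat.succ_mul, Finset.sum_range_add]

theorem sum_blockMean (f : ℕ → ℝ) (r q : ℕ) :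
    ∑ i ∈ Finset.range r, blockMean q (fun _ => f) i =
      (∑ v ∈ Finset.range (r * q), f v) / q := by
  rw [← sum_blocks, Finset.sum_div]
  rfl

/-- For passing from all `n` vertices to those covered by full blocks. -/
theorem sum_range_sub_le {f : ℕ → ℝ} {c : ℝ} {m n : ℕ} (hmn : m ≤ n) (hf : ∀ v < n, f v ≤ c) :
    ∑ v ∈ Finset.range n, f v - (n - m : ℕ) * c ≤ ∑ v ∈ Finset.range m, f v := by
  obtain ⟨d, rfl⟩ := Nat.exists_eq_add_of_le hmn
  rw [Finset.sum_range_add, Nat.add_sub_cancel_left]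
  have : ∑ v ∈ Finset.range d, f (m + v) ≤ d * c := by
    refine (Finset.sum_le_card_nsmul _ _ c fun v hv => hf _ ?_).trans (by simp)
    have := Finset.mem_range.1 hv
    omega
  linarith

theorem sum_nbrCount (A : ℕ → ℕ) (r : ℕ) :
    ∑ v ∈ Finset.range n, nbrCount G A v r = ∑ i ∈ Finset.range r, natDegree G (A i) := by
  simp only [nbrCount, natDegree_eq_sum]
  exact Finset.sum_comm

theorem nbrCount_le (A : ℕ → ℕ) (v r : ℕ) : nbrCount G A v r ≤ r := by
  calc nbrCount G A v r ≤ ∑ j ∈ Finset.range r, 1 := Finset.sum_le_sum fun j _ => adjBit_le _ _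
    _ = r := by simp

/-- Many vertices have many neighbours among vertices of large total degree. -/
theorem sum_natDegree_le (A : ℕ → ℕ) (r t : ℕ) :
    ∑ i ∈ Finset.range r, natDegree G (A i) ≤
      n * t + r * ((Finset.range n).filter fun v => t ≤ nbrCount G A v r).card := by
  -- Double counting: a vertex with fewer than `t` neighbours contributes at most `t`, any other at
  -- most `r`.
  rw [← sum_nbrCount]
  calc ∑ v ∈ Finset.range n, nbrCount G A v r ≤
      ∑ v ∈ Finset.range n, (t + r * if t ≤ nbrCount G A v r then 1 else 0) := by
        refine Finset.sum_le_sum fun v _ => ?_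
        split
        · have := nbrCount_le (G := G) A v r
          omega
        · omega
    _ = _ := by
        rw [Finset.sum_add_distrib, ← Finset.mul_sum, Finset.card_filter]
        simp

/-- Choosing from disjoint blocks makes the chosen vertices distinct, so collisions of random
vertices need no analysis. -/
theorem injOn_of_blocks {A : ℕ → ℕ} {m q : ℕ} (hA : ∀ i < m, i * q ≤ A i ∧ A i < i * q + q) :
    Set.InjOn A (Set.Iio m) := by
  intro i hi j hj hij
  have h1 := hA i hi
  have h2 := hA j hj
  rw [hij] at h1
  have h3 : i < j + 1 := by
    by_contra h
    have := Nat.mul_le_mul_right q (not_lt.1 h)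
    rw [Nat.succ_mul] at this
    omega
  have h4 : j < i + 1 := by
    by_contra h
    have := Nat.mul_le_mul_right q (not_lt.1 h)
    rw [Nat.succ_mul] at this
    omega
  omega

theorem density_nonneg : 0 ≤ density G := by unfold density; positivity

end Counting

section Entropy

/-! ## Perturbing the density -/

open Real

/-- Gibbs' inequality, from `log y ≤ y - 1`. -/
theorem binEntropy_le_cross {x p : ℝ} (hx0 : 0 < x) (hx1 : x < 1) (hp0 : 0 < p) (hp1 : p < 1) :
    binEntropy x ≤ x * log p⁻¹ + (1 - x) * log (1 - p)⁻¹ := by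
  have h1 : x * log (p / x) ≤ x * (p / x - 1) :=
    mul_le_mul_of_nonneg_left (log_le_sub_one_of_pos (by positivity)) hx0.le
  have hp : 0 < 1 - p := by linarith
  have hx : 0 < 1 - x := by linarith
  have h2 : (1 - x) * log ((1 - p) / (1 - x)) ≤ (1 - x) * ((1 - p) / (1 - x) - 1) :=
    mul_le_mul_of_nonneg_left (log_le_sub_one_of_pos (by positivity)) hx.le
  have h3 : x * (p / x - 1) = p - x := by field_simp
  have h4 : (1 - x) * ((1 - p) / (1 - x) - 1) = x - p := by field_simp; ring
  rw [log_div hp0.ne' hx0.ne'] at h1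
  rw [log_div hp.ne' hx.ne'] at h2
  rw [binEntropy, log_inv, log_inv, log_inv, log_inv]
  linarith

/-- Densities that agree up to a factor, together with their complements, have entropies that agree
up to the same factor; no derivative of the entropy is needed. -/
theorem binEntropy_le_mul {x p c : ℝ} (hx0 : 0 < x) (hx1 : x < 1) (hp0 : 0 < p) (hp1 : p < 1)
    (h : x ≤ c * p) (h' : 1 - x ≤ c * (1 - p)) : binEntropy x ≤ c * binEntropy p := by
  have h1 : 0 ≤ log p⁻¹ := (sub_nonneg.2 hp1.le).trans (one_sub_le_log_inv hp0)
  have h2 : 0 ≤ log (1 - p)⁻¹ := by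
    have := one_sub_le_log_inv (sub_pos.2 hp1)
    linarith
  refine (binEntropy_le_cross hx0 hx1 hp0 hp1).trans ?_
  rw [binEntropy]
  have h3 := mul_le_mul_of_nonneg_right h h1
  have h4 := mul_le_mul_of_nonneg_right h' h2
  linarith

end Entropy

section Search

/-! ## When the search succeeds -/

open Real

variable {n : ℕ} {G : SimpleGraph (Fin n)} {p κ γ : ℝ} {k r t q : ℕ}

namespace GoodParams

theorem choose_le' (h : GoodParams n p k r t) (hk : 1 ≤ k) (hκ : κ = p * (1 - p) / (8 * k)) :
    ((t * r.choose t : ℕ) : ℝ) ≤ n * κ / (2 * (r + 1)) := by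
  have hk0 : (0 : ℝ) < k := by exact_mod_cast hk
  refine h.choose_le.trans (le_of_eq ?_)
  rw [hκ]
  field_simp
  ring

theorem mul_left_le (h : GoodParams n p k r t) (hk : 1 ≤ k) (hκ : κ = p * (1 - p) / (8 * k)) :
    (k : ℝ) * (2 * (r + 1)) ≤ n * κ := by
  have h1 := h.choose_le' hk hκ
  rw [le_div_iff₀ (by positivity)] at h1
  refine le_trans (mul_le_mul_of_nonneg_right ?_ (by positivity)) h1
  exact_mod_cast h.k_le.trans (Nat.le_mul_of_pos_right _ (Nat.choose_pos h.t_le))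

theorem left_le (h : GoodParams n p k r t) (hk : 1 ≤ k) (hκ : κ = p * (1 - p) / (8 * k)) :
    2 * ((r : ℝ) + 1) ≤ n * κ := by
  have h1 := h.mul_left_le hk hκ
  have hk0 : (1 : ℝ) ≤ k := by exact_mod_cast hk
  nlinarith

theorem kappa_le (hk : 1 ≤ k) (hκ : κ = p * (1 - p) / (8 * k)) (hp0 : 0 < p) (hp1 : p < 1) :
    0 < κ ∧ 8 * κ ≤ p ∧ 8 * κ ≤ 1 - p := by
  have hk0 : (1 : ℝ) ≤ k := by exact_mod_cast hk
  have hq0 : 0 < 1 - p := by linarith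
  have h1 : 8 * κ = p * (1 - p) / k := by rw [hκ]; field_simp
  have h2 : p * (1 - p) / k ≤ p * (1 - p) := div_le_self (by positivity) hk0
  refine ⟨by rw [hκ]; positivity, ?_, ?_⟩ <;> rw [h1] <;> nlinarith

theorem one_le_left (h : GoodParams n p k r t) (hk : 1 ≤ k) : 1 ≤ r :=
  hk.trans (h.k_le.trans h.t_le)

theorem left_le_card (h : GoodParams n p k r t) (hk : 1 ≤ k) (hp0 : 0 < p) (hp1 : p < 1) :
    r ≤ n := by
  have h1 := h.left_le hk rfl
  obtain ⟨h2, h3, h4⟩ := kappa_le hk rfl hp0 hp1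
  have h5 : (n : ℝ) * (p * (1 - p) / (8 * k)) ≤ n := mul_le_of_le_one_right (by positivity)
    (by linarith)
  have : (r : ℝ) ≤ n := by linarith
  exact_mod_cast this

/-- With `κ = p * (1 - p) / (8 * k)` the size satisfies `t ≤ r * (p - 8 * κ)`, so vertices with
fewer than `t` neighbours account for at most `r * n * (p - 8 * κ)` of the total degree. The
remaining `4 * κ * r * n` needs `4 * κ * n` further vertices, each contributing at most `r`. -/
theorem card_le (h : GoodParams n p k r t) (hk : 1 ≤ k) (hκ : κ = p * (1 - p) / (8 * k))
    (A : ℕ → ℕ)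
    (hA : r * n * (p - 4 * κ) ≤ ((∑ i ∈ Finset.range r, natDegree G (A i) : ℕ) : ℝ)) :
    4 * κ * n ≤ ((Finset.range n).filter fun v => t ≤ nbrCount G A v r).card := by
  have hk0 : (0 : ℝ) < k := by exact_mod_cast hk
  have hr0 : (0 : ℝ) < r := by exact_mod_cast h.one_le_left hk
  have h1 : ((∑ i ∈ Finset.range r, natDegree G (A i) : ℕ) : ℝ) ≤
      n * t + r * ((Finset.range n).filter fun v => t ≤ nbrCount G A v r).card := by
    exact_mod_cast sum_natDegree_le A r t
  have h2 : (n : ℝ) * t ≤ n * (p * r * (1 - (1 - p) / k)) :=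
    mul_le_mul_of_nonneg_left h.t_le_mul (by positivity)
  have h3 : (n : ℝ) * (p * r * (1 - (1 - p) / k)) = r * (n * (p - 8 * κ)) := by
    rw [hκ]; field_simp
  refine le_of_mul_le_mul_left ?_ hr0
  linarith

/-- The loss `2 * κ` covers the error of the estimate, the fewer than `r` vertices outside the
blocks, and the factor `n - 1` in place of `n` in the degree sum; the last two are small because `2
* (r + 1) ≤ n * κ`. -/
theorem sum_blockMean_bounds (h : GoodParams n p k r t) (hk : 1 ≤ k)
    (hκ : κ = p * (1 - p) / (8 * k)) (hp0 : 0 < p) (hp1 : p < 1) (hq : n / r = q)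
    (hγ : |p - density G| ≤ κ) :
    1 ≤ q ∧ r * (p - 2 * κ) ≤
        ∑ i ∈ Finset.range r, blockMean q (fun _ v => (natDegree G v : ℝ) / n) i ∧
      ∑ i ∈ Finset.range r, blockMean q (fun _ v => (natDegree G v : ℝ) / n) i ≤ 4 * r * p := by
  obtain ⟨hκ0, hκp, hκq⟩ := kappa_le hk hκ hp0 hp1
  have hr := h.one_le_left hk
  have hrn := h.left_le_card hk hp0 hp1
  have hq1 : 1 ≤ q := by rw [← hq]; exact Nat.div_pos hrn hr
  have hq0 : (0 : ℝ) < q := by exact_mod_cast hq1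
  have hr0 : (0 : ℝ) < r := by exact_mod_cast hr
  have hn0 : (0 : ℝ) < n := by exact_mod_cast hr.trans hrn
  have hrq : r * q ≤ n := by rw [← hq]; exact Nat.mul_div_le n r
  have hrq' : (r : ℝ) * q ≤ n := by exact_mod_cast hrq
  have hnq : n < r * q + r := by
    rw [← hq]; exact Nat.lt_mul_div_succ n hr
  have hnq' : (n : ℝ) ≤ r * q + r := by exact_mod_cast hnq.le
  have hdeg : ∑ v ∈ Finset.range n, (natDegree G v : ℝ) / n = density G * (n - 1) := by
    rw [← Finset.sum_div, ← Nat.cast_sum]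
    change (degreeSum G : ℝ) / n = _
    rw [degreeSum_eq]
    field_simp
  have hdeg0 : ∀ v, 0 ≤ (natDegree G v : ℝ) / n := fun v => by positivity
  have hdeg1 : ∀ v, (natDegree G v : ℝ) / n ≤ 1 := fun v => by
    rw [div_le_one hn0]; exact_mod_cast natDegree_le v
  rw [abs_le] at hγ
  have hγ0 := density_nonneg (G := G)
  refine ⟨hq1, ?_, ?_⟩
  · rw [sum_blockMean, le_div_iff₀ hq0]
    have h1 := sum_range_sub_le (f := fun v => (natDegree G v : ℝ) / n) hrq fun v _ => hdeg1 v
    have h2 : ((n - r * q : ℕ) : ℝ) ≤ r := by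
      have : n - r * q ≤ r := by omega
      exact_mod_cast this
    rw [hdeg] at h1
    have h3 := h.left_le hk hκ
    have h4 : (p - 2 * κ) * (r * q) ≤ (p - 2 * κ) * n :=
      mul_le_mul_of_nonneg_left hrq' (by linarith)
    have h5 : (p - κ) * n ≤ density G * n := mul_le_mul_of_nonneg_right (by linarith) hn0.le
    linarith
  · rw [sum_blockMean, div_le_iff₀ hq0]
    have h1 : ∑ v ∈ Finset.range (r * q), (natDegree G v : ℝ) / n ≤
        ∑ v ∈ Finset.range n, (natDegree G v : ℝ) / n :=
      Finset.sum_le_sum_of_subset_of_nonneg (Finset.range_mono hrq) fun v _ _ => hdeg0 v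
    rw [hdeg] at h1
    have h2 : density G * n ≤ 2 * p * n := mul_le_mul_of_nonneg_right (by linarith) hn0.le
    have h3 : (r : ℝ) ≤ r * q := le_mul_of_one_le_right hr0.le (by exact_mod_cast hq1)
    have h4 : 2 * p * n ≤ 2 * p * (2 * (r * q)) :=
      mul_le_mul_of_nonneg_left (by linarith) (by positivity)
    linarith

/-- The maximal degree in a block is at least the mean degree of the block, so the chosen vertices
have at least the expected total degree of a random choice. -/
theorem forced_of_max (h : GoodParams n p k r t) (hk : 1 ≤ k) (hp0 : 0 < p) (hp1 : p < 1)
    (hq : n / r = q) (hγ : p = density G) {A B : ℕ → ℕ}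
    (hA : ∀ i < r, i * q ≤ A i ∧ A i < i * q + max q 1 ∧
      ∀ v, i * q ≤ v → v < i * q + q → natDegree G v ≤ natDegree G (A i))
    (hB : ∀ j < n, B j = j) : Forced G A B r n t := by
  obtain ⟨κ, hκ⟩ : ∃ κ, κ = p * (1 - p) / (8 * k) := ⟨_, rfl⟩
  obtain ⟨hκ0, hκp, hκq⟩ := kappa_le hk hκ hp0 hp1
  obtain ⟨hq1, hlow, -⟩ := h.sum_blockMean_bounds (G := G) hk hκ hp0 hp1 hq (by simp [hγ, hκ0.le])
  have hq0 : (0 : ℝ) < q := by exact_mod_cast hq1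
  have hr := h.one_le_left hk
  have hr0 : (1 : ℝ) ≤ r := by exact_mod_cast hr
  have hrn := h.left_le_card hk hp0 hp1
  have hn0 : (0 : ℝ) < n := by exact_mod_cast hr.trans hrn
  refine ⟨hk.trans h.k_le, h.t_le, injOn_of_blocks (q := q) fun i hi => ?_, fun i hi j hj hij => ?_,
    ?_⟩
  · have := hA i hi
    rw [max_eq_left hq1] at this
    exact ⟨this.1, this.2.1⟩
  · rwa [hB i hi, hB j hj] at hij
  · have h1 : ∑ i ∈ Finset.range r, blockMean q (fun _ v => (natDegree G v : ℝ) / n) i ≤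
        ∑ i ∈ Finset.range r, (natDegree G (A i) : ℝ) / n := by
      refine Finset.sum_le_sum fun i hi => ?_
      have hi := hA i (Finset.mem_range.1 hi)
      rw [blockMean, div_le_iff₀ hq0]
      refine (Finset.sum_le_card_nsmul _ _ ((natDegree G (A i) : ℝ) / n) fun v hv => ?_).trans
        (by rw [Finset.card_range, nsmul_eq_mul, mul_comm])
      have hv := Finset.mem_range.1 hv
      have := hi.2.2 (i * q + v) (by omega) (by omega)
      gcongr
    have h2 : r * n * (p - 4 * κ) ≤ ((∑ i ∈ Finset.range r, natDegree G (A i) : ℕ) : ℝ) := by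
      rw [← Finset.sum_div, le_div_iff₀ hn0] at h1
      push_cast
      have h3 := mul_le_mul_of_nonneg_right hlow hn0.le
      have h4 : 0 ≤ r * n * κ := by positivity
      linarith
    have h3 := h.card_le hk hκ A h2
    have h4 := h.choose_le' hk hκ
    have h5 : (n : ℝ) * κ / (2 * (r + 1)) ≤ n * κ := div_le_self (by positivity) (by linarith)
    have h6 : 0 ≤ κ * n := by positivity
    have h7 : ((t * r.choose t : ℕ) : ℝ) ≤
        ((Finset.range n).filter fun v => t ≤ nbrCount G A v r).card := by linarith
    refine (Nat.cast_le.1 h7).trans (le_of_eq ?_)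
    congr 1
    refine Finset.filter_congr fun j hj => ?_
    rw [hB j (Finset.mem_range.1 hj)]

/-- For random vertices on both sides, the search is likely to succeed. -/
theorem avgFill_forced (h : GoodParams n p k r t) (hk : 1 ≤ k) (hp0 : 0 < p) (hp1 : p < 1)
    (hq : n / r = q) (hγ : |p - density G| ≤ p * (1 - p) / (8 * k)) {arr arr' : ℕ → ℕ}
    {F : (ℕ → ℕ) → (ℕ → ℕ) → ℝ} (hF0 : ∀ A B, 0 ≤ F A B)
    (hF : ∀ A B, Forced G A B r q t → 1 ≤ F A B) :
    1 - 19201 / k ≤ avgFill q r 0 arr fun A => avgFill r q 0 arr' fun B => F A B := by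
  obtain ⟨κ, hκ⟩ : ∃ κ, κ = p * (1 - p) / (8 * k) := ⟨_, rfl⟩
  rw [← hκ] at hγ
  obtain ⟨hκ0, hκp, hκq⟩ := kappa_le hk hκ hp0 hp1
  obtain ⟨hq1, hlow, hup⟩ := h.sum_blockMean_bounds (G := G) hk hκ hp0 hp1 hq hγ
  have hk0 : (0 : ℝ) < k := by exact_mod_cast hk
  have hr := h.one_le_left hk
  have hr0 : (0 : ℝ) < r := by exact_mod_cast hr
  have hrn := h.left_le_card hk hp0 hp1
  have hn0 : (0 : ℝ) < n := by exact_mod_cast hr.trans hrn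
  have hq0 : 0 < 1 - p := by linarith
  have hqr : q * r ≤ n := by rw [← hq]; exact Nat.div_mul_le_self n r
  have hnq : n < q * r + r := by
    rw [← hq, mul_comm]; exact Nat.lt_mul_div_succ n hr
  have hsplit : (1 : ℝ) - 19201 / k = 1 - 1 / k - 19200 / k := by ring
  rw [hsplit]
  have hk1 : 1 / (k : ℝ) ≥ 0 := by positivity
  -- Left side: the deviation allowed is `2 * κ * r` and the variance at most `6 * r * (p * (1 -
  -- p))`. The quotient is `96 * k ^ 2 / (r * (p * (1 - p)))`, at most `19200 / k` by `cube_le`.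
  refine le_trans (sub_le_sub_left (?_ : 6 * r * (p * (1 - p)) / (2 * κ * r) ^ 2 ≤ _) _)
    (avgFill_chebyshev (α := 1 - 1 / k) hq1 (fun _ v => (natDegree G v : ℝ) / n)
    (by positivity : 0 < 2 * κ * r) (by linarith) ?_ ?_ ?_)
  · have h1 := h.cube_le
    have h2 : 6 * r * (p * (1 - p)) / (2 * κ * r) ^ 2 = 96 * k ^ 2 / (r * (p * (1 - p))) := by
      rw [hκ]; field_simp; norm_num
    rw [h2, div_le_div_iff₀ (by positivity) hk0]
    calc 96 * (k : ℝ) ^ 2 * k = 19200 * (k ^ 3 / 200) := by ring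
      _ ≤ _ := by gcongr
  · have h1 : ∀ j ∈ Finset.range r, (∑ v ∈ Finset.range q, ((natDegree G (j * q + v) : ℝ) / n -
        blockMean q (fun _ v => (natDegree G v : ℝ) / n) j) ^ 2) / q ≤
        (1 - 2 * p) * blockMean q (fun _ v => (natDegree G v : ℝ) / n) j + p := by
      intro j _
      refine (block_variance_le hq1 (fun v => (natDegree G (j * q + v) : ℝ) / n)
        (fun v _ => by positivity) (fun v _ => ?_) rfl hp0.le hp1.le).trans (le_of_eq ?_)
      · rw [div_le_one hn0]; exact_mod_cast natDegree_le _
      · rw [blockMean]; ring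
    refine (Finset.sum_le_sum h1).trans ?_
    rw [Finset.sum_add_distrib, ← Finset.mul_sum, Finset.sum_const, Finset.card_range,
      nsmul_eq_mul]
    obtain ⟨M, hM⟩ : ∃ M, M = ∑ i ∈ Finset.range r,
      blockMean q (fun _ v => (natDegree G v : ℝ) / n) i := ⟨_, rfl⟩
    rw [← hM] at hlow hup ⊢
    -- The summed variance bound is rewritten as `(1 - p) * M + p * (r - M)`; the two parts
    -- contribute `4` and `2` times `r * (p * (1 - p))`.
    have h2 : (1 - p) * M ≤ (1 - p) * (4 * r * p) := mul_le_mul_of_nonneg_left hup hq0.le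
    have h3 : p * (r - M) ≤ p * (r * (2 * (1 - p))) := by
      refine mul_le_mul_of_nonneg_left ?_ hp0.le
      have h4 : (r : ℝ) * (1 - p + 2 * κ) ≤ r * (2 * (1 - p)) :=
        mul_le_mul_of_nonneg_left (by linarith) hr0.le
      linarith
    linarith
  · exact fun A _ => avgFill_ge fun B _ => hF0 A B
  intro A hA hdev
  have hinjA : Set.InjOn A (Set.Iio r) := injOn_of_blocks (q := q) fun i hi => by
    have := hA.1 i (by omega) (by omega)
    rwa [max_eq_left hq1] at this
  have hcard : 4 * κ * n ≤ ((Finset.range n).filter fun v => t ≤ nbrCount G A v r).card := by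
    refine h.card_le hk hκ A ?_
    have h1 := (abs_lt.1 hdev).1
    rw [← Finset.sum_div] at h1
    have h2 : r * (p - 4 * κ) ≤ (∑ i ∈ Finset.range r, (natDegree G (A i) : ℝ)) / n := by
      linarith
    rw [le_div_iff₀ hn0] at h2
    push_cast
    linarith
  obtain ⟨f, hf⟩ : ∃ f : ℕ → ℝ, f = fun v => if t ≤ nbrCount G A v r then 1 else 0 := ⟨_, rfl⟩
  have hf0 : ∀ v, 0 ≤ f v := fun v => by rw [hf]; dsimp only; split <;> norm_num
  have hf1 : ∀ v, f v ≤ 1 := fun v => by rw [hf]; dsimp only; split <;> norm_num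
  have hlr := h.left_le hk hκ
  obtain ⟨M, hM⟩ : ∃ M, M = ∑ j ∈ Finset.range q, blockMean r (fun _ => f) j := ⟨_, rfl⟩
  have hMlow : 3 * κ * n / r ≤ M := by
    rw [hM, sum_blockMean]
    refine div_le_div_of_nonneg_right ?_ hr0.le
    have h1 := sum_range_sub_le (f := f) hqr fun v _ => hf1 v
    have h2 : ∑ v ∈ Finset.range n, f v =
        ((Finset.range n).filter fun v => t ≤ nbrCount G A v r).card := by
      rw [hf, Finset.card_filter]; push_cast; rfl
    have h3 : ((n - q * r : ℕ) : ℝ) ≤ r := by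
      have : n - q * r ≤ r := by omega
      exact_mod_cast this
    have h4 : 0 ≤ n * κ := by positivity
    linarith
  have hM0 : 0 < M := lt_of_lt_of_le (by positivity) hMlow
  -- Right side: the expected number `M` of good vertices bounds the variance, so falling below `M /
  -- 2` has probability at most `4 / M ≤ 1 / k`. Half of `M` still suffices for the pigeonhole
  -- argument.
  refine le_trans (sub_le_sub_left (?_ : M / (M / 2) ^ 2 ≤ _) _)
    (avgFill_chebyshev (α := 1) hr (fun _ => f) (half_pos hM0) le_rfl ?_ (fun B _ => hF0 A B) ?_)
  · have h1 : M / (M / 2) ^ 2 = 4 / M := by field_simp; norm_num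
    rw [h1, div_le_div_iff₀ hM0 hk0]
    have h2 := h.mul_left_le hk hκ
    have h3 : 4 * k ≤ 3 * κ * n / r := by
      rw [le_div_iff₀ hr0]
      have : 0 ≤ (k : ℝ) * r := by positivity
      linarith
    linarith
  · rw [hM]
    refine Finset.sum_le_sum fun j _ => ?_
    refine (block_variance_le hr (fun v => f (j * r + v)) (fun v _ => hf0 _) (fun v _ => hf1 _)
      rfl le_rfl zero_le_one).trans (le_of_eq ?_)
    rw [blockMean]; ring
  · intro B hB hdev
    refine hF A B ⟨hk.trans h.k_le, h.t_le, hinjA, injOn_of_blocks (q := r) fun i hi => ?_, ?_⟩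
    · have := hB.1 i (by omega) (by omega)
      rwa [max_eq_left hr] at this
    · rw [← hM] at hdev
      have h1 := (abs_lt.1 hdev).1
      have h2 : ∑ j ∈ Finset.range q, f (B j) =
          ((Finset.range q).filter fun j => t ≤ nbrCount G A (B j) r).card := by
        rw [hf, Finset.card_filter]; push_cast; rfl
      have h3 := h.choose_le' hk hκ
      have h4 : n * κ / (2 * ((r : ℝ) + 1)) ≤ 3 * κ * n / r / 2 := by
        rw [div_div, div_le_div_iff₀ (by positivity) (by positivity)]
        have h5 : 0 ≤ n * κ := by positivity
        have h6 : 0 ≤ n * κ * r := by positivity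
        linarith
      have h7 : ((t * r.choose t : ℕ) : ℝ) ≤
        ((Finset.range q).filter fun j => t ≤ nbrCount G A (B j) r).card := by linarith
      exact_mod_cast h7

end GoodParams

end Search

/-! ### Comparison with the target size and the time bound; choice of vanishing errors -/

section Target

open Real

variable {n : ℕ} {G : SimpleGraph (Fin n)}

theorem h2_eq (x : ℝ) : h2 x = binEntropy x / log 2 := by
  rw [h2, binEntropy, logb, logb, log_inv, log_inv]
  ring

theorem targetSize_eq (G : SimpleGraph (Fin n)) :
    targetSize G = density G * log n / binEntropy (density G) := by
  have h : log 2 ≠ 0 := (log_pos one_lt_two).ne'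
  rw [targetSize, h2_eq, logb]
  field_simp

theorem timeBound_eq (C : ℝ) (G : SimpleGraph (Fin n)) :
    timeBound C G = C * (n * (log n / binEntropy (density G))) := by
  have h : log 2 ≠ 0 := (log_pos one_lt_two).ne'
  rw [timeBound, h2_eq, logb]
  field_simp

/-- The effect of a small change of the density on the entropy. -/
theorem binEntropy_bounds {p γ x : ℝ} (hx0 : 0 ≤ x) (hx1 : x ≤ 1 / 4) (hp0 : 0 < p) (hp1 : p < 1)
    (hγ0 : 0 < γ) (hγ1 : γ < 1) (h : |p - γ| ≤ p * (1 - p) * x) :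
    (γ ≤ (1 + 2 * x) * p ∧ p ≤ (1 + 2 * x) * γ) ∧
      binEntropy γ ≤ (1 + 2 * x) * binEntropy p ∧ binEntropy p ≤ (1 + 2 * x) * binEntropy γ := by
  obtain ⟨h1, h2⟩ := abs_le.1 h
  have hq0 : 0 < 1 - p := by linarith
  have e1 : p * (1 - p) * x ≤ p * x := by nlinarith [mul_nonneg hp0.le hx0]
  have e2 : p * (1 - p) * x ≤ (1 - p) * x := by nlinarith [mul_nonneg hq0.le hx0]
  have e3 : 0 ≤ p * x := by positivity
  have e4 : 0 ≤ (1 - p) * x := by positivity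
  have a1 : γ ≤ (1 + 2 * x) * p := by linarith
  have a2 : 1 - γ ≤ (1 + 2 * x) * (1 - p) := by linarith
  -- This uses `(1 + 2 * x) * (1 - x) ≥ 1`, valid for `0 ≤ x ≤ 1 / 2`.
  have e5 : p ≤ (1 + 2 * x) * ((1 - x) * p) := by
    have : 0 ≤ p * x * (1 - 2 * x) := mul_nonneg e3 (by linarith)
    linarith
  have e6 : 1 - p ≤ (1 + 2 * x) * ((1 - x) * (1 - p)) := by
    have : 0 ≤ (1 - p) * x * (1 - 2 * x) := mul_nonneg e4 (by linarith)
    linarith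
  have a3 : p ≤ (1 + 2 * x) * γ :=
    e5.trans (mul_le_mul_of_nonneg_left (by linarith) (by linarith))
  have a4 : 1 - p ≤ (1 + 2 * x) * (1 - γ) :=
    e6.trans (mul_le_mul_of_nonneg_left (by linarith) (by linarith))
  exact ⟨⟨a1, a3⟩, binEntropy_le_mul hγ0 hγ1 hp0 hp1 a1 a2, binEntropy_le_mul hp0 hp1 hγ0 hγ1 a3 a4⟩

theorem ratio_le_mul {a b H H' L c : ℝ} (hL : 0 ≤ L) (hH : 0 < H) (hH' : 0 < H') (hb : 0 ≤ b)
    (hc : 1 ≤ c) (ha : a ≤ c * b) (hHH : H' ≤ c * H) :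
    a * L / H ≤ c ^ 2 * (b * L / H') := by
  rw [mul_div_assoc', div_le_div_iff₀ hH hH']
  calc a * L * H' ≤ (c * b) * L * (c * H) := by gcongr
    _ = c ^ 2 * (b * L) * H := by ring

namespace GoodParams

variable {p : ℝ} {k r t : ℕ}

/-- Parameters that are good for an estimated density are good for the density. -/
theorem abs_sub_le (h : GoodParams n p k r t) (hk : 8 ≤ k) (hp0 : 0 < p) (hp1 : p < 1)
    (hγ0 : 0 < density G) (hγ1 : density G < 1)
    (hγ : |p - density G| ≤ p * (1 - p) / (8 * k)) :
    |(t : ℝ) - targetSize G| ≤ 8 / k * targetSize G ∧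
      (r : ℝ) ≤ 2 * (log n / binEntropy (density G)) := by
  have hk' : (8 : ℝ) ≤ k := by exact_mod_cast hk
  have hk0 : (0 : ℝ) < k := by linarith
  have hk8 : 1 / (k : ℝ) ≤ 1 / 8 := one_div_le_one_div_of_le (by norm_num) hk'
  have hk1 : 0 < 1 / (k : ℝ) := by positivity
  obtain ⟨y, hy⟩ : ∃ y, y = 1 / (k : ℝ) := ⟨_, rfl⟩
  have hx : p * (1 - p) / (8 * k) = p * (1 - p) * (y / 8) := by rw [hy]; field_simp
  rw [← hy] at hk8 hk1
  rw [hx] at hγ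
  obtain ⟨⟨a1, a2⟩, b1, b2⟩ := binEntropy_bounds (by linarith) (by linarith) hp0 hp1 hγ0 hγ1 hγ
  have hH := binEntropy_pos hp0 hp1
  have hH' := binEntropy_pos hγ0 hγ1
  have hL : 0 ≤ log n := log_natCast_nonneg n
  have hc : (1 + 2 * (y / 8)) ^ 2 ≤ 1 + y := by nlinarith
  have h1 := ratio_le_mul hL hH hH' hγ0.le (by linarith) a2 b1
  have h2 := ratio_le_mul hL hH' hH hp0.le (by linarith) a1 b2
  have hlow := h.lower
  have hup := h.upper
  rw [show (8 : ℝ) / k = 8 * y by rw [hy]; ring, targetSize_eq]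
  rw [show (7 : ℝ) / k = 7 * y by rw [hy]; ring] at hlow
  have hT0 : 0 ≤ density G * log n / binEntropy (density G) := by positivity
  have hT0' : 0 ≤ p * log n / binEntropy p := by positivity
  constructor
  · obtain ⟨T, hT⟩ : ∃ T, T = p * log n / binEntropy p := ⟨_, rfl⟩
    obtain ⟨T', hT'⟩ : ∃ T', T' = density G * log n / binEntropy (density G) := ⟨_, rfl⟩
    rw [← hT] at h1 h2 hlow hup hT0'
    rw [← hT'] at h1 h2 hT0 ⊢
    -- Exchanging the estimated and the true density changes the target by a factor of at most `1 +
    -- 1 / k`, which turns the relative error `7 / k` into `8 / k`.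
    have h3 : T ≤ (1 + y) * T' := h1.trans (mul_le_mul_of_nonneg_right hc hT0)
    have h4 : T' ≤ (1 + y) * T := h2.trans (mul_le_mul_of_nonneg_right hc hT0')
    rw [abs_le]
    have h5 : 0 ≤ y * T' := mul_nonneg hk1.le hT0
    have h6 : (1 - 8 * y) * T' ≤ (1 - 8 * y) * ((1 + y) * T) :=
      mul_le_mul_of_nonneg_left h4 (by linarith)
    have h7 : 0 ≤ y * y * T := by positivity
    constructor <;> linarith
  · refine h.r_le.trans ?_
    have h3 := ratio_le_mul (a := 1) (b := 1) hL hH hH' zero_le_one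
      (by linarith : 1 ≤ 1 + 2 * (y / 8)) (by linarith) b1
    rw [one_mul] at h3
    refine h3.trans (mul_le_mul_of_nonneg_right (hc.trans (by linarith)) (by positivity))

end GoodParams

theorem log_inv_le_of_near {p γ : ℝ} (hγ : 0 < γ) (h : γ / 2 ≤ p) :
    log p⁻¹ ≤ log γ⁻¹ + log 2 := by
  rw [← log_mul (by positivity) (by norm_num)]
  have hp : 0 < p := by linarith
  refine log_le_log (by positivity) ?_
  rw [inv_mul_eq_div, inv_eq_one_div, div_le_div_iff₀ hp hγ]
  linarith

theorem DensityBounded.log_inv_le {e : ℝ} (hn : 1 ≤ n) (h : DensityBounded G e) :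
    log (density G)⁻¹ ≤ e * log n ∧ log (1 - density G)⁻¹ ≤ e * log n := by
  have hn' : (0 : ℝ) < n := by exact_mod_cast hn
  obtain ⟨h0, h1, h2⟩ := h
  have hq : 0 < 1 - density G := by linarith
  rw [← log_rpow hn']
  exact ⟨log_le_log (by positivity) ((le_max_left _ _).trans h2),
    log_le_log (by positivity) ((le_max_right _ _).trans h2)⟩

/-- By `γ * (1 - γ) ≤ H`, the density hypothesis bounds `1 / H` by two factors `n ^ (ε / 3)`; the
third absorbs `C * log n`. -/
theorem timeBound_le {C ε e : ℝ} (he : e ≤ ε / 3) (hn : 1 ≤ n)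
    (hC : C * log n ≤ (n : ℝ) ^ (ε / 3)) (h : DensityBounded G e) :
    timeBound C G ≤ (n : ℝ) ^ (1 + ε) := by
  have hn' : (0 : ℝ) < n := by exact_mod_cast hn
  have hn1 : (1 : ℝ) ≤ n := by exact_mod_cast hn
  obtain ⟨h0, h1, h2⟩ := h
  obtain ⟨γ, hγ⟩ : ∃ γ, γ = density G := ⟨_, rfl⟩
  rw [timeBound_eq, ← hγ]
  rw [← hγ] at h0 h1 h2
  have hq : 0 < 1 - γ := by linarith
  have hH := binEntropy_pos h0 h1
  have h3 : γ * (1 - γ) ≤ binEntropy γ := by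
    have h4 := mul_le_mul_of_nonneg_left (one_sub_le_log_inv h0) h0.le
    have h5 := one_sub_le_log_inv hq
    have h6 : 0 ≤ (1 - γ) * log (1 - γ)⁻¹ := mul_nonneg hq.le (by linarith)
    rw [binEntropy]
    linarith
  have h4 : (n : ℝ) ^ e ≤ (n : ℝ) ^ (ε / 3) := rpow_le_rpow_of_exponent_le hn1 he
  have h5 : (binEntropy γ)⁻¹ ≤ (n : ℝ) ^ (ε / 3) * (n : ℝ) ^ (ε / 3) := by
    calc (binEntropy γ)⁻¹ ≤ (γ * (1 - γ))⁻¹ := inv_anti₀ (by positivity) h3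
      _ = γ⁻¹ * (1 - γ)⁻¹ := mul_inv _ _
      _ ≤ (n : ℝ) ^ (ε / 3) * (n : ℝ) ^ (ε / 3) :=
        mul_le_mul (((le_max_left _ _).trans h2).trans h4) (((le_max_right _ _).trans h2).trans h4)
          (by positivity) (by positivity)
  calc C * (n * (log n / binEntropy γ)) = n * (C * log n * (binEntropy γ)⁻¹) := by ring
    _ ≤ n * ((n : ℝ) ^ (ε / 3) * ((n : ℝ) ^ (ε / 3) * (n : ℝ) ^ (ε / 3))) := by gcongr
    _ = (n : ℝ) ^ (1 + ε) := by
      rw [show 1 + ε = 1 + (ε / 3 + (ε / 3 + ε / 3)) by ring, rpow_add hn', rpow_one,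
        rpow_add hn', rpow_add hn']

theorem eventually_mul_log_le (C : ℝ) {e : ℝ} (he : 0 < e) :
    ∀ᶠ n : ℕ in atTop, C * log n ≤ (n : ℝ) ^ e := by
  have h := ((isLittleO_log_rpow_atTop he).const_mul_left C).bound one_pos
  filter_upwards [tendsto_natCast_atTop_atTop.eventually h] with n hn
  rw [one_mul, norm_of_nonneg (rpow_nonneg (Nat.cast_nonneg n) e)] at hn
  exact (le_abs_self _).trans hn

/-- The word-length constant `20` arises from `n + 2 ≤ (n + 1) ^ 2` and the exponent `10`. -/
theorem pow_le_two_pow {w : ℕ} (hn : 1 ≤ n) (hw : 20 * Nat.size n ≤ w) :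
    (n + 2) ^ 10 ≤ 2 ^ w := by
  have h1 : n + 1 ≤ 2 ^ Nat.size n := Nat.lt_size_self n
  calc (n + 2) ^ 10 ≤ ((n + 1) ^ 2) ^ 10 := Nat.pow_le_pow_left (by nlinarith) _
    _ = (n + 1) ^ 20 := by ring
    _ ≤ (2 ^ Nat.size n) ^ 20 := Nat.pow_le_pow_left h1 _
    _ = 2 ^ (20 * Nat.size n) := by rw [← pow_mul, mul_comm]
    _ ≤ 2 ^ w := Nat.pow_le_pow_right (by norm_num) hw

/-- A diagonal argument: a property that for every error `ε` holds with some exponent for all large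
`n` holds with every vanishing exponent and some vanishing error. -/
theorem exists_vanishing {Q : ℕ → ℝ → ℝ → Prop}
    (hQ : ∀ n e e' d, 1 ≤ n → e ≤ e' → Q n e' d → Q n e d)
    (h : ∀ ε > 0, ∃ e > 0, ∀ᶠ n in atTop, Q n e ε) (η : ℕ → ℝ) (hη : Tendsto η atTop (𝓝 0)) :
    ∃ δ : ℕ → ℝ, Tendsto δ atTop (𝓝 0) ∧ ∀ᶠ n in atTop, Q n (η n) (δ n) := by
  have h1 : ∀ m : ℕ, ∃ N, ∀ n ≥ N, Q n (η n) (1 / ((m : ℝ) + 1)) := by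
    intro m
    obtain ⟨e, he, hev⟩ := h (1 / ((m : ℝ) + 1)) (by positivity)
    refine eventually_atTop.1 ?_
    filter_upwards [hev, hη.eventually (gt_mem_nhds he), eventually_ge_atTop 1] with n h1 h2 h3
    exact hQ n _ _ _ h3 h2.le h1
  choose N hN using h1
  -- The finest error `1 / (m + 1)` with `m ≤ n` whose threshold `N m` has been passed; it improves
  -- without limit as `n` grows.
  let f : ℕ → ℕ := fun n => Nat.findGreatest (fun m => N m ≤ n) n
  have hf : Tendsto f atTop atTop := by
    refine tendsto_atTop.2 fun M => ?_
    filter_upwards [eventually_ge_atTop (max (N M) M)] with n hn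
    exact Nat.le_findGreatest ((le_max_right _ _).trans hn) ((le_max_left _ _).trans hn)
  refine ⟨fun n => 1 / ((f n : ℝ) + 1), tendsto_one_div_add_atTop_nhds_zero_nat.comp hf, ?_⟩
  filter_upwards [eventually_ge_atTop (N 0)] with n hn
  exact hN _ _ (Nat.findGreatest_spec (P := fun m => N m ≤ n) (Nat.zero_le n) hn)

theorem DensityBounded.mono {e e' : ℝ} (hn : 1 ≤ n) (h : e ≤ e') (hG : DensityBounded G e) :
    DensityBounded G e' :=
  ⟨hG.1, hG.2.1, hG.2.2.trans (Real.rpow_le_rpow_of_exponent_le (by exact_mod_cast hn) h)⟩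

theorem support_subset_of_val {w T : ℕ} {P : Prog} {S : Set Config}
    (h : 1 ≤ val w G S T ⟨[P], Mem.init w n⟩) : ∀ c ∈ (runFor P w G T).support, c ∈ S := by
  rw [val] at h
  have h1 : (runFor P w G T).toOuterMeasure S = 1 := by
    refine le_antisymm (toOuterMeasure_le_one _ _) ?_
    have := (ENNReal.ofReal_le_iff_le_toReal
      ((toOuterMeasure_le_one _ S).trans_lt ENNReal.one_lt_top).ne).2 h
    rwa [ENNReal.ofReal_one] at this
  exact fun c hc => (PMF.toOuterMeasure_apply_eq_one_iff _ _).1 h1 hc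

end Target

/-! ### Success of the two programs for a fixed error -/

section Main

open Real

theorem detProg_randFree : detProg.RandFree := by
  simp [detProg, readDensity, computeParams, selectVertices, finalize, forLoop, copyReg, countShrink,
    computeRoot, maxInBlock, classify, trieWalk, trieStep, recordLeaf, listLeft, listRight,
    Prog.RandFree]

theorem randProg_degFree : randProg.DegFree := by
  simp [randProg, fillRandom, estimateDensity, computeParams, finalize, forLoop, copyReg, countShrink,
    computeRoot, classify, trieWalk, trieStep, recordLeaf, listLeft, listRight, Prog.DegFree]

theorem succeeds_halted {n : ℕ} {G : SimpleGraph (Fin n)} {ε : ℝ} :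
    ∀ c ∈ {c | Succeeds G ε c}, c.Halted := fun _ hc => hc.1

theorem detProg_succeeds {ε : ℝ} (hε : 0 < ε) : ∃ e > 0, ∀ᶠ n : ℕ in atTop,
    ∀ w : ℕ, 20 * Nat.size n ≤ w → ∀ G : SimpleGraph (Fin n), DensityBounded G e →
      timeBound 8000 G ≤ (n : ℝ) ^ (1 + ε) ∧
      ∀ c ∈ (runFor detProg w G ⌊timeBound 8000 G⌋₊).support, Succeeds G ε c := by
  obtain ⟨K, hK⟩ := exists_nat_ge (8 / ε)
  obtain ⟨e, he, n₀, hgood⟩ := exists_goodParams (max K 8)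
  refine ⟨min e (ε / 3), lt_min he (by positivity), ?_⟩
  filter_upwards [eventually_ge_atTop n₀, eventually_ge_atTop 2,
    eventually_mul_log_le 8000 (show 0 < ε / 3 by positivity)] with n hn hn2 hlog w hw G hG
  refine ⟨timeBound_le (min_le_right _ _) (by omega) hlog hG, ?_⟩
  obtain ⟨h0, h1⟩ := (hG.mono (by omega) (min_le_left e (ε / 3))).log_inv_le (by omega)
  obtain ⟨hγ0, hγ1, -⟩ := hG
  have hn' : (2 : ℝ) ≤ n := by exact_mod_cast hn2
  have hb : (((n - 1) * n : ℕ) : ℝ) = (n - 1) * n := by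
    rw [Nat.cast_mul, Nat.cast_sub (by omega), Nat.cast_one]
  have hb0 : (0 : ℝ) < (n - 1) * n := mul_pos (by linarith) (by linarith)
  have ha : (degreeSum G : ℝ) = density G * ((n - 1) * n) := by rw [degreeSum_eq]; ring
  have hp : (degreeSum G : ℝ) / ((n - 1) * n : ℕ) = density G := by
    rw [hb, ha, mul_div_assoc, div_self hb0.ne', mul_one]
  have ha0 : 0 < degreeSum G := by
    have : (0 : ℝ) < degreeSum G := by rw [ha]; positivity
    exact_mod_cast this
  have hab : degreeSum G < (n - 1) * n := by
    have : (degreeSum G : ℝ) < ((n - 1) * n : ℕ) := by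
      rw [ha, hb]; exact mul_lt_of_lt_one_left hb0 hγ1
    exact_mod_cast this
  obtain ⟨hk, h⟩ := hgood n hn _ _ ha0 hab (by rwa [hp]) (by rwa [hp])
  rw [hp] at h
  obtain ⟨k, hkdef⟩ : ∃ k, accuracy n (degreeSum G) ((n - 1) * n) = k := ⟨_, rfl⟩
  obtain ⟨r, hr⟩ : ∃ r, leftSize n (degreeSum G) ((n - 1) * n) = r := ⟨_, rfl⟩
  obtain ⟨t, ht⟩ : ∃ t, bicliqueSize n (degreeSum G) ((n - 1) * n) = t := ⟨_, rfl⟩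
  rw [hkdef] at hk
  rw [hkdef, hr, ht] at h
  have hk8 : 8 ≤ k := (le_max_right _ _).trans hk
  have hk8' : (8 : ℝ) ≤ k := by exact_mod_cast hk8
  have hkK : (K : ℝ) ≤ k := by exact_mod_cast (le_max_left _ _).trans hk
  obtain ⟨hsize, hrle⟩ := h.abs_sub_le hk8 hγ0 hγ1 hγ0 hγ1 (by
    rw [sub_self, abs_zero]
    have : 0 < 1 - density G := by linarith
    positivity)
  have hT0 : 0 ≤ targetSize G := by
    rw [targetSize_eq]
    have := binEntropy_pos hγ0 hγ1
    have := log_natCast_nonneg n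
    positivity
  have hkε : 8 / (k : ℝ) ≤ ε := by
    rw [div_le_iff₀ (by linarith)]
    rw [div_le_iff₀ hε] at hK
    nlinarith
  -- The constant `8000` is `1000 * 2 * 2 * 2`, from `n + 1 ≤ 2 * n`, `r + 1 ≤ 2 * r` and `r ≤ 2 *
  -- log n / H`.
  have htime : 1000 * ((n + 1) * (r + 1)) ≤ ⌊timeBound 8000 G⌋₊ := by
    refine Nat.le_floor ?_
    have hr1 : (1 : ℝ) ≤ r := by exact_mod_cast h.one_le_left (by omega)
    rw [timeBound_eq]
    push_cast
    calc 1000 * (((n : ℝ) + 1) * (r + 1)) ≤ 1000 * ((2 * n) * (2 * r)) := by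
          gcongr <;> linarith
      _ ≤ 1000 * ((2 * n) * (2 * (2 * (log n / binEntropy (density G))))) := by gcongr
      _ = _ := by ring
  have hrun := run_detProg (w := w) (pow_le_two_pow (by omega) hw) (by omega) (G := G) rfl rfl hr ht
    rfl
  suffices hval : 1 ≤ val w G {c | Succeeds G ε c} (0 + 1000 * ((n + 1) * (r + 1)))
      ⟨[detProg], Mem.init w n⟩ by
    rw [zero_add] at hval
    exact support_subset_of_val (S := {c | Succeeds G ε c})
      (hval.trans (val_mono succeeds_halted htime _))
  refine hrun.le_val succeeds_halted ?_
  rintro s' ⟨hs, A, B, hA, hB, hout⟩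
  refine (val_done ?_ succeeds_halted 0).ge
  refine ⟨rfl, hout (h.forced_of_max (by omega) hγ0 hγ1 rfl rfl hA hB), ?_⟩
  change |((s'.reg 0 : ℕ) : ℝ) - targetSize G| ≤ _
  rw [hs]
  exact hsize.trans (mul_le_mul_of_nonneg_right hkε hT0)

/-- The average of the constant `1`: every outcome of the sampling leads to a halt, even an atypical
one. -/
theorem randProg_halts {w n : ℕ} (hn : 1 ≤ n) (hw : 20 * Nat.size n ≤ w)
    (G : SimpleGraph (Fin n)) : 1 ≤ val w G {c | c.Halted} (1000 * (n + 1)) ⟨[randProg],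
      Mem.init w n⟩ := by
  refine le_trans ?_ (le_val_randProg (S := {c | c.Halted}) (fun c hc => hc)
    (pow_le_two_pow hn hw) hn (fun Z => rfl) (fun Z => rfl) (fun Z => rfl)
    (F := fun _ _ _ => 1) fun Z A B s' _ _ => ?_)
  · exact avgFill_ge fun Z _ => avgFill_ge fun A _ => avgFill_ge fun B _ => le_rfl
  · exact (val_done (show (⟨[], s'⟩ : Config).todo = [] from rfl) (fun c hc => hc) 0).ge

/-- A vertex may be paired with itself, which is never an edge; hence `n - 1` and a slightly biased
estimate. -/
theorem sum_blockMean_adjBit {n : ℕ} (hn : 1 ≤ n) (G : SimpleGraph (Fin n)) :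
    ∑ i ∈ Finset.range n, blockMean n (fun i v => (adjBit G i (v % n) : ℝ)) i =
      density G * (n - 1) := by
  have hn0 : (n : ℝ) ≠ 0 := by exact_mod_cast (by omega : n ≠ 0)
  have h : ∀ i, blockMean n (fun i v => (adjBit G i (v % n) : ℝ)) i = natDegree G i / n := by
    intro i
    rw [blockMean, natDegree_eq_sum]
    push_cast
    congr 1
    refine Finset.sum_congr rfl fun v hv => ?_
    rw [Nat.mul_add_mod_self_right, Nat.mod_eq_of_lt (Finset.mem_range.1 hv)]
  simp only [h]
  rw [← Finset.sum_div, ← Nat.cast_sum]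
  change (degreeSum G : ℝ) / n = _
  rw [degreeSum_eq]
  field_simp

/-- The sampled density is likely to be close to the density. -/
theorem avgFill_edgeCount {n : ℕ} (hn : 1 ≤ n) (G : SimpleGraph (Fin n)) (hγ1 : density G ≤ 1)
    {α d : ℝ} (hα : α ≤ 1) (hd : 2 ≤ d * n) {F : (ℕ → ℕ) → ℝ} (hF0 : ∀ Z, 0 ≤ F Z)
    (hF : ∀ Z, |(edgeCount G Z : ℝ) / n - density G| ≤ d → α ≤ F Z) :
    α - 4 / (d ^ 2 * n) ≤ avgFill n n 0 (fun _ => 0) F := by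
  have hn0 : (0 : ℝ) < n := by exact_mod_cast hn
  have hd0 : 0 < d := pos_of_mul_pos_left (by linarith) hn0.le
  have hmean := sum_blockMean_adjBit hn G
  -- Half of the tolerance `d * n` is for the random deviation; the other half, at least `1`,
  -- absorbs the bias `density G ≤ 1`.
  refine le_trans (le_of_eq ?_) (avgFill_chebyshev (α := α) (l := d * n / 2) (V := n) hn
    (fun i v => (adjBit G i (v % n) : ℝ)) (by positivity) hα ?_ (fun Z _ => hF0 Z) fun Z _ hZ => ?_)
  · field_simp
    norm_num
  · calc _ ≤ ∑ i ∈ Finset.range n, blockMean n (fun i v => (adjBit G i (v % n) : ℝ)) i := by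
          refine Finset.sum_le_sum fun j _ => ?_
          refine (block_variance_le hn (fun v => (adjBit G j ((j * n + v) % n) : ℝ))
            (fun v _ => by positivity) (fun v _ => by exact_mod_cast adjBit_le _ _) rfl le_rfl
            zero_le_one).trans (le_of_eq ?_)
          rw [blockMean]; ring
      _ ≤ n := by
          have h1 := degreeSum_le (G := G)
          rw [hmean]
          have h2 := degreeSum_eq G
          have h3 : (degreeSum G : ℝ) ≤ n * n := by
            exact_mod_cast h1.trans (Nat.mul_le_mul_right _ (Nat.sub_le _ _))
          refine le_of_mul_le_mul_right ?_ hn0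
          linarith
  · refine hF Z ?_
    rw [hmean] at hZ
    have h1 : ∑ i ∈ Finset.range n, (adjBit G i (Z i % n) : ℝ) = edgeCount G Z := by
      rw [edgeCount]; push_cast; rfl
    rw [h1] at hZ
    have hγ0 := density_nonneg (G := G)
    have h2 : (edgeCount G Z : ℝ) / n - density G = (edgeCount G Z - density G * n) / n := by
      field_simp
    rw [h2, abs_div, abs_of_pos hn0, div_le_iff₀ hn0]
    rw [abs_lt] at hZ
    rw [abs_le]
    constructor <;> linarith

theorem randProg_succeeds {ε : ℝ} (hε : 0 < ε) : ∃ e > 0, ∀ᶠ n : ℕ in atTop,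
    ∀ w : ℕ, 20 * Nat.size n ≤ w → ∀ G : SimpleGraph (Fin n), DensityBounded G e →
      timeBound 8000 G ≤ (n : ℝ) ^ (1 + ε) ∧
      (∀ c ∈ (runFor randProg w G ⌊timeBound 8000 G⌋₊).support, c.Halted) ∧
      ENNReal.ofReal (1 - ε) ≤
        (runFor randProg w G ⌊timeBound 8000 G⌋₊).toOuterMeasure {c | Succeeds G ε c} := by
  classical
  -- The search may fail with probability `ε / 2`, and so may the density estimate.
  obtain ⟨K, hK⟩ := exists_nat_ge (2 * 19201 / ε)
  obtain ⟨K', hK'⟩ : ∃ K', K' = max K (max 8 ⌈8 / ε⌉₊) := ⟨_, rfl⟩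
  have hKK : K ≤ K' := hK' ▸ le_max_left _ _
  have hK8 : 8 ≤ K' := hK' ▸ (le_max_left _ _).trans (le_max_right _ _)
  have hKε : 8 / ε ≤ K' := (Nat.le_ceil _).trans (by
    exact_mod_cast hK' ▸ (le_max_right _ _).trans (le_max_right _ _))
  have hK0 : (0 : ℝ) < K' := by exact_mod_cast (by omega : 0 < K')
  obtain ⟨e, he, n₀, hgood⟩ := exists_goodParams K'
  -- The bound `e / 2` leaves room for replacing the density by its estimate, `1 / 8` makes the
  -- sampling error `n ^ (-1/4)` less than half the density and half its complement, and `ε / 3`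
  -- serves the time bound.
  obtain ⟨e', he'⟩ : ∃ e', e' = min (min (e / 2) (1 / 8)) (ε / 3) := ⟨_, rfl⟩
  have he1 : e' ≤ e / 2 := he' ▸ (min_le_left _ _).trans (min_le_left _ _)
  have he2 : e' ≤ 1 / 8 := he' ▸ (min_le_left _ _).trans (min_le_right _ _)
  have he3 : e' ≤ ε / 3 := he' ▸ min_le_right _ _
  refine ⟨e', he' ▸ lt_min (lt_min (by positivity) (by norm_num)) (by positivity), ?_⟩
  have hlogn := tendsto_log_atTop.comp (tendsto_natCast_atTop_atTop (R := ℝ))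
  have hexp : ∀ᶠ n : ℕ in atTop, 4 * exp (-(log n / 2)) ≤ ε / 2 := by
    have h1 : ∀ᶠ x : ℝ in atTop, 4 * exp (-(x / 2)) ≤ ε / 2 := by
      have h2 : Tendsto (fun x : ℝ => 4 * exp (-(x / 2))) atTop (𝓝 (4 * 0)) :=
        (tendsto_exp_neg_atTop_nhds_zero.comp (tendsto_id.atTop_div_const two_pos)).const_mul 4
      rw [mul_zero] at h2
      exact h2.eventually (ge_mem_nhds (by positivity))
    exact hlogn.eventually h1
  filter_upwards [eventually_ge_atTop n₀, eventually_ge_atTop 2,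
    eventually_mul_log_le 8000 (show 0 < ε / 3 by positivity), hexp,
    hlogn.eventually_ge_atTop 8, hlogn.eventually_ge_atTop (2 * log 2 / e)]
    with n hn hn2 hlog hexpn hL8 hLe w hw G hG
  simp only [Function.comp] at hL8 hLe
  refine ⟨timeBound_le he3 (by omega) hlog hG, ?_⟩
  obtain ⟨h0, h1⟩ := hG.log_inv_le (by omega)
  obtain ⟨hγ0, hγ1, -⟩ := hG
  have hn' : (2 : ℝ) ≤ n := by exact_mod_cast hn2
  have hlog2 : log 2 ≤ 1 := by have := log_two_lt_d9; linarith
  have hH0 := binEntropy_pos hγ0 hγ1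
  have htime : 1000 * (n + 1) ≤ ⌊timeBound 8000 G⌋₊ := by
    refine Nat.le_floor ?_
    have h2 : 1 ≤ log n / binEntropy (density G) := by
      rw [one_le_div hH0]
      have := binEntropy_le_log_two (p := density G)
      linarith
    rw [timeBound_eq]
    push_cast
    calc 1000 * ((n : ℝ) + 1) ≤ 8000 * (n * 1) := by linarith
      _ ≤ _ := by gcongr
  constructor
  · exact support_subset_of_val (S := {c | c.Halted}) ((randProg_halts (by omega) hw G).trans
      (val_mono (fun c hc => hc) htime _))
  have hT0 : 0 ≤ targetSize G := by
    rw [targetSize_eq]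
    have := log_natCast_nonneg n
    positivity
  refine ENNReal.ofReal_le_of_le_toReal ?_
  change _ ≤ val w G {c | Succeeds G ε c} _ _
  refine le_trans ?_ (val_mono succeeds_halted htime _)
  -- The function `F` is the indicator that the candidates force a biclique and that its size is in
  -- range; such runs succeed.
  refine le_trans ?_ (le_val_randProg (S := {c | Succeeds G ε c}) succeeds_halted
    (pow_le_two_pow (by omega) hw) (by omega) (fun Z => rfl) (fun Z => rfl) (fun Z => rfl)
    (F := fun Z A B => if Forced G A B (leftSize n (edgeCount G Z) n)
      (n / leftSize n (edgeCount G Z) n) (bicliqueSize n (edgeCount G Z) n) ∧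
      |(bicliqueSize n (edgeCount G Z) n : ℝ) - targetSize G| ≤ ε * targetSize G then 1 else 0)
    fun Z A B s' hs hout => ?_)
  swap
  · split
    · rename_i h
      refine (val_done ?_ succeeds_halted 0).ge
      refine ⟨rfl, hout h.1, ?_⟩
      change |((s'.reg 0 : ℕ) : ℝ) - targetSize G| ≤ _
      rw [hs]
      exact h.2
    · exact val_nonneg _ _ _
  -- The tolerance is `n ^ (-1/4)`, so that the sampling fails with probability at most `4 * n ^
  -- (-1/2)`.
  obtain ⟨d, hd⟩ : ∃ d, d = exp (-(log n / 4)) := ⟨_, rfl⟩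
  have hnL : (n : ℝ) = exp (log n) := (exp_log (by linarith)).symm
  have hdn : d ^ 2 * n = exp (log n / 2) := by
    rw [hd, ← exp_nat_mul]
    nth_rewrite 2 [hnL]
    rw [← exp_add]
    ring_nf
  have hdn2 : 2 ≤ d * n := by
    rw [hd]
    nth_rewrite 2 [hnL]
    rw [← exp_add]
    have := add_one_le_exp (-(log n / 4) + log n)
    linarith
  have hdγ : ∀ x : ℝ, 0 < x → log x⁻¹ ≤ e' * log n → d ≤ x / 2 := by
    intro x hx hlx
    rw [← log_le_log_iff (by rw [hd]; positivity) (by positivity), hd, log_exp,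
      log_div hx.ne' (by norm_num)]
    rw [log_inv] at hlx
    have : e' * log n ≤ 1 / 8 * log n := mul_le_mul_of_nonneg_right he2 (by linarith)
    linarith
  have hd1 := hdγ _ hγ0 h0
  have hd2 := hdγ (1 - density G) (by linarith) h1
  have hα : 19201 / (K' : ℝ) ≤ ε / 2 := by
    rw [div_le_iff₀ hK0]
    rw [div_le_iff₀ hε] at hK
    have : (K : ℝ) * ε ≤ K' * ε := mul_le_mul_of_nonneg_right (by exact_mod_cast hKK) hε.le
    linarith
  have hfail : 4 / (d ^ 2 * n) ≤ ε / 2 := by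
    rw [hdn, div_eq_mul_inv, ← exp_neg]
    exact hexpn
  have hK1 : 0 ≤ 19201 / (K' : ℝ) := by positivity
  refine le_trans (by linarith) (avgFill_edgeCount (α := 1 - 19201 / K') (d := d) (by omega) G
    hγ1.le (by linarith) hdn2 (fun Z => avgFill_ge fun A _ => avgFill_ge fun B _ => by split <;> norm_num)
    fun Z hZ => ?_)
  obtain ⟨a, ha⟩ : ∃ a, a = edgeCount G Z := ⟨_, rfl⟩
  rw [← ha] at hZ ⊢
  obtain ⟨p, hp⟩ : ∃ p, p = (a : ℝ) / n := ⟨_, rfl⟩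
  have hZ' := hZ
  rw [← hp] at hZ'
  have hpγ := abs_le.1 hZ'
  have hp0 : 0 < p := by linarith
  have hp1 : p < 1 := by linarith
  have ha0 : 0 < a := by
    by_contra h
    have : a = 0 := by omega
    rw [hp, this] at hp0
    simp at hp0
  have han : a < n := by
    rw [hp, div_lt_one (by linarith)] at hp1
    exact_mod_cast hp1
  -- The estimate may lose a factor `2`, and `log 2 ≤ e / 2 * log n` for large `n`.
  have hee : ∀ x y : ℝ, 0 < x → x / 2 ≤ y → log x⁻¹ ≤ e' * log n → log y⁻¹ ≤ e * log n := by
    intro x y hx hxy hlx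
    have h2 := log_inv_le_of_near hx hxy
    have h3 : e' * log n ≤ e / 2 * log n := mul_le_mul_of_nonneg_right he1 (by linarith)
    rw [div_le_iff₀ he] at hLe
    linarith
  obtain ⟨hk, h⟩ := hgood n hn a n ha0 han (by rw [← hp]; exact hee _ _ hγ0 (by linarith) h0)
    (by rw [← hp]; exact hee (1 - density G) _ (by linarith) (by linarith) h1)
  rw [← hp] at h
  obtain ⟨k, hkdef⟩ : ∃ k, accuracy n a n = k := ⟨_, rfl⟩
  obtain ⟨r, hr⟩ : ∃ r, leftSize n a n = r := ⟨_, rfl⟩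
  obtain ⟨t, ht⟩ : ∃ t, bicliqueSize n a n = t := ⟨_, rfl⟩
  rw [hkdef] at hk
  rw [hkdef, hr, ht] at h
  rw [hr, ht]
  have hkK : (K' : ℝ) ≤ k := by exact_mod_cast hk
  have hnear : |p - density G| ≤ p * (1 - p) / (8 * k) := hZ'.trans (hd ▸ h.root_le)
  obtain ⟨hsize, -⟩ := h.abs_sub_le (by omega) hp0 hp1 hγ0 hγ1 hnear
  have hkε : 8 / (k : ℝ) ≤ ε := by
    rw [div_le_iff₀ (by linarith)]
    rw [div_le_iff₀ hε] at hKε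
    have := mul_le_mul_of_nonneg_right hkK hε.le
    linarith
  refine le_trans ?_ (h.avgFill_forced (G := G) (by omega) hp0 hp1 rfl hnear
    (fun A B => by split <;> norm_num) fun A B hAB => ?_)
  · exact sub_le_sub_left (div_le_div_of_nonneg_left (by norm_num) hK0 hkK) _
  · rw [if_pos ⟨hAB, hsize.trans (mul_le_mul_of_nonneg_right hkε hT0)⟩]

end Main

end BicliqueRAM

theorem mainTheorem6 :
    -- randomized algorithm, with adjacency queries only
    (∃ P : BicliqueRAM.Prog, P.DegFree ∧ ∃ (b : ℕ) (C : ℝ), 0 < C ∧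
      ∀ η : ℕ → ℝ, Tendsto η atTop (𝓝 0) →
        ∃ δ : ℕ → ℝ, Tendsto δ atTop (𝓝 0) ∧
          ∀ᶠ n : ℕ in atTop, ∀ w : ℕ, b * Nat.size n ≤ w →
            ∀ G : SimpleGraph (Fin n), BicliqueRAM.DensityBounded G (η n) →
              BicliqueRAM.timeBound C G ≤ (n : ℝ) ^ (1 + δ n) ∧
              (∀ c ∈ (BicliqueRAM.runFor P w G ⌊BicliqueRAM.timeBound C G⌋₊).support,
                c.Halted) ∧
              ENNReal.ofReal (1 - δ n) ≤
                (BicliqueRAM.runFor P w G ⌊BicliqueRAM.timeBound C G⌋₊).toOuterMeasure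
                  {c | BicliqueRAM.Succeeds G (δ n) c}) ∧
    -- deterministic algorithm, with adjacency and degree queries
    (∃ P : BicliqueRAM.Prog, P.RandFree ∧ ∃ (b : ℕ) (C : ℝ), 0 < C ∧
      ∀ η : ℕ → ℝ, Tendsto η atTop (𝓝 0) →
        ∃ δ : ℕ → ℝ, Tendsto δ atTop (𝓝 0) ∧
          ∀ᶠ n : ℕ in atTop, ∀ w : ℕ, b * Nat.size n ≤ w →
            ∀ G : SimpleGraph (Fin n), BicliqueRAM.DensityBounded G (η n) →
              BicliqueRAM.timeBound C G ≤ (n : ℝ) ^ (1 + δ n) ∧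
              ∀ c ∈ (BicliqueRAM.runFor P w G ⌊BicliqueRAM.timeBound C G⌋₊).support,
                BicliqueRAM.Succeeds G (δ n) c) := by
  refine ⟨⟨BicliqueRAM.randProg, BicliqueRAM.randProg_degFree, 20, 8000, by norm_num, ?_⟩,
    ⟨BicliqueRAM.detProg, BicliqueRAM.detProg_randFree, 20, 8000, by norm_num, ?_⟩⟩
  · exact BicliqueRAM.exists_vanishing
      (fun n e e' d hn he h w hw G hG => h w hw G (hG.mono hn he))
      fun ε hε => BicliqueRAM.randProg_succeeds hε
  · exact BicliqueRAM.exists_vanishing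
      (fun n e e' d hn he h w hw G hG => h w hw G (hG.mono hn he))
      fun ε hε => BicliqueRAM.detProg_succeeds hε
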